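/- Let $M$ be a smooth ($C^\infty$, finite-dimensional, Hausdorff) manifold without boundary, $X$ a smooth vector field on $M$ and $\mathcal V\subset TM$ a smooth distribution of rank $m$. Let $\mathcal D=\mathcal V+[X,\mathcal V]$ be the distribution spanned by the local sections $V$ of $\mathcal V$ and the Lie brackets $[X,V]$, and assume that the dynamic pair $(X,\mathcal V)$ is regular: $X$ has no zeros, $\operatorname{rk}\mathcal D=2m$, and $[X,\mathcal D]\subset\mathcal D$. Let $c\colon[0,T]\to M$ be an integral curve of $X$, $x_0=c(0)$. Notation. Fields along $c$ are regarded as functions of $t\in[0,T]$. In a local frame $(V_1,\dots,V_m)$ of $\mathcal V$ write $[X,[X,V_j]]=\sum_i (H_0)^i_jV_i+\sum_i (H_1)^i_j[X,V_i]$; the curvature operator $K_x\colon\mathcal V(x)\to\mathcal V(x)$ is the operator with matrix $-H_0+\tfrac12X(H_1)-\tfrac14H_1^2$ in this frame (it does not depend on the frame). A local section $W$ of $\mathcal V$ (along $c$) is normal if $[X,[X,W]]\in\mathcal V$; the horizontal space $\mathcal H$ is spanned by the brackets $[X,W]$ with $W$ normal, $\mathcal D=\mathcal V\oplus\mathcal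 H$ along $c$, and $D_XV=\pi_{\mathcal V}[X,V]$ for sections $V$ of $\mathcal V$ along $c$, where $\pi_{\mathcal V}$ is the projection onto $\mathcal V$ along $\mathcal H$. A vertical Jacobi field along $c$ is a smooth section $V$ of $\mathcal V$ along $c$ with $D_XD_XV+KV=0$. A time $t^*\in(0,T]$ is conjugate along $c$ if $\exp(t^*X)_*\mathcal V(x_0)\cap\mathcal V(c(t^*))\ne\{0\}$, where $\exp(tX)$ is the local flow of $X$, and the dimension of this intersection is the multiplicity of $t^*$. Proposition. For every $t^*\in(0,T]$, $t^*$ is a conjugate time along $c$ if and only if there exists a vertical Jacobi field $V$ along $c$, not identically zero on $[0,T]$, such that $$V(c(0))=0\quad\text{and}\quad V(c(t^*))=0 .$$ Moreover, the vertical Jacobi fields along $c$ satisfying these two conditions form a finite-dimensional real vector space, whose dimension (the number of linearly independent such fields) equals the multiplicity of $t^*$ (both being $0$ if $t^*$ is not conjugate). -/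

import Mathlib

open Set Filter Topology
open scoped Manifold ContDiff

namespace DynPair

noncomputable section

variable {E : Type*} [NormedAddCommGroup E] [NormedSpace ℝ E]
  {M : Type*} [TopologicalSpace M] [ChartedSpace E M]

/-! ### Vector fields and distributions on a manifold `M` modelled on `E` -/

/-- `X` is a `C^∞` vector field on the set `U`. -/
def SmoothOn [IsManifold 𝓘(ℝ, E) ∞ M]
    (X : ∀ x : M, TangentSpace 𝓘(ℝ, E) x) (U : Set M) : Prop :=
  ContMDiffOn 𝓘(ℝ, E) 𝓘(ℝ, E).tangent ∞
    (fun x => (⟨x, X x⟩ : TangentBundle 𝓘(ℝ, E) M)) U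

/-- `W` is a smooth section over `U` of the field of tangent subspaces `Δ`. -/
def IsSectionOn [IsManifold 𝓘(ℝ, E) ∞ M]
    (Δ : ∀ x : M, Submodule ℝ (TangentSpace 𝓘(ℝ, E) x))
    (W : ∀ x : M, TangentSpace 𝓘(ℝ, E) x) (U : Set M) : Prop :=
  SmoothOn W U ∧ ∀ x ∈ U, W x ∈ Δ x

/-- `e = (e_1, …, e_m)` is a smooth frame of `Δ` over `U`. -/
def IsFrameOn [IsManifold 𝓘(ℝ, E) ∞ M] {m : ℕ}
    (Δ : ∀ x : M, Submodule ℝ (TangentSpace 𝓘(ℝ, E) x))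
    (e : Fin m → ∀ x : M, TangentSpace 𝓘(ℝ, E) x) (U : Set M) : Prop :=
  (∀ i, SmoothOn (e i) U) ∧
    ∀ x ∈ U, LinearIndependent ℝ (fun i => e i x) ∧
      Submodule.span ℝ (range fun i => e i x) = Δ x

/-- `Δ` is a smooth distribution of rank `m` on `M`. -/
def IsDistribution [IsManifold 𝓘(ℝ, E) ∞ M]
    (Δ : ∀ x : M, Submodule ℝ (TangentSpace 𝓘(ℝ, E) x)) (m : ℕ) : Prop :=
  ∀ x : M, ∃ U : Set M, IsOpen U ∧ x ∈ U ∧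
    ∃ e : Fin m → ∀ y : M, TangentSpace 𝓘(ℝ, E) y, IsFrameOn Δ e U

/-- The Lie bracket `[X, Y]` of vector fields on `M`. -/
abbrev bracket (X Y : ∀ x : M, TangentSpace 𝓘(ℝ, E) x) : ∀ x : M, TangentSpace 𝓘(ℝ, E) x :=
  VectorField.mlieBracket 𝓘(ℝ, E) X Y

/-- The field of tangent subspaces `𝒟 = 𝒱 + [X, 𝒱]`, spanned by the values of the local sections
of `𝒱` and of their Lie brackets with `X`. -/
def derived [IsManifold 𝓘(ℝ, E) ∞ M] (X : ∀ x : M, TangentSpace 𝓘(ℝ, E) x)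
    (𝒱 : ∀ x : M, Submodule ℝ (TangentSpace 𝓘(ℝ, E) x)) (x : M) :
    Submodule ℝ (TangentSpace 𝓘(ℝ, E) x) :=
  𝒱 x ⊔ Submodule.span ℝ {v | ∃ (U : Set M) (W : ∀ y : M, TangentSpace 𝓘(ℝ, E) y),
    IsOpen U ∧ x ∈ U ∧ IsSectionOn 𝒱 W U ∧ v = bracket X W x}

/-- Regularity of the dynamic pair `(X, 𝒱)`, where `𝒱` has rank `m`: `X` has no zeros,
`𝒟 = 𝒱 + [X, 𝒱]` has the maximal rank `2 m`, and `[X, 𝒟] ⊆ 𝒟`. -/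
structure IsRegular [IsManifold 𝓘(ℝ, E) ∞ M] (X : ∀ x : M, TangentSpace 𝓘(ℝ, E) x)
    (𝒱 : ∀ x : M, Submodule ℝ (TangentSpace 𝓘(ℝ, E) x)) (m : ℕ) : Prop where
  ne_zero : ∀ x, X x ≠ 0
  finrank_derived : ∀ x, Module.finrank ℝ (derived X 𝒱 x) = 2 * m
  invariant : ∀ (U : Set M) (Y : ∀ x : M, TangentSpace 𝓘(ℝ, E) x), IsOpen U →
    IsSectionOn (derived X 𝒱) Y U → ∀ x ∈ U, bracket X Y x ∈ derived X 𝒱 x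

/-! ### The curvature operator -/

/-- The derivative along `X`, at `x`, of a matrix of functions on `M`. -/
def derivMatrix {m : ℕ} (X : ∀ x : M, TangentSpace 𝓘(ℝ, E) x)
    (A : M → Matrix (Fin m) (Fin m) ℝ) (x : M) : Matrix (Fin m) (Fin m) ℝ :=
  Matrix.of fun i j =>
    NormedSpace.fromTangentSpace _ (mfderiv 𝓘(ℝ, E) 𝓘(ℝ, ℝ) (fun y => A y i j) x (X x))

/-- `A` is the curvature matrix at `x` of `(X, 𝒱)` in the frame `e` of `𝒱` over `U`:
if `[X, [X, e_j]] = ∑ᵢ (H₀)ⁱⱼ eᵢ + ∑ᵢ (H₁)ⁱⱼ [X, eᵢ]` on `U`,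
then `A = -H₀ + ½ X(H₁) - ¼ H₁²` at `x`. -/
def HasCurvatureMatrix {m : ℕ} (X : ∀ x : M, TangentSpace 𝓘(ℝ, E) x)
    (e : Fin m → ∀ x : M, TangentSpace 𝓘(ℝ, E) x) (U : Set M) (x : M)
    (A : Matrix (Fin m) (Fin m) ℝ) : Prop :=
  ∃ H₀ H₁ : M → Matrix (Fin m) (Fin m) ℝ,
    (∀ y ∈ U, ∀ j, bracket X (bracket X (e j)) y =
      ∑ i, H₀ y i j • e i y + ∑ i, H₁ y i j • bracket X (e i) y) ∧
    A = -H₀ x + (1 / 2 : ℝ) • derivMatrix X H₁ x - (1 / 4 : ℝ) • (H₁ x * H₁ x)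

/-- `w = K_x v`, where `K_x : 𝒱(x) → 𝒱(x)` is the curvature operator of `(X, 𝒱)`: the operator
whose matrix, in a local frame of `𝒱` around `x`, is the curvature matrix in that frame. -/
def HasCurvature [IsManifold 𝓘(ℝ, E) ∞ M] (m : ℕ) (X : ∀ x : M, TangentSpace 𝓘(ℝ, E) x)
    (𝒱 : ∀ x : M, Submodule ℝ (TangentSpace 𝓘(ℝ, E) x)) (x : M)
    (v w : TangentSpace 𝓘(ℝ, E) x) : Prop :=
  ∃ (U : Set M) (e : Fin m → ∀ y : M, TangentSpace 𝓘(ℝ, E) y)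
    (A : Matrix (Fin m) (Fin m) ℝ) (a : Fin m → ℝ),
    IsOpen U ∧ x ∈ U ∧ IsFrameOn 𝒱 e U ∧ HasCurvatureMatrix X e U x A ∧
    v = ∑ i, a i • e i x ∧ w = ∑ i, (A.mulVec a) i • e i x

/-! ### Fields along a curve -/

/-- `W` is a smooth section of `𝒱` along `c`, over the parameter set `s`. -/
def IsSectionAlong [IsManifold 𝓘(ℝ, E) ∞ M]
    (𝒱 : ∀ x : M, Submodule ℝ (TangentSpace 𝓘(ℝ, E) x)) (c : ℝ → M) (s : Set ℝ)
    (W : ∀ t : ℝ, TangentSpace 𝓘(ℝ, E) (c t)) : Prop :=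
  ContMDiffOn 𝓘(ℝ, ℝ) 𝓘(ℝ, E).tangent ∞
    (fun t => (⟨c t, W t⟩ : TangentBundle 𝓘(ℝ, E) M)) s ∧
  ∀ t ∈ s, W t ∈ 𝒱 (c t)

/-- The coordinate vector of a tangent vector `p` in the chart of `M` centred at `x`. -/
def coord [IsManifold 𝓘(ℝ, E) ∞ M] (x : M) (p : TangentBundle 𝓘(ℝ, E) M) : E :=
  (trivializationAt E (TangentSpace 𝓘(ℝ, E) : M → Type _) x p).2

/-- The Lie bracket `[X, W]` at the parameter `t₀` of the vector field `X` with a field `W` along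
an integral curve `c` of `X` defined on `s`. In the chart around `c t₀` it is
`(d/dt) W - (dX) W`, the formula for the bracket of vector fields `[X, W] = (dW) X - (dX) W`, in
which `(dW) X` is the derivative of `W` along the integral curve. -/
def bracketAlong [IsManifold 𝓘(ℝ, E) ∞ M] (X : ∀ x : M, TangentSpace 𝓘(ℝ, E) x)
    (c : ℝ → M) (s : Set ℝ) (W : ∀ t : ℝ, TangentSpace 𝓘(ℝ, E) (c t)) (t₀ : ℝ) :
    TangentSpace 𝓘(ℝ, E) (c t₀) :=
  (trivializationAt E (TangentSpace 𝓘(ℝ, E) : M → Type _) (c t₀)).symm (c t₀)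
    (derivWithin (fun t => coord (c t₀) ⟨c t, W t⟩) s t₀ -
      fderiv ℝ (fun y : E => coord (c t₀) ⟨(extChartAt 𝓘(ℝ, E) (c t₀)).symm y, X _⟩)
        (extChartAt 𝓘(ℝ, E) (c t₀) (c t₀)) (coord (c t₀) ⟨c t₀, W t₀⟩))

/-- A section `W` of `𝒱` along the integral curve `c` is normal if `[X, [X, W]] ∈ 𝒱`. -/
def IsNormalAlong [IsManifold 𝓘(ℝ, E) ∞ M] (X : ∀ x : M, TangentSpace 𝓘(ℝ, E) x)
    (𝒱 : ∀ x : M, Submodule ℝ (TangentSpace 𝓘(ℝ, E) x)) (c : ℝ → M) (s : Set ℝ)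
    (W : ∀ t : ℝ, TangentSpace 𝓘(ℝ, E) (c t)) : Prop :=
  IsSectionAlong 𝒱 c s W ∧
    ∀ t ∈ s, bracketAlong X c s (bracketAlong X c s W) t ∈ 𝒱 (c t)

/-- The horizontal space `ℋ(c(t))`, spanned by the brackets `[X, W]` of `X` with the local normal
sections `W` of `𝒱` along `c` around the parameter `t`. -/
def horizontal [IsManifold 𝓘(ℝ, E) ∞ M] (X : ∀ x : M, TangentSpace 𝓘(ℝ, E) x)
    (𝒱 : ∀ x : M, Submodule ℝ (TangentSpace 𝓘(ℝ, E) x)) (c : ℝ → M) (s : Set ℝ) (t : ℝ) :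
    Submodule ℝ (TangentSpace 𝓘(ℝ, E) (c t)) :=
  Submodule.span ℝ {v | ∃ (J : Set ℝ) (W : ∀ r : ℝ, TangentSpace 𝓘(ℝ, E) (c r)),
    IsOpen J ∧ t ∈ J ∧ IsNormalAlong X 𝒱 c (s ∩ J) W ∧ v = bracketAlong X c (s ∩ J) W t}

/-- `Z = D_X V` along `c`: the section `Z` of `𝒱` is the vertical part `π_𝒱 [X, V]` of `[X, V]`
for the splitting `𝒟 = 𝒱 ⊕ ℋ`. -/
def HasCovDerivAlong [IsManifold 𝓘(ℝ, E) ∞ M] (X : ∀ x : M, TangentSpace 𝓘(ℝ, E) x)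
    (𝒱 : ∀ x : M, Submodule ℝ (TangentSpace 𝓘(ℝ, E) x)) (c : ℝ → M) (s : Set ℝ)
    (V Z : ∀ t : ℝ, TangentSpace 𝓘(ℝ, E) (c t)) : Prop :=
  IsSectionAlong 𝒱 c s Z ∧
    ∀ t ∈ s, bracketAlong X c s V t - Z t ∈ horizontal X 𝒱 c s t

/-- `V` is a vertical Jacobi field along `c`: a section of `𝒱` with `D_X D_X V + K V = 0`. -/
def IsVerticalJacobi [IsManifold 𝓘(ℝ, E) ∞ M] (m : ℕ) (X : ∀ x : M, TangentSpace 𝓘(ℝ, E) x)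
    (𝒱 : ∀ x : M, Submodule ℝ (TangentSpace 𝓘(ℝ, E) x)) (c : ℝ → M) (s : Set ℝ)
    (V : ∀ t : ℝ, TangentSpace 𝓘(ℝ, E) (c t)) : Prop :=
  IsSectionAlong 𝒱 c s V ∧
    ∃ DV DDV KV : ∀ t : ℝ, TangentSpace 𝓘(ℝ, E) (c t),
      HasCovDerivAlong X 𝒱 c s V DV ∧ HasCovDerivAlong X 𝒱 c s DV DDV ∧
      (∀ t ∈ s, HasCurvature m X 𝒱 (c t) (V t) (KV t)) ∧
      ∀ t ∈ s, DDV t + KV t = 0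

/-! ### The flow and conjugate times -/

open Classical in
/-- The flow map `exp(tX)`, `t ≥ 0`: the value at time `t` of the integral curve of `X` that starts
at `y`; a point whose integral curve does not reach time `t` is left fixed (a junk value). -/
def flow (X : ∀ x : M, TangentSpace 𝓘(ℝ, E) x) (t : ℝ) (y : M) : M :=
  if h : ∃ γ : ℝ → M, γ 0 = y ∧ IsMIntegralCurveOn γ X (Icc 0 t) then h.choose t else y

/-- Integral curves of `X` with the same initial point agree at later times. -/
theorem integralCurve_eq [CompleteSpace E] [T2Space M] [IsManifold 𝓘(ℝ, E) ∞ M]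
   {X : ∀ x : M, TangentSpace 𝓘(ℝ, E) x} (hX : SmoothOn X univ) {γ c : ℝ → M} {t : ℝ} (ht : 0 < t)
   (hγ : IsMIntegralCurveOn γ X (Icc 0 t)) (hc : IsMIntegralCurveOn c X (Icc 0 t)) (h0 : γ 0 = c 0) :
   γ t = c t := by
  have : IsManifold 𝓘(ℝ, E) 1 M := IsManifold.of_le (n := ∞) (by simp)
  have hX1 : ContMDiff 𝓘(ℝ, E) 𝓘(ℝ, E).tangent 1 (fun x => (⟨x, X x⟩ : TangentBundle 𝓘(ℝ, E) M)) :=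
    (contMDiffOn_univ.1 hX).of_le (by simp)
  obtain ⟨δ, hδ0, hδ⟩ := exists_isMIntegralCurveAt_of_contMDiffAt_boundaryless 0 (hX1 (c 0))
  obtain ⟨ε, hε, hδ⟩ := isMIntegralCurveAt_iff'.1 hδ
  have key : ∀ g : ℝ → M, g 0 = c 0 → IsMIntegralCurveOn g X (Icc 0 t) →
      IsMIntegralCurveOn (fun r => if r ≤ 0 then δ r else g r) X (Ioo (-ε) t) := by
    intro g hg0 hg r hr
    set G : ℝ → M := fun r => if r ≤ 0 then δ r else g r with hG
    have e1 : EqOn G δ (Iic 0) := fun x hx => by simp [hG, mem_Iic.1 hx]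
    have e2 : EqOn G g (Ici 0) := fun x hx => by
      rcases (mem_Ici.1 hx).eq_or_lt with h | h
      · subst h; simp [hG, hδ0, hg0]
      · simp [hG, not_le.2 h]
    have hsub : Ioo (-ε) t ⊆ (Ioc (-ε) 0) ∪ (Ico 0 t) := by
      intro x hx; rcases le_total x 0 with h | h
      · exact Or.inl ⟨hx.1, h⟩
      · exact Or.inr ⟨h, hx.2⟩
    have A : r ≤ 0 → HasMFDerivAt[Ioc (-ε) 0] G r ((1 : ℝ →L[ℝ] ℝ).smulRight (X (G r))) := by
      intro h
      have := (hδ r (by simp [abs_lt]; constructor <;> linarith [hr.1])).mono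
        (t := Metric.ball 0 ε) (s := Ioc (-ε) 0) (by intro x hx; simp [abs_lt]; constructor <;> linarith [hx.1, hx.2])
      rw [← e1 h] at this
      exact this.congr_of_eventuallyEq (eventually_mem_nhdsWithin.mono fun x hx => e1 hx.2) (e1 h)
    have B : 0 ≤ r → HasMFDerivAt[Ico 0 t] G r ((1 : ℝ →L[ℝ] ℝ).smulRight (X (G r))) := by
      intro h
      have := (hg r ⟨h, hr.2.le⟩).mono (s := Ico 0 t) Ico_subset_Icc_self
      rw [← e2 h] at this
      exact this.congr_of_eventuallyEq (eventually_mem_nhdsWithin.mono fun x hx => e2 hx.1) (e2 h)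
    rcases lt_trichotomy r 0 with h | h | h
    · have := (A h.le).hasMFDerivAt (Ioc_mem_nhds hr.1 h)
      exact this.hasMFDerivWithinAt
    · exact ((A h.le).union (B h.ge)).mono hsub
    · have := (B h.le).hasMFDerivAt (Ico_mem_nhds h hr.2)
      exact this.hasMFDerivWithinAt
  have E0 := isMIntegralCurveOn_Ioo_eqOn_of_contMDiff_boundaryless (t₀ := 0) ⟨by linarith, ht⟩ hX1
    (key γ h0 hγ) (key c rfl hc) (by simp)
  have E1 : EqOn γ c (Ioo 0 t) := fun x hx => by
    simpa [not_le.2 hx.1] using E0 ⟨by linarith [hx.1], hx.2⟩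
  have hcl : t ∈ closure (Ioo 0 t) := by rw [closure_Ioo ht.ne]; exact ⟨ht.le, le_rfl⟩
  have := mem_closure_iff_nhdsWithin_neBot.1 hcl
  have l1 := (hγ.continuousWithinAt ⟨ht.le, le_rfl⟩).mono Ioo_subset_Icc_self
  have l2 := (hc.continuousWithinAt ⟨ht.le, le_rfl⟩).mono Ioo_subset_Icc_self
  exact tendsto_nhds_unique l1 (l2.congr' (eventually_mem_nhdsWithin.mono fun x hx => (E1 hx).symm))

/-- The flow map sends the initial point of the integral curve `c` to `c t`, so that the base point
`exp(tX) x₀` in the definition of conjugate times is `c t`. -/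
theorem flow_eq [CompleteSpace E] [T2Space M] [IsManifold 𝓘(ℝ, E) ∞ M]
   {X : ∀ x : M, TangentSpace 𝓘(ℝ, E) x} (hX : SmoothOn X univ) {c : ℝ → M} {t : ℝ} (ht : 0 < t)
   (hc : IsMIntegralCurveOn c X (Icc 0 t)) : flow X t (c 0) = c t := by
  have h : ∃ γ : ℝ → M, γ 0 = c 0 ∧ IsMIntegralCurveOn γ X (Icc 0 t) := ⟨c, rfl, hc⟩
  rw [flow, dif_pos h]
  exact integralCurve_eq hX ht h.choose_spec.2 hc h.choose_spec.1

/-- The intersection `exp(tX)_* 𝒱(x₀) ∩ 𝒱(exp(tX) x₀)`; along an integral curve `c` with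
`c 0 = x₀` the point `exp(tX) x₀` is `c t`. -/
def conjugateSpace (X : ∀ x : M, TangentSpace 𝓘(ℝ, E) x)
    (𝒱 : ∀ x : M, Submodule ℝ (TangentSpace 𝓘(ℝ, E) x)) (x₀ : M) (t : ℝ) :
    Submodule ℝ (TangentSpace 𝓘(ℝ, E) (flow X t x₀)) :=
  (𝒱 x₀).map (mfderiv 𝓘(ℝ, E) 𝓘(ℝ, E) (flow X t) x₀).toLinearMap ⊓ 𝒱 (flow X t x₀)

/-- `t` is a conjugate time along the integral curve of `X` that starts at `x₀`. -/
def IsConjugateTime (X : ∀ x : M, TangentSpace 𝓘(ℝ, E) x)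
    (𝒱 : ∀ x : M, Submodule ℝ (TangentSpace 𝓘(ℝ, E) x)) (x₀ : M) (t : ℝ) : Prop :=
  conjugateSpace X 𝒱 x₀ t ≠ ⊥

/-- The multiplicity of the time `t`. -/
def multiplicity (X : ∀ x : M, TangentSpace 𝓘(ℝ, E) x)
    (𝒱 : ∀ x : M, Submodule ℝ (TangentSpace 𝓘(ℝ, E) x)) (x₀ : M) (t : ℝ) : ℕ :=
  Module.finrank ℝ (conjugateSpace X 𝒱 x₀ t)

end

end DynPair

/-! The idea is to trivialise the tangent spaces along `c` by a frame `Φ t : E ≃ T_{c(t)}M` that is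
carried along by the flow of `X`, i.e. that solves the linearised equation. In such a frame
everything becomes a statement about a curve of subspaces of one fixed vector space. The
differential of `exp(tX)` at `c 0` is `Φ t ∘ (Φ 0)⁻¹` (`hasMFDerivAt_flow`), the bracket with `X`
along `c` is the derivative `d/dt` (`IsInvariantFrame.bracketAlong_eq`), and `𝒱` becomes the curve
`V t = (Φ t)⁻¹ 𝒱(c t)` (`alongFrame`). The conjugate space of the time `t` is thus isomorphic to `V
0 ∩ V t` (`exists_equiv_conjugateSpace`).

A frame `P` of `V` satisfies `P'' = P h₀ + P' h₁` by `[X, 𝒟] ⊆ 𝒟`, and `P`, `P'` are jointly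
independent because `𝒟` has rank `2m`. Hence `D = V t + V' t` does not depend on `t`
(`exists_symbolRel_of_left`). Write a constant vector `z ∈ D` as `z = P p + P' q`, and call `v = P
q` its symbol; it represents the class of `z` in `D / V t ≃ V t`, so it vanishes at `t` exactly if
`z ∈ V t`. Constancy of `z` means `p' = -h₀ q` and `q' = -p - h₁ q`.

The horizontal space consists of the vectors `P' b - ½ P h₁ b`, so `D_X` acts on coefficients as `a
↦ a' + ½ h₁ a`. Therefore `D_X v` has coefficient `-p - ½ h₁ q`, and `D_X D_X v` has coefficient `h₀
q - ½ h₁' q + ¼ h₁² q`, which is minus the curvature applied to `q`. Thus symbols are Jacobi fields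
(`exists_isCurveJacobi`). Conversely, for a Jacobi field `v` the vector `v' - 2 D_X v` has
derivative zero, and `v` is its symbol (`IsCurveJacobi.exists_symbolRel`). A vector whose symbol
vanishes identically lies in every `V t`; being a constant section with derivative zero, it is zero
(`eq_zero_of_symbolRel_zero`).

So Jacobi fields correspond linearly and bijectively to vectors of `D`, and those vanishing at `0`
and at `t` correspond to `V 0 ∩ V t` (`exists_jacobi_linearMap`). This gives both the equivalence
and the equality of dimensions. No solution theory of the second order Jacobi equation is needed,
and the independence of the curvature of the frame is never invoked: one direction works in
whichever frame witnesses the curvature at a given time, the other produces a witness in one frame.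
-/

set_option linter.unusedSectionVars false

namespace DynPair

/-! ### Preliminaries on ordinary differential equations -/

/-- A relation on a compact interval that holds locally and is transitive holds between the
endpoints. -/
theorem rel_of_local_of_trans {P : ℝ → ℝ → Prop} {a b : ℝ} (hab : a ≤ b)
    (hloc : ∀ s ∈ Icc a b, ∃ ε > 0, ∀ s₁ ∈ Icc a b, ∀ s₂ ∈ Icc a b, s₁ ≤ s₂ →
      |s₁ - s| < ε → |s₂ - s| < ε → P s₁ s₂)
    (htrans : ∀ s₁ ∈ Icc a b, ∀ s₂ ∈ Icc a b, ∀ s₃ ∈ Icc a b, s₁ ≤ s₂ → s₂ ≤ s₃ →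
      P s₁ s₂ → P s₂ s₃ → P s₁ s₃) : P a b := by
  choose! ε hε H using hloc
  -- Subdivide the interval so finely that each piece lies in one of the neighbourhoods where the
  -- relation is known.
  obtain ⟨t, h0, hmono, ⟨n, hn⟩, hsub⟩ := exists_monotone_Icc_subset_open_cover_Icc hab
    (c := fun s : Icc a b => {x : Icc a b | |x.1 - s.1| < ε s.1})
    (fun s => isOpen_lt (by fun_prop) continuous_const)
    (fun x _ => mem_iUnion.2 ⟨x, by simpa using hε x.1 x.2⟩)
  have step : ∀ k, P (t k) (t (k + 1)) := fun k => by
    obtain ⟨i, hi⟩ := hsub k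
    have hk : t k ≤ t (k + 1) := hmono k.le_succ
    exact H i i.2 _ (t k).2 _ (t (k + 1)).2 hk (hi ⟨le_rfl, hk⟩) (hi ⟨hk, le_rfl⟩)
  have all : ∀ k, P (t 0) (t k) := fun k => by
    induction k with
    | zero =>
      exact H _ (t 0).2 _ (t 0).2 _ (t 0).2 le_rfl (by simpa using hε _ (t 0).2)
        (by simpa using hε _ (t 0).2)
    | succ k ih =>
      exact htrans _ (t 0).2 _ (t k).2 _ (t (k + 1)).2 (hmono k.zero_le) (hmono k.le_succ) ih
        (step k)
  have := all n
  rwa [hn n le_rfl, h0] at this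

section ODE

variable {F : Type*} [NormedAddCommGroup F] [NormedSpace ℝ F]

/-- The Picard-Lindelöf theorem, with the information that the solution stays in the ball. -/
theorem exists_solution_mem_closedBall [CompleteSpace F] {f : ℝ → F → F} {tmin tmax : ℝ}
    {t₀ : Icc tmin tmax} {x₀ x : F} {a r L K : NNReal} (hf : IsPicardLindelof f t₀ x₀ a r L K)
    (hx : x ∈ Metric.closedBall x₀ r) :
    ∃ α : ℝ → F, α t₀ = x ∧ ∀ t ∈ Icc tmin tmax,
      HasDerivWithinAt α (f t (α t)) (Icc tmin tmax) t ∧ α t ∈ Metric.closedBall x₀ a := by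
  obtain ⟨α, hα⟩ := ODE.FunSpace.exists_isFixedPt_next hf hx
  refine ⟨α.compProj, by rw [ODE.FunSpace.compProj_val, ← hα, ODE.FunSpace.next_apply₀],
    fun t ht ↦ ⟨?_, α.compProj_mem_closedBall hf.mul_max_le⟩⟩
  apply ODE.hasDerivWithinAt_picard_Icc t₀.2 hf.continuousOn_uncurry
    α.continuous_compProj.continuousOn (fun _ ht' ↦ α.compProj_mem_closedBall hf.mul_max_le)
    x ht |>.congr_of_mem _ ht
  intro t' ht'
  nth_rw 1 [← hα]
  rw [ODE.FunSpace.compProj_of_mem ht', ODE.FunSpace.next_apply]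

/-- A linear differential equation is solvable on short intervals. -/
theorem exists_linear_solution [CompleteSpace F] {A : ℝ → F →L[ℝ] F} {a b : ℝ}
    (hA : ContinuousOn A (Icc a b)) {K : NNReal} (hK : ∀ t ∈ Icc a b, ‖A t‖ ≤ K)
    (hsmall : 2 * K * (b - a) ≤ 1) {t₀ : ℝ} (ht₀ : t₀ ∈ Icc a b) (x₀ : F) :
    ∃ x : ℝ → F, x t₀ = x₀ ∧ ∀ t ∈ Icc a b, HasDerivWithinAt x (A t (x t)) (Icc a b) t := by
  -- On the ball of radius `‖x₀‖` about `x₀` the right-hand side is at most `2 K ‖x₀‖`, so over a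
  -- time `b - a ≤ 1 / (2K)` the solution cannot leave the ball.
  have hPL : IsPicardLindelof (fun t x => A t x) (⟨t₀, ht₀⟩ : Icc a b) x₀ ‖x₀‖₊ 0
      (K * (2 * ‖x₀‖₊)) K := by
    refine ⟨fun t ht => ?_, fun x _ => ?_, fun t ht x hx => ?_, ?_⟩
    · exact ((A t).lipschitz.weaken (hK t ht)).lipschitzOnWith
    · exact hA.clm_apply continuousOn_const
    · refine ((A t).le_of_opNorm_le (hK t ht) x).trans ?_
      push_cast
      gcongr
      rw [mem_closedBall_iff_norm] at hx
      have := norm_le_norm_sub_add x x₀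
      simp only [coe_nnnorm] at hx
      linarith
    · have h1 : max (b - t₀) (t₀ - a) ≤ b - a := max_le (by linarith [ht₀.1]) (by linarith [ht₀.2])
      push_cast
      calc (K : ℝ) * (2 * ‖x₀‖) * max (b - t₀) (t₀ - a) ≤ K * (2 * ‖x₀‖) * (b - a) := by gcongr
        _ = (2 * K * (b - a)) * ‖x₀‖ := by ring
        _ ≤ 1 * ‖x₀‖ := by gcongr
        _ = ‖x₀‖ - 0 := by ring
  exact hPL.exists_eq_forall_mem_Icc_hasDerivWithinAt₀

/-- Linearity of the bound in the defect `e`: a defect quadratic in the initial displacement gives a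
quadratic error at the end time. -/
theorem gronwallBound_zero_eq_mul (K e x : ℝ) :
    gronwallBound 0 K e x = gronwallBound 0 K 1 x * e := by
  by_cases hK : K = 0
  · simp [hK, gronwallBound_K0, mul_comm]
  · simp only [gronwallBound_of_K_ne_0 hK]; ring

theorem hasDerivWithinAt_Ici_of_Icc {u : ℝ → F} {u' : F} {a b t : ℝ} (ht : t ∈ Ico a b)
    (h : HasDerivWithinAt u u' (Icc a b) t) : HasDerivWithinAt u u' (Ici t) t :=
  h.mono_of_mem_nhdsWithin (mem_of_superset (Icc_mem_nhdsGE ht.2) (Icc_subset_Icc_left ht.1))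

/-- The flow of a `C²` vector field near a point is differentiable along a trajectory, and its
derivative solves the linearized equation. -/
theorem exists_local_flow_hasFDerivAt [CompleteSpace F] {f : F → F} {u₀ : F}
    (hf : ContDiffAt ℝ 2 f u₀) {Ω : Set F} (hΩ : Ω ∈ 𝓝 u₀) :
    ∃ ε > 0, ∃ ρ > 0, ∀ s₁ s₂ : ℝ, s₁ ≤ s₂ → s₂ - s₁ ≤ ε → ∀ u : ℝ → F,
      (∀ τ ∈ Icc s₁ s₂, HasDerivWithinAt u (f (u τ)) (Icc s₁ s₂) τ) →
      (∀ τ ∈ Icc s₁ s₂, u τ ∈ Metric.ball u₀ ρ) →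
      ∀ Q : F →L[ℝ] F, (∀ v, ∃ z : ℝ → F, z s₁ = v ∧ z s₂ = Q v ∧
        ∀ τ ∈ Icc s₁ s₂, HasDerivWithinAt z (fderiv ℝ f (u τ) (z τ)) (Icc s₁ s₂) τ) →
      ∃ G : F → F, G (u s₁) = u s₂ ∧ HasFDerivAt G Q (u s₁) ∧
        ∀ᶠ y in 𝓝 (u s₁), ∃ γ : ℝ → F, γ s₁ = y ∧ γ s₂ = G y ∧
        ∀ τ ∈ Icc s₁ s₂, HasDerivWithinAt γ (f (γ τ)) (Icc s₁ s₂) τ ∧ γ τ ∈ Ω := by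
  obtain ⟨K, S₁, hS₁, hK⟩ := (hf.of_le one_le_two).exists_lipschitzOnWith
  have hf' : ContDiffAt ℝ 1 (fderiv ℝ f) u₀ := hf.fderiv_right (by norm_num)
  obtain ⟨C, S₂, hS₂, hC⟩ := hf'.exists_lipschitzOnWith
  have hd : ∀ᶠ y in 𝓝 u₀, DifferentiableAt ℝ f y :=
    (hf.eventually (by simp)).mono fun y hy => hy.differentiableAt (by simp)
  obtain ⟨R, hR, hRs⟩ := Metric.mem_nhds_iff.1
    (inter_mem (inter_mem hΩ hd) (inter_mem hS₁ hS₂))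
  have hBΩ : Metric.ball u₀ R ⊆ Ω := fun y hy => (hRs hy).1.1
  have hBd : ∀ y ∈ Metric.ball u₀ R, DifferentiableAt ℝ f y := fun y hy => (hRs hy).1.2
  replace hK : LipschitzOnWith K f (Metric.ball u₀ R) := hK.mono fun y hy => (hRs hy).2.1
  replace hC : LipschitzOnWith C (fderiv ℝ f) (Metric.ball u₀ R) :=
    hC.mono fun y hy => (hRs hy).2.2
  have hu₀ : u₀ ∈ Metric.ball u₀ R := Metric.mem_ball_self hR
  have hfK : ∀ y ∈ Metric.ball u₀ R, ‖fderiv ℝ f y‖ ≤ K := fun y hy =>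
    norm_fderiv_le_of_lipschitzOn ℝ (Metric.isOpen_ball.mem_nhds hy) hK
  lift R to NNReal using hR.le
  set L : NNReal := K * R + ‖f u₀‖₊ + 1 with hL
  have hL0 : (0 : ℝ) < L := by rw [hL]; push_cast; positivity
  have hbound : ∀ y ∈ Metric.closedBall u₀ ((R / 2 : NNReal) : ℝ), ‖f y‖ ≤ L := fun y hy => by
    have hy' : y ∈ Metric.ball u₀ R :=
      Metric.closedBall_subset_ball (by push_cast; linarith) hy
    have h1 := hK.dist_le_mul y hy' u₀ hu₀
    have h2 : dist y u₀ ≤ R := (Metric.mem_ball.1 hy').le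
    have h3 := norm_le_norm_sub_add (f y) (f u₀)
    rw [dist_eq_norm] at h1
    have h4 : (K : ℝ) * dist y u₀ ≤ K * R := by gcongr
    rw [hL]; push_cast
    linarith
  have hsubB : Metric.closedBall u₀ ((R / 2 : NNReal) : ℝ) ⊆ Metric.ball u₀ R :=
    Metric.closedBall_subset_ball (by push_cast; linarith)
  -- Solutions starting within `R / 4` of `u₀` have speed at most `L` inside the ball of radius `R /
  -- 2`, hence stay in it for the time `R / 4 / L`. The trajectory `u` itself is kept within `R /
  -- 4`, which leaves room for perturbations.
  refine ⟨R / 4 / L, by positivity, R / 4, by positivity, ?_⟩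
  intro s₁ s₂ hs hsε u hu huB Q hQ
  have hs₁ : s₁ ∈ Icc s₁ s₂ := ⟨le_rfl, hs⟩
  have hs₂ : s₂ ∈ Icc s₁ s₂ := ⟨hs, le_rfl⟩
  have hPL : IsPicardLindelof (fun _ ↦ f) (⟨s₁, hs₁⟩ : Icc s₁ s₂) u₀ (R / 2) (R / 4) L K := by
    refine .of_time_independent hbound (hK.mono hsubB) ?_
    have : max (s₂ - s₁) (s₁ - s₁) ≤ R / 4 / L := max_le hsε (by simp; positivity)
    calc (L : ℝ) * max (s₂ - s₁) (s₁ - s₁) ≤ L * (R / 4 / L) := by gcongr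
      _ = R / 4 := by field_simp
      _ = ((R / 2 : NNReal) : ℝ) - ((R / 4 : NNReal) : ℝ) := by push_cast; ring
  have hγ := fun y (hy : y ∈ Metric.closedBall u₀ ((R / 4 : NNReal) : ℝ)) =>
    exists_solution_mem_closedBall hPL hy
  choose! γ hγ₀ hγ using hγ
  have huR : ∀ τ ∈ Icc s₁ s₂, u τ ∈ Metric.ball u₀ R := fun τ hτ =>
    Metric.ball_subset_ball (by linarith) (huB τ hτ)
  have hnear : Metric.closedBall u₀ ((R / 4 : NNReal) : ℝ) ∈ 𝓝 (u s₁) := by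
    refine mem_of_superset (Metric.isOpen_ball.mem_nhds (huB s₁ hs₁)) ?_
    push_cast; exact Metric.ball_subset_closedBall
  set D : ℝ := Real.exp (K * (s₂ - s₁)) with hD
  have hDpos : 0 < D := Real.exp_pos _
  set B : ℝ := gronwallBound 0 K 1 (s₂ - s₁) with hB
  -- the main estimate
  have key : ∀ y ∈ Metric.closedBall u₀ ((R / 4 : NNReal) : ℝ), D * ‖y - u s₁‖ < R / 2 →
      ‖γ y s₂ - u s₂ - Q (y - u s₁)‖ ≤ B * (C * D ^ 2) * ‖y - u s₁‖ ^ 2 := by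
    intro y hy hyD
    obtain ⟨z, hz₁, hz₂, hz⟩ := hQ (y - u s₁)
    have hzb : ∀ τ ∈ Icc s₁ s₂, ‖z τ‖ ≤ D * ‖y - u s₁‖ := by
      intro τ hτ
      have := norm_le_gronwallBound_of_norm_deriv_right_le (f := z) (K := K) (ε := 0)
        (δ := ‖y - u s₁‖) (fun τ hτ => (hz τ hτ).continuousWithinAt)
        (fun τ hτ => hasDerivWithinAt_Ici_of_Icc hτ (hz τ (Ico_subset_Icc_self hτ)))
        (by rw [hz₁]) (fun τ hτ => by
          rw [add_zero]
          exact ContinuousLinearMap.le_of_opNorm_le _ (hfK _ (huR τ (Ico_subset_Icc_self hτ))) _)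
        τ hτ
      rw [gronwallBound_ε0] at this
      refine this.trans ?_
      rw [mul_comm, hD]
      gcongr
      exact hτ.2
    -- The approximate solution `u + z` stays in the ball where the Lipschitz constants hold, since
    -- `‖u - u₀‖ < R / 4` and `‖z‖ < R / 2`.
    have hw : ∀ τ ∈ Icc s₁ s₂, u τ + z τ ∈ Metric.ball u₀ R := by
      intro τ hτ
      have h1 := huB τ hτ
      rw [mem_ball_iff_norm] at h1 ⊢
      have h2 : ‖u τ + z τ - u₀‖ ≤ ‖u τ - u₀‖ + ‖z τ‖ := by
        rw [show u τ + z τ - u₀ = (u τ - u₀) + z τ by abel]; exact norm_add_le _ _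
      linarith [hzb τ hτ]
    -- `u + z` solves the equation up to the first order Taylor remainder of `f`, which is quadratic
    -- in `z` because `fderiv ℝ f` is Lipschitz.
    have herr : ∀ τ ∈ Icc s₁ s₂, dist (f (u τ) + fderiv ℝ f (u τ) (z τ)) (f (u τ + z τ)) ≤
        C * (D * ‖y - u s₁‖) ^ 2 := by
      intro τ hτ
      have hseg : segment ℝ (u τ) (u τ + z τ) ⊆ Metric.ball u₀ R :=
        (convex_ball u₀ (R : ℝ)).segment_subset (huR τ hτ) (hw τ hτ)
      have := (convex_segment (𝕜 := ℝ) (u τ) (u τ + z τ)).norm_image_sub_le_of_norm_hasFDerivWithin_le'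
        (f := f) (f' := fderiv ℝ f) (φ := fderiv ℝ f (u τ)) (C := C * ‖z τ‖)
        (fun x hx => (hBd x (hseg hx)).hasFDerivAt.hasFDerivWithinAt)
        (fun x hx => by
          have h1 := hC.dist_le_mul x (hseg hx) (u τ) (huR τ hτ)
          rw [dist_eq_norm] at h1
          refine h1.trans ?_
          gcongr
          have h2 := norm_sub_le_of_mem_segment hx
          rw [dist_eq_norm]
          simpa using h2)
        (left_mem_segment ℝ _ _) (right_mem_segment ℝ _ _)
      rw [add_sub_cancel_left] at this
      rw [dist_comm, dist_eq_norm, ← sub_sub]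
      refine this.trans ?_
      have h3 := hzb τ hτ
      calc C * ‖z τ‖ * ‖z τ‖ = C * ‖z τ‖ ^ 2 := by ring
        _ ≤ C * (D * ‖y - u s₁‖) ^ 2 := by gcongr
    -- Grönwall comparison of the true solution `γ y` with the approximate solution `u + z`; both
    -- start at `y`.
    have := dist_le_of_approx_trajectories_ODE_of_mem (v := fun _ => f)
      (s := fun _ => Metric.ball u₀ R) (K := K) (f := γ y) (g := fun τ => u τ + z τ)
      (f' := fun τ => f (γ y τ)) (g' := fun τ => f (u τ) + fderiv ℝ f (u τ) (z τ))
      (εf := 0) (εg := C * (D * ‖y - u s₁‖) ^ 2) (δ := 0) (a := s₁) (b := s₂)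
      (fun _ _ => hK) (fun τ hτ => (hγ y hy τ hτ).1.continuousWithinAt)
      (fun τ hτ => hasDerivWithinAt_Ici_of_Icc hτ (hγ y hy τ (Ico_subset_Icc_self hτ)).1)
      (fun τ _ => by simp) (fun τ hτ => hsubB (hγ y hy τ (Ico_subset_Icc_self hτ)).2)
      (fun τ hτ => ((hu τ hτ).add (hz τ hτ)).continuousWithinAt)
      (fun τ hτ => hasDerivWithinAt_Ici_of_Icc hτ
        ((hu τ (Ico_subset_Icc_self hτ)).add (hz τ (Ico_subset_Icc_self hτ))))
      (fun τ hτ => herr τ (Ico_subset_Icc_self hτ)) (fun τ hτ => hw τ (Ico_subset_Icc_self hτ))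
      (by rw [hz₁, show γ y s₁ = y from hγ₀ y hy]; simp) s₂ hs₂
    rw [zero_add, gronwallBound_zero_eq_mul, hz₂, dist_eq_norm, ← sub_sub] at this
    refine this.trans (le_of_eq ?_)
    rw [hB]; ring
  have hev : ∀ᶠ y in 𝓝 (u s₁), D * ‖y - u s₁‖ < R / 2 := by
    have : Tendsto (fun y => D * ‖y - u s₁‖) (𝓝 (u s₁)) (𝓝 (D * ‖u s₁ - u s₁‖)) := by
      apply Continuous.tendsto; fun_prop
    refine this.eventually_lt_const ?_
    simpa using hR
  -- With zero displacement the estimate is a uniqueness statement.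
  have hG₁ : γ (u s₁) s₂ = u s₂ := by
    have := key (u s₁) (mem_of_mem_nhds hnear) hev.self_of_nhds
    simpa [sub_eq_zero] using this
  refine ⟨fun y => γ y s₂, hG₁, ?_, ?_⟩
  · rw [hasFDerivAt_iff_isLittleO]
    refine Asymptotics.IsBigO.trans_isLittleO (g := fun y => ‖y - u s₁‖ ^ 2) ?_ ?_
    · refine Asymptotics.IsBigO.of_bound (B * (C * D ^ 2)) ?_
      filter_upwards [hnear, hev] with y hy hyD
      simp only [hG₁, norm_pow, norm_norm]
      exact key y hy hyD
    · have h1 : (fun y => ‖y - u s₁‖ ^ 2) = fun y => ‖y - u s₁‖ * ‖y - u s₁‖ := by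
        ext y; ring
      rw [h1]
      have h2 : (fun y : F => ‖y - u s₁‖) =o[𝓝 (u s₁)] (fun _ => (1 : ℝ)) := by
        rw [Asymptotics.isLittleO_one_iff]
        have : Tendsto (fun y => ‖y - u s₁‖) (𝓝 (u s₁)) (𝓝 (‖u s₁ - u s₁‖)) := by
          apply Continuous.tendsto; fun_prop
        simpa using this
      have h3 := h2.mul_isBigO (Asymptotics.isBigO_refl (fun y : F => ‖y - u s₁‖) (𝓝 (u s₁)))
      simp only [one_mul] at h3
      exact h3.of_norm_right
  · filter_upwards [hnear] with y hy
    exact ⟨γ y, hγ₀ y hy, rfl, fun τ hτ => ⟨(hγ y hy τ hτ).1, hBΩ (hsubB (hγ y hy τ hτ).2)⟩⟩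

end ODE

/-! ### Smoothness of coefficients with respect to smooth families of independent vectors -/

section Coefficients

variable {E : Type*} [NormedAddCommGroup E] [NormedSpace ℝ E]
  {E' : Type*} [NormedAddCommGroup E'] [NormedSpace ℝ E']
  {H : Type*} [TopologicalSpace H] {I : ModelWithCorners ℝ E' H} {N : Type*} [TopologicalSpace N]
  [ChartedSpace H N] {n : WithTop ℕ∞} {s : Set N} {x₀ : N}

/-- If `y = B a`, where `y` and the family `B` of injective linear maps are smooth, then `a` is
smooth. -/
theorem contMDiffWithinAt_of_clm_apply [FiniteDimensional ℝ E] {G : Type*} [NormedAddCommGroup G]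
    [NormedSpace ℝ G] [FiniteDimensional ℝ G] {B : N → G →L[ℝ] E} {y : N → E} {a : N → G}
    (hx₀ : x₀ ∈ s) (hB : ContMDiffWithinAt I 𝓘(ℝ, G →L[ℝ] E) n B s x₀)
    (hinj : Function.Injective (B x₀)) (hy : ContMDiffWithinAt I 𝓘(ℝ, E) n y s x₀)
    (heq : ∀ᶠ x in 𝓝[s] x₀, y x = B x (a x)) :
    ContMDiffWithinAt I 𝓘(ℝ, G) n a s x₀ := by
  have : CompleteSpace G := FiniteDimensional.complete ℝ G
  -- A fixed left inverse `L` of `B x₀` makes `L ∘ B x` a smooth family of endomorphisms, equal to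
  -- the identity at `x₀` and so invertible nearby; then `a = (L ∘ B)⁻¹ L y`.
  obtain ⟨l, hl⟩ := (B x₀ : G →ₗ[ℝ] E).exists_leftInverse_of_injective
    (LinearMap.ker_eq_bot.2 hinj)
  set L : E →L[ℝ] G := LinearMap.toContinuousLinearMap l with hL
  have hA₀ : L.comp (B x₀) = 1 := by
    ext1 v
    exact LinearMap.congr_fun hl v
  have hA : ContMDiffWithinAt I 𝓘(ℝ, G →L[ℝ] G) n (fun x => L.comp (B x)) s x₀ :=
    ((contDiff_const (c := L)).clm_comp contDiff_id).contMDiff.contMDiffAt.comp_contMDiffWithinAt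
      x₀ hB
  have hinv : ContMDiffWithinAt I 𝓘(ℝ, G →L[ℝ] G) n (fun x => Ring.inverse (L.comp (B x))) s x₀ := by
    refine ContMDiffAt.comp_contMDiffWithinAt x₀ (g := Ring.inverse) ?_ hA
    rw [hA₀]
    exact (contDiffAt_ringInverse ℝ (1 : (G →L[ℝ] G)ˣ)).contMDiffAt
  have hLy : ContMDiffWithinAt I 𝓘(ℝ, G) n (fun x => L (y x)) s x₀ :=
    L.contDiff.contMDiff.contMDiffAt.comp_contMDiffWithinAt x₀ hy
  have hu : ∀ᶠ x in 𝓝[s] x₀, IsUnit (L.comp (B x)) := by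
    have h1 : {g : G →L[ℝ] G | IsUnit g} ∈ 𝓝 (L.comp (B x₀)) :=
      Units.isOpen.mem_nhds (by rw [hA₀]; exact isUnit_one)
    exact hA.continuousWithinAt h1
  have e : ∀ᶠ x in 𝓝[s] x₀, a x = Ring.inverse (L.comp (B x)) (L (y x)) := by
    filter_upwards [heq, hu] with x hx hux
    rw [hx, ← ContinuousLinearMap.comp_apply L (B x), ← mul_apply_eq_comp,
      Ring.inverse_mul_cancel _ hux, one_apply_eq_self]
  exact (hinv.clm_apply hLy).congr_of_eventuallyEq e (e.self_of_nhdsWithin hx₀)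

/-- The linear combinations of the vectors `b i x`, as a family of continuous linear maps. -/
noncomputable def combination {ι : Type*} [Fintype ι] (b : ι → E) : (ι → ℝ) →L[ℝ] E :=
  ∑ i, (ContinuousLinearMap.proj i : (ι → ℝ) →L[ℝ] ℝ).smulRight (b i)

theorem combination_apply {ι : Type*} [Fintype ι] (b : ι → E) (a : ι → ℝ) :
    combination b a = ∑ i, a i • b i := by
  simp [combination]

theorem contMDiffWithinAt_combination {ι : Type*} [Fintype ι] {b : ι → N → E}
    (hb : ∀ i, ContMDiffWithinAt I 𝓘(ℝ, E) n (b i) s x₀) :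
    ContMDiffWithinAt I 𝓘(ℝ, (ι → ℝ) →L[ℝ] E) n (fun x => combination fun i => b i x) s x₀ := by
  have hlin : ∀ i, ContDiff ℝ n fun v : E =>
      (ContinuousLinearMap.proj i : (ι → ℝ) →L[ℝ] ℝ).smulRight v := fun i =>
    contDiff_const.smulRight contDiff_id
  exact ContMDiffWithinAt.sum fun i _ =>
    (hlin i).contMDiff.contMDiffAt.comp_contMDiffWithinAt x₀ (hb i)

/-- The coefficients of a smooth map with respect to smooth linearly independent maps are smooth. -/
theorem contMDiffWithinAt_coeff [FiniteDimensional ℝ E] {ι : Type*} [Fintype ι] {b : ι → N → E}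
    {y : N → E} {h : ι → N → ℝ} (hx₀ : x₀ ∈ s)
    (hb : ∀ i, ContMDiffWithinAt I 𝓘(ℝ, E) n (b i) s x₀)
    (hli : LinearIndependent ℝ fun i => b i x₀)
    (hy : ContMDiffWithinAt I 𝓘(ℝ, E) n y s x₀)
    (heq : ∀ᶠ x in 𝓝[s] x₀, y x = ∑ i, h i x • b i x) (i : ι) :
    ContMDiffWithinAt I 𝓘(ℝ, ℝ) n (h i) s x₀ := by
  refine contMDiffWithinAt_pi_space.1 (contMDiffWithinAt_of_clm_apply (a := fun x i => h i x) hx₀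
    (contMDiffWithinAt_combination hb) (fun v w hvw => ?_) hy
    (heq.mono fun x hx => by rw [hx, combination_apply])) i
  rw [combination_apply, combination_apply] at hvw
  exact linearIndependent_iff_injective_fintypeLinearCombination.1 hli hvw

end Coefficients

end DynPair

namespace DynPair

variable {E : Type*} [NormedAddCommGroup E] [NormedSpace ℝ E]
  {M : Type*} [TopologicalSpace M] [ChartedSpace E M] [IsManifold 𝓘(ℝ, E) ∞ M]

/-! ### Vector fields in charts -/

/-- The linear map underlying `coord`. -/
noncomputable def coordL (a x : M) : E →L[ℝ] E := tangentCoordChange 𝓘(ℝ, E) x a x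

/-- The vector field `X` in the chart centred at `a`. -/
noncomputable def chartVec (X : ∀ x : M, TangentSpace 𝓘(ℝ, E) x) (a : M) (y : E) : E :=
  coord a ⟨(extChartAt 𝓘(ℝ, E) a).symm y, X _⟩

theorem coord_eq (a x : M) (v : TangentSpace 𝓘(ℝ, E) x) :
    coord a (⟨x, v⟩ : TangentBundle 𝓘(ℝ, E) M) = coordL (E := E) a x v := rfl

theorem coordL_self (a : M) : coordL (E := E) a a = ContinuousLinearMap.id ℝ E := by
  ext v
  exact tangentCoordChange_self (mem_extChartAt_source (I := 𝓘(ℝ, E)) a)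

/-- The transition map between the charts centred at `a` and `b`. -/
noncomputable def transition (a b : M) : E → E :=
  extChartAt 𝓘(ℝ, E) b ∘ (extChartAt 𝓘(ℝ, E) a).symm

theorem contDiffAt_transition {a b x : M} (ha : x ∈ (extChartAt 𝓘(ℝ, E) a).source)
    (hb : x ∈ (extChartAt 𝓘(ℝ, E) b).source) :
    ContDiffAt ℝ ∞ (transition (E := E) a b) (extChartAt 𝓘(ℝ, E) a x) := by
  have h' : extChartAt 𝓘(ℝ, E) a x ∈
      ((extChartAt 𝓘(ℝ, E) a).symm ≫ (extChartAt 𝓘(ℝ, E) b)).source := by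
    rw [PartialEquiv.trans_source'', PartialEquiv.symm_symm, PartialEquiv.symm_target]
    exact mem_image_of_mem _ ⟨ha, hb⟩
  have := contDiffWithinAt_ext_coord_change (I := 𝓘(ℝ, E)) (n := ∞) b a h'
  rw [transition]; simpa [contDiffWithinAt_univ] using this

theorem coordL_transition {a b x : M} (ha : x ∈ (extChartAt 𝓘(ℝ, E) a).source)
    (hb : x ∈ (extChartAt 𝓘(ℝ, E) b).source) (v : E) :
    coordL b x v = fderiv ℝ (transition a b) (extChartAt 𝓘(ℝ, E) a x) (coordL a x v) := by
  have h := tangentCoordChange_comp (I := 𝓘(ℝ, E)) (w := x) (x := a) (y := b) (z := x) (v := v)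
    ⟨⟨mem_extChartAt_source x, ha⟩, hb⟩
  have h2 := tangentCoordChange_def (I := 𝓘(ℝ, E)) (x := a) (y := b) (z := x)
  rw [coordL, ← h, h2]
  simp [transition, coordL, fderivWithin_univ]

theorem coordL_tangentCoordChange {a x : M} (ha : x ∈ (extChartAt 𝓘(ℝ, E) a).source) (v : E) :
    coordL (E := E) a x (tangentCoordChange 𝓘(ℝ, E) a x x v) = v := by
  rw [coordL, tangentCoordChange_comp ⟨⟨ha, mem_extChartAt_source x⟩, ha⟩,
    tangentCoordChange_self ha]

theorem chartVec_extChartAt (X : ∀ x : M, TangentSpace 𝓘(ℝ, E) x) {a x : M}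
    (ha : x ∈ (extChartAt 𝓘(ℝ, E) a).source) :
    chartVec X a (extChartAt 𝓘(ℝ, E) a x) = coordL (E := E) a x (X x) := by
  rw [chartVec, (extChartAt 𝓘(ℝ, E) a).left_inv ha]; rfl

/-- Smoothness of a lift to the tangent bundle, in the chart centred at `a`. -/
theorem contMDiffWithinAt_lift_iff {E' : Type*} [NormedAddCommGroup E'] [NormedSpace ℝ E']
    {H : Type*} [TopologicalSpace H] {I : ModelWithCorners ℝ E' H} {N : Type*} [TopologicalSpace N]
    [ChartedSpace H N] {c : N → M} {W : ∀ t : N, TangentSpace 𝓘(ℝ, E) (c t)} {s : Set N} {t : N}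
    {a : M} (ha : c t ∈ (extChartAt 𝓘(ℝ, E) a).source) :
    ContMDiffWithinAt I 𝓘(ℝ, E).tangent ∞
      (fun t => (⟨c t, W t⟩ : TangentBundle 𝓘(ℝ, E) M)) s t ↔
    ContMDiffWithinAt I 𝓘(ℝ, E) ∞ c s t ∧
      ContMDiffWithinAt I 𝓘(ℝ, E) ∞ (fun t => coordL (E := E) a (c t) (W t)) s t := by
  have := (trivializationAt E (TangentSpace 𝓘(ℝ, E) : M → Type _) a).contMDiffWithinAt_iff
    (IB := 𝓘(ℝ, E)) (IM := I) (n := ∞) (f := fun t => (⟨c t, W t⟩ : TangentBundle 𝓘(ℝ, E) M))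
    (s := s) (x₀ := t) (by simpa using ha)
  exact this

theorem SmoothOn.contMDiffWithinAt_coord {W : ∀ x : M, TangentSpace 𝓘(ℝ, E) x} {U : Set M}
    (hW : SmoothOn W U) {a x : M} (hx : x ∈ U) (ha : x ∈ (extChartAt 𝓘(ℝ, E) a).source) :
    ContMDiffWithinAt 𝓘(ℝ, E) 𝓘(ℝ, E) ∞ (fun x => coordL (E := E) a x (W x)) U x :=
  ((contMDiffWithinAt_lift_iff ha).1 (hW x hx)).2

theorem contDiffAt_chartVec {W : ∀ x : M, TangentSpace 𝓘(ℝ, E) x} {U : Set M}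
    (hW : SmoothOn W U) (hU : IsOpen U) {a x : M} (hx : x ∈ U)
    (ha : x ∈ (extChartAt 𝓘(ℝ, E) a).source) :
    ContDiffAt ℝ ∞ (chartVec W a) (extChartAt 𝓘(ℝ, E) a x) := by
  have h1 := (hW.contMDiffWithinAt_coord hx ha).contMDiffAt (hU.mem_nhds hx)
  have h2 : ContMDiffAt 𝓘(ℝ, E) 𝓘(ℝ, E) ∞ (extChartAt 𝓘(ℝ, E) a).symm (extChartAt 𝓘(ℝ, E) a x) :=
    (contMDiffOn_extChartAt_symm a).contMDiffAt
      ((isOpen_extChartAt_target a).mem_nhds ((extChartAt 𝓘(ℝ, E) a).map_source ha))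
  rw [← (extChartAt 𝓘(ℝ, E) a).left_inv ha] at h1
  exact (h1.comp _ h2).contDiffAt

theorem hasDerivWithinAt_chart {X : ∀ x : M, TangentSpace 𝓘(ℝ, E) x}
    {c : ℝ → M} {s : Set ℝ} (hc : IsMIntegralCurveOn c X s) {t t₀ : ℝ} (ht : t ∈ s)
    (ha : c t ∈ (extChartAt 𝓘(ℝ, E) (c t₀)).source) :
    HasDerivWithinAt (fun r => extChartAt 𝓘(ℝ, E) (c t₀) (c r))
      (chartVec X (c t₀) (extChartAt 𝓘(ℝ, E) (c t₀) (c t))) s t := by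
  rw [chartVec_extChartAt X ha]
  exact hc.hasDerivWithinAt ht ha

end DynPair

namespace DynPair

variable {E : Type*} [NormedAddCommGroup E] [NormedSpace ℝ E]
  {M : Type*} [TopologicalSpace M] [ChartedSpace E M] [IsManifold 𝓘(ℝ, E) ∞ M]

/-- The notion of integral curve refers to the chart centred at the point in question, so the
equation in the fixed chart at `a` is transported by the transition map and the chain rule. -/
theorem isMIntegralCurveOn_of_chart {X : ∀ x : M, TangentSpace 𝓘(ℝ, E) x} {a : M} {u : ℝ → E}
    {s : Set ℝ} (hu : ∀ t ∈ s, HasDerivWithinAt u (chartVec X a (u t)) s t)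
    (hmem : ∀ t ∈ s, u t ∈ (extChartAt 𝓘(ℝ, E) a).target) :
    IsMIntegralCurveOn (fun t => (extChartAt 𝓘(ℝ, E) a).symm (u t)) X s := by
  intro t ht
  set x : M := (extChartAt 𝓘(ℝ, E) a).symm (u t) with hx
  have hxa : x ∈ (extChartAt 𝓘(ℝ, E) a).source := (extChartAt 𝓘(ℝ, E) a).map_target (hmem t ht)
  have hxx : x ∈ (extChartAt 𝓘(ℝ, E) x).source := mem_extChartAt_source x
  have hax : extChartAt 𝓘(ℝ, E) a x = u t := (extChartAt 𝓘(ℝ, E) a).right_inv (hmem t ht)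
  refine ⟨(continuousAt_extChartAt_symm'' (hmem t ht)).comp_continuousWithinAt
    (hu t ht).continuousWithinAt, ?_⟩
  simp only [mfld_simps]
  have h1 : HasFDerivAt (transition (E := E) a x) (fderiv ℝ (transition a x) (u t)) (u t) := by
    rw [← hax]
    exact ((contDiffAt_transition hxa hxx).differentiableAt (by simp)).hasFDerivAt
  have h2 := h1.comp_hasDerivWithinAt t (hu t ht)
  have h3 : fderiv ℝ (transition (E := E) a x) (u t) (chartVec X a (u t)) = X x := by
    rw [← hax]
    exact (congrArg _ (chartVec_extChartAt X hxa)).trans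
      ((coordL_transition hxa hxx _).symm.trans (by rw [coordL_self]; rfl))
  rw [h3] at h2
  have h4 := h2.hasFDerivWithinAt
  simpa [transition, Function.comp_def] using! h4

/-! ### Fields invariant under the flow, and brackets, in charts -/

/-- `Z` is a field along the curve `c` which is invariant under the flow of `X` at time `r`, in the
chart centred at `a`. -/
def InvariantIn (X : ∀ x : M, TangentSpace 𝓘(ℝ, E) x) (c : ℝ → M) (a : M) (s : Set ℝ)
    (Z : ℝ → E) (r : ℝ) : Prop :=
  HasDerivWithinAt (fun τ => coordL (E := E) a (c τ) (Z τ))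
    (fderiv ℝ (chartVec X a) (extChartAt 𝓘(ℝ, E) a (c r)) (coordL (E := E) a (c r) (Z r))) s r

/-- The linearised equation is natural. If `ψ` is the transition map and `g ∘ ψ = Dψ f` relates the
vector fields, differentiating this relation in the direction `z` gives `Dg (Dψ z) = D²ψ(z, f) + Dψ
(Df z)`, while the derivative of `Dψ(u) z` along `u' = f(u)`, `z' = Df z` is `D²ψ(f, z) + Dψ (Df
z)`. The two agree by the symmetry of the second derivative. -/
theorem InvariantIn.change_chart {X : ∀ x : M, TangentSpace 𝓘(ℝ, E) x} (hX : SmoothOn X univ)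
    {c : ℝ → M} {s : Set ℝ} (hc : IsMIntegralCurveOn c X s) {Z : ℝ → E} {r t₁ : ℝ} {b : M}
    (hr : r ∈ s) (h₁ : c r ∈ (extChartAt 𝓘(ℝ, E) (c t₁)).source)
    (h₂ : c r ∈ (extChartAt 𝓘(ℝ, E) b).source) (h : InvariantIn X c (c t₁) s Z r) :
    InvariantIn X c b s Z r := by
  set a := c t₁ with ha
  set ψ : E → E := transition a b with hψ
  set u : ℝ → E := fun τ => extChartAt 𝓘(ℝ, E) a (c τ) with hu
  set z : ℝ → E := fun τ => coordL (E := E) a (c τ) (Z τ) with hz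
  set f := chartVec X a with hf
  set g := chartVec X b with hg
  have hu' : HasDerivWithinAt u (f (u r)) s r := hasDerivWithinAt_chart hc hr h₁
  have hz' : HasDerivWithinAt z (fderiv ℝ f (u r) (z r)) s r := h
  have hψs : ContDiffAt ℝ ∞ ψ (u r) := contDiffAt_transition h₁ h₂
  have hψ2 : ContDiffAt ℝ ∞ (fderiv ℝ ψ) (u r) := hψs.fderiv_right (by simp)
  have hψ' : HasFDerivAt (fderiv ℝ ψ) (fderiv ℝ (fderiv ℝ ψ) (u r)) (u r) :=
    (hψ2.differentiableAt (by simp)).hasFDerivAt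
  have hfs : DifferentiableAt ℝ f (u r) :=
    (contDiffAt_chartVec hX isOpen_univ (mem_univ _) h₁).differentiableAt (by simp)
  have hgs : DifferentiableAt ℝ g (extChartAt 𝓘(ℝ, E) b (c r)) :=
    (contDiffAt_chartVec hX isOpen_univ (mem_univ _) h₂).differentiableAt (by simp)
  have hψu : ψ (u r) = extChartAt 𝓘(ℝ, E) b (c r) := by
    simp only [hψ, hu, transition, Function.comp_apply, (extChartAt 𝓘(ℝ, E) a).left_inv h₁]
  -- the transformation rule of the vector field
  have hopen : ∀ᶠ y in 𝓝 (u r), y ∈ (extChartAt 𝓘(ℝ, E) a).target ∧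
      (extChartAt 𝓘(ℝ, E) a).symm y ∈ (extChartAt 𝓘(ℝ, E) b).source := by
    have h1 := (isOpen_extChartAt_target (I := 𝓘(ℝ, E)) a).mem_nhds
      ((extChartAt 𝓘(ℝ, E) a).map_source h₁)
    have h2 : ContinuousAt (extChartAt 𝓘(ℝ, E) a).symm (u r) :=
      continuousAt_extChartAt_symm'' ((extChartAt 𝓘(ℝ, E) a).map_source h₁)
    have h3 := h2.preimage_mem_nhds (t := (extChartAt 𝓘(ℝ, E) b).source) (by
      rw [hu, (extChartAt 𝓘(ℝ, E) a).left_inv h₁]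
      exact (isOpen_extChartAt_source b).mem_nhds h₂)
    filter_upwards [h1, h3] with y hy hy'
    exact ⟨hy, hy'⟩
  have hrule : (fun y => g (ψ y)) =ᶠ[𝓝 (u r)] fun y => fderiv ℝ ψ y (f y) := by
    filter_upwards [hopen] with y hy
    have hya := (extChartAt 𝓘(ℝ, E) a).map_target hy.1
    have e1 : ψ y = extChartAt 𝓘(ℝ, E) b ((extChartAt 𝓘(ℝ, E) a).symm y) := rfl
    have e2 : y = extChartAt 𝓘(ℝ, E) a ((extChartAt 𝓘(ℝ, E) a).symm y) :=
      ((extChartAt 𝓘(ℝ, E) a).right_inv hy.1).symm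
    have e3 := (coordL_transition hya hy.2 (X ((extChartAt 𝓘(ℝ, E) a).symm y))).trans
      (congrArg _ (chartVec_extChartAt X hya).symm)
    rw [← e2] at e3
    rw [e1]
    exact (chartVec_extChartAt X hy.2).trans e3
  have hD1 : HasFDerivAt (fun y => g (ψ y)) ((fderiv ℝ g (ψ (u r))).comp (fderiv ℝ ψ (u r))) (u r) :=
    HasFDerivAt.comp (g := g) (u r) (by rw [hψu]; exact hgs.hasFDerivAt)
      (hψs.differentiableAt (by simp)).hasFDerivAt
  have hD2 := hψ'.clm_apply hfs.hasFDerivAt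
  -- Both derivatives of the transformation rule at `u r`, to be evaluated in the direction `z r`.
  have hD := (hD1.congr_of_eventuallyEq hrule.symm).unique hD2
  have hD' := congrArg (fun A => A (z r)) hD
  simp only [ContinuousLinearMap.comp_apply, add_apply,
    ContinuousLinearMap.flip_apply] at hD'
  -- the field in the chart at `b`
  have hcont : ContinuousWithinAt c s r := hc.continuousWithinAt hr
  have hzb : (fun τ => coordL (E := E) b (c τ) (Z τ)) =ᶠ[𝓝[s] r]
      fun τ => fderiv ℝ ψ (u τ) (z τ) := by
    filter_upwards [hcont ((isOpen_extChartAt_source (I := 𝓘(ℝ, E)) a).mem_nhds h₁),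
      hcont ((isOpen_extChartAt_source (I := 𝓘(ℝ, E)) b).mem_nhds h₂)] with τ h1 h2
    exact coordL_transition h1 h2 _
  have hzr : coordL (E := E) b (c r) (Z r) = fderiv ℝ ψ (u r) (z r) := coordL_transition h₁ h₂ _
  have hder : HasDerivWithinAt (fun τ => fderiv ℝ ψ (u τ) (z τ))
      (fderiv ℝ (fderiv ℝ ψ) (u r) (f (u r)) (z r) + fderiv ℝ ψ (u r) (fderiv ℝ f (u r) (z r)))
      s r :=
    (hψ'.comp_hasDerivWithinAt r hu').clm_apply hz'
  have hsymm : IsSymmSndFDerivAt ℝ ψ (u r) := hψs.isSymmSndFDerivAt (by simp; exact ENat.LEInfty.out)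
  rw [InvariantIn, hzr, ← hψu]
  refine (hder.congr_of_eventuallyEq hzb hzr).congr_deriv ?_
  rw [hD', hsymm.eq, add_comm]

theorem trivializationAt_symm_self (x : M) (v : E) :
    (trivializationAt E (TangentSpace 𝓘(ℝ, E) : M → Type _) x).symm x v = v := by
  have h := (trivializationAt E (TangentSpace 𝓘(ℝ, E) : M → Type _) x).apply_mk_symm
    (b := x) (by simp) v
  have h2 : coordL (E := E) x x
      ((trivializationAt E (TangentSpace 𝓘(ℝ, E) : M → Type _) x).symm x v) = v :=
    congrArg Prod.snd h
  rwa [coordL_self] at h2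

theorem bracketAlong_eq (X : ∀ x : M, TangentSpace 𝓘(ℝ, E) x) (c : ℝ → M) (s : Set ℝ)
    (W : ∀ t : ℝ, TangentSpace 𝓘(ℝ, E) (c t)) (r : ℝ) :
    bracketAlong X c s W r = (derivWithin (fun t => coordL (E := E) (c r) (c t) (W t)) s r -
      fderiv ℝ (chartVec X (c r)) (extChartAt 𝓘(ℝ, E) (c r) (c r)) (W r) : E) := by
  have h : coord (c r) (⟨c r, W r⟩ : TangentBundle 𝓘(ℝ, E) M) = W r := by
    rw [coord_eq, coordL_self]; rfl
  rw [bracketAlong, h]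
  exact trivializationAt_symm_self _ _

theorem mpullbackWithin_extChartAt_symm (Y : ∀ x : M, TangentSpace 𝓘(ℝ, E) x) {a : M} {y : E}
    (hy : y ∈ (extChartAt 𝓘(ℝ, E) a).target) :
    VectorField.mpullbackWithin 𝓘(ℝ, E) 𝓘(ℝ, E) (extChartAt 𝓘(ℝ, E) a).symm Y
      (range 𝓘(ℝ, E)) y = chartVec Y a y := by
  have : IsManifold 𝓘(ℝ, E) 1 M := IsManifold.of_le (n := ∞) (by simp)
  rw [VectorField.mpullbackWithin_apply, ContinuousLinearMap.inverse_eq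
    (mfderivWithin_extChartAt_symm_comp_mfderiv_extChartAt hy)
    (mfderiv_extChartAt_comp_mfderivWithin_extChartAt_symm hy)]
  have hs : (extChartAt 𝓘(ℝ, E) a).symm y ∈ (chartAt E a).source := by
    simpa using (extChartAt 𝓘(ℝ, E) a).map_target hy
  have h := DFunLike.congr_fun (TangentBundle.continuousLinearMapAt_trivializationAt
    (𝕜 := ℝ) (I := 𝓘(ℝ, E)) hs) (Y ((extChartAt 𝓘(ℝ, E) a).symm y))
  exact h.symm.trans (Bundle.Trivialization.continuousLinearMapAt_apply_of_mem (R := ℝ)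
    (trivializationAt E (TangentSpace 𝓘(ℝ, E) : M → Type _) a) (by simpa using hs) _)

/-- In the chart centred at `x` the pullbacks of the fields are their chart representatives and the
differential of the chart at `x` is the identity, so the bracket is that of the vector space `E`. -/
theorem bracket_eq (X Y : ∀ x : M, TangentSpace 𝓘(ℝ, E) x) (x : M) :
    bracket X Y x = (fderiv ℝ (chartVec Y x) (extChartAt 𝓘(ℝ, E) x x) (X x) -
      fderiv ℝ (chartVec X x) (extChartAt 𝓘(ℝ, E) x x) (Y x) : E) := by
  have hev : ∀ Y : ∀ x : M, TangentSpace 𝓘(ℝ, E) x,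
      VectorField.mpullbackWithin 𝓘(ℝ, E) 𝓘(ℝ, E) (extChartAt 𝓘(ℝ, E) x).symm Y
      (range 𝓘(ℝ, E)) =ᶠ[𝓝 (extChartAt 𝓘(ℝ, E) x x)] chartVec Y x := fun Y => by
    filter_upwards [(isOpen_extChartAt_target (I := 𝓘(ℝ, E)) x).mem_nhds
      (mem_extChartAt_target x)] with y hy
    exact mpullbackWithin_extChartAt_symm Y hy
  have hval : ∀ Y : ∀ x : M, TangentSpace 𝓘(ℝ, E) x,
      chartVec Y x (extChartAt 𝓘(ℝ, E) x x) = Y x := fun Y => by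
    rw [chartVec_extChartAt Y (mem_extChartAt_source x), coordL_self]; rfl
  have : IsManifold 𝓘(ℝ, E) 1 M := IsManifold.of_le (n := ∞) (by simp)
  have hset : (extChartAt 𝓘(ℝ, E) x).symm ⁻¹' univ ∩ range 𝓘(ℝ, E) = univ := by simp
  have h : VectorField.lieBracketWithin ℝ
      (VectorField.mpullbackWithin 𝓘(ℝ, E) 𝓘(ℝ, E) (extChartAt 𝓘(ℝ, E) x).symm X (range 𝓘(ℝ, E)))
      (VectorField.mpullbackWithin 𝓘(ℝ, E) 𝓘(ℝ, E) (extChartAt 𝓘(ℝ, E) x).symm Y (range 𝓘(ℝ, E)))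
      ((extChartAt 𝓘(ℝ, E) x).symm ⁻¹' univ ∩ range 𝓘(ℝ, E)) (extChartAt 𝓘(ℝ, E) x x) =
      VectorField.lieBracket ℝ (chartVec X x) (chartVec Y x) (extChartAt 𝓘(ℝ, E) x x) :=
    (congrArg (fun s => VectorField.lieBracketWithin ℝ _ _ s _) hset).trans
      ((congrFun VectorField.lieBracketWithin_univ _).trans
        ((hev X).lieBracket_vectorField_eq (hev Y)))
  rw [bracket, ← VectorField.mlieBracketWithin_univ, VectorField.mlieBracketWithin_apply,
    mfderiv_extChartAt_self]
  refine (DFunLike.congr_fun (ContinuousLinearMap.inverse_id (R := ℝ) (M := E)) _).trans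
    (h.trans ?_)
  rw [VectorField.lieBracket_eq]
  exact congrArg₂ (fun v w : E => fderiv ℝ (chartVec Y x) (extChartAt 𝓘(ℝ, E) x x) v -
    fderiv ℝ (chartVec X x) (extChartAt 𝓘(ℝ, E) x x) w) (hval X) (hval Y)

end DynPair

namespace DynPair

/-! ### Frames along an integral curve that are invariant under the flow -/

/-- Localisation to a short nondegenerate interval that also works at the end points of `[a, b]`,
where it becomes one-sided. -/
theorem exists_Icc_mem_nhdsWithin {a b t₀ : ℝ} (hab : a < b) (ht₀ : t₀ ∈ Icc a b) {N : Set ℝ}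
    (hN : N ∈ 𝓝[Icc a b] t₀) {δ : ℝ} (hδ : 0 < δ) :
    ∃ a' b', a' < b' ∧ b' - a' ≤ δ ∧ Icc a' b' ⊆ Icc a b ∧ Icc a' b' ⊆ N ∧ t₀ ∈ Icc a' b' ∧
      Icc a' b' ∈ 𝓝[Icc a b] t₀ := by
  obtain ⟨ε, hε, hεN⟩ := Metric.mem_nhdsWithin_iff.1 hN
  set η := min (ε / 2) (δ / 2) with hη
  have hη0 : 0 < η := by positivity
  have hη1 : η < ε := (min_le_left _ _).trans_lt (by linarith)
  have hη2 : η ≤ δ / 2 := min_le_right _ _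
  have heq : Icc (max a (t₀ - η)) (min b (t₀ + η)) = Icc a b ∩ Icc (t₀ - η) (t₀ + η) :=
    Icc_inter_Icc.symm
  refine ⟨max a (t₀ - η), min b (t₀ + η), ?_, ?_, ?_, ?_, ?_, ?_⟩
  · rw [max_lt_iff, lt_min_iff, lt_min_iff]
    exact ⟨⟨hab, by linarith [ht₀.1]⟩, by linarith [ht₀.2], by linarith⟩
  · linarith [min_le_right b (t₀ + η), le_max_right a (t₀ - η)]
  · rw [heq]; exact inter_subset_left
  · rw [heq]
    intro x hx
    refine hεN ⟨?_, hx.1⟩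
    rw [Metric.mem_ball, Real.dist_eq, abs_lt]
    constructor <;> linarith [hx.2.1, hx.2.2]
  · rw [heq]; exact ⟨ht₀, by linarith, by linarith⟩
  · rw [heq]
    exact inter_mem self_mem_nhdsWithin
      (mem_nhdsWithin_of_mem_nhds (Icc_mem_nhds (by linarith) (by linarith)))

theorem hasDerivWithinAt_Icc_glue {F : Type*} [NormedAddCommGroup F] [NormedSpace ℝ F]
    {g : ℝ → F} {g' : F} {s₁ s₂ s₃ r : ℝ} (h₁₂ : s₁ ≤ s₂) (h₂₃ : s₂ ≤ s₃)
    (hl : r ≤ s₂ → HasDerivWithinAt g g' (Icc s₁ s₂) r)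
    (hr : s₂ ≤ r → HasDerivWithinAt g g' (Icc s₂ s₃) r) :
    HasDerivWithinAt g g' (Icc s₁ s₃) r := by
  rw [← Icc_union_Icc_eq_Icc h₁₂ h₂₃]
  rcases lt_trichotomy r s₂ with h | h | h
  · refine (hl h.le).union (HasFDerivWithinAt.of_notMem_closure ?_)
    rw [isClosed_Icc.closure_eq]; exact fun h' => absurd h'.1 (not_le.2 h)
  · exact (hl h.le).union (hr h.ge)
  · refine HasDerivWithinAt.union (HasFDerivWithinAt.of_notMem_closure ?_) (hr h.le)
    rw [isClosed_Icc.closure_eq]; exact fun h' => absurd h'.2 (not_le.2 h)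

variable {E : Type*} [NormedAddCommGroup E] [NormedSpace ℝ E]
  {M : Type*} [TopologicalSpace M] [ChartedSpace E M] [IsManifold 𝓘(ℝ, E) ∞ M]

theorem contDiffAt_fderiv_chartVec {X : ∀ x : M, TangentSpace 𝓘(ℝ, E) x}
    (hX : SmoothOn X univ) {a x : M} (hx : x ∈ (extChartAt 𝓘(ℝ, E) a).source) :
    ContDiffAt ℝ ∞ (fderiv ℝ (chartVec X a)) (extChartAt 𝓘(ℝ, E) a x) :=
  (contDiffAt_chartVec hX isOpen_univ (mem_univ _) hx).fderiv_right (by simp)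

/-- `Φ` is a frame along `c` that is invariant under the flow of `X`. -/
def IsInvariantFrame (X : ∀ x : M, TangentSpace 𝓘(ℝ, E) x) (c : ℝ → M) (s : Set ℝ)
    (Φ : ℝ → E ≃L[ℝ] E) : Prop :=
  ∀ v : E, ∀ r ∈ s, InvariantIn X c (c r) s (fun τ => Φ τ v) r

/-- The invariant frame in the chart centred at `a`. -/
noncomputable def frameIn (c : ℝ → M) (Φ : ℝ → E ≃L[ℝ] E) (a : M) (τ : ℝ) : E →L[ℝ] E :=
  (coordL (E := E) a (c τ)).comp (Φ τ : E →L[ℝ] E)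

theorem frameIn_self (c : ℝ → M) (Φ : ℝ → E ≃L[ℝ] E) (t : ℝ) :
    frameIn c Φ (c t) t = (Φ t : E →L[ℝ] E) := by
  rw [frameIn, coordL_self]; ext v; rfl

variable [FiniteDimensional ℝ E]

/-- In a chart, an integral curve of a smooth vector field is smooth. -/
theorem contDiffOn_chart_integralCurve {X : ∀ x : M, TangentSpace 𝓘(ℝ, E) x}
    (hX : SmoothOn X univ) {c : ℝ → M} {a b t₀ : ℝ} (hc : IsMIntegralCurveOn c X (Icc a b))
    (hsrc : ∀ t ∈ Icc a b, c t ∈ (extChartAt 𝓘(ℝ, E) (c t₀)).source) :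
    ContDiffOn ℝ ∞ (fun t => extChartAt 𝓘(ℝ, E) (c t₀) (c t)) (Icc a b) := by
  have : CompleteSpace E := FiniteDimensional.complete ℝ E
  refine ODE.contDiffOn_enat_Icc_of_hasDerivWithinAt (n := ⊤)
    (f := fun _ => chartVec X (c t₀)) (u := (extChartAt 𝓘(ℝ, E) (c t₀)).target) ?_
    (fun t ht => hasDerivWithinAt_chart hc ht (hsrc t ht))
    (fun t ht => (extChartAt 𝓘(ℝ, E) (c t₀)).map_source (hsrc t ht))
  rintro ⟨t, y⟩ ⟨-, hy⟩
  have h := contDiffAt_chartVec hX isOpen_univ (mem_univ _)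
    ((extChartAt 𝓘(ℝ, E) (c t₀)).map_target hy)
  rw [(extChartAt 𝓘(ℝ, E) (c t₀)).right_inv hy] at h
  exact (h.comp (t, y) contDiffAt_snd).contDiffWithinAt

theorem contMDiffOn_integralCurve {X : ∀ x : M, TangentSpace 𝓘(ℝ, E) x}
    (hX : SmoothOn X univ) {c : ℝ → M} {a b : ℝ} (hab : a < b)
    (hc : IsMIntegralCurveOn c X (Icc a b)) :
    ContMDiffOn 𝓘(ℝ, ℝ) 𝓘(ℝ, E) ∞ c (Icc a b) := by
  intro t ht
  refine contMDiffWithinAt_iff_target.2 ⟨hc.continuousWithinAt ht, ?_⟩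
  obtain ⟨a', b', -, -, hsub, hN, ht', hmem⟩ := exists_Icc_mem_nhdsWithin hab ht
    ((hc.continuousWithinAt ht) (extChartAt_source_mem_nhds (I := 𝓘(ℝ, E)) (c t))) one_pos
  have := contDiffOn_chart_integralCurve hX (t₀ := t) (hc.mono hsub) hN t ht'
  exact (this.mono_of_mem_nhdsWithin hmem).contMDiffWithinAt

/-- The fundamental matrix of the linearised equation in the chart at `c t₀`, started at the
identity, remains invertible near `t₀`; read in the tangent spaces it is the required frame. -/
theorem exists_isInvariantFrame_local {X : ∀ x : M, TangentSpace 𝓘(ℝ, E) x}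
    (hX : SmoothOn X univ) {c : ℝ → M} {a b t₀ : ℝ} (hab : a < b) (ht₀ : t₀ ∈ Icc a b)
    (hc : IsMIntegralCurveOn c X (Icc a b)) :
    ∃ N ∈ 𝓝[Icc a b] t₀, N ⊆ Icc a b ∧ ∃ Φ : ℝ → E ≃L[ℝ] E, IsInvariantFrame X c N Φ := by
  have : CompleteSpace E := FiniteDimensional.complete ℝ E
  set A : ℝ → E →L[ℝ] E := fun τ =>
    fderiv ℝ (chartVec X (c t₀)) (extChartAt 𝓘(ℝ, E) (c t₀) (c τ)) with hA
  have hsrcN := (hc.continuousWithinAt ht₀) (extChartAt_source_mem_nhds (I := 𝓘(ℝ, E)) (c t₀))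
  have hAc : ∀ τ ∈ Icc a b, c τ ∈ (extChartAt 𝓘(ℝ, E) (c t₀)).source →
      ContinuousWithinAt A (Icc a b) τ := fun τ hτ hτs =>
    ContinuousAt.comp_continuousWithinAt (f := fun r => extChartAt 𝓘(ℝ, E) (c t₀) (c r))
      (contDiffAt_fderiv_chartVec hX hτs).continuousAt
      (hasDerivWithinAt_chart hc hτ hτs).continuousWithinAt
  have hbd : ∀ᶠ τ in 𝓝[Icc a b] t₀, ‖A τ‖ < ‖A t₀‖ + 1 :=
    (hAc t₀ ht₀ (mem_extChartAt_source _)).norm.eventually_lt_const (by linarith)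
  set K : NNReal := ‖A t₀‖₊ + 1 with hK
  have hKpos : (0 : ℝ) < K := by rw [hK]; push_cast; positivity
  obtain ⟨a', b', hab', hlen, hsub, hN, ht', hmem⟩ := exists_Icc_mem_nhdsWithin hab ht₀
    (inter_mem hsrcN hbd) (δ := 1 / (2 * K)) (by positivity)
  -- The matrix equation `q' = A q`, viewed as a linear equation on the space of endomorphisms; `‖B
  -- τ‖ ≤ ‖A τ‖`.
  set B : ℝ → (E →L[ℝ] E) →L[ℝ] (E →L[ℝ] E) := fun τ =>
    ContinuousLinearMap.compL ℝ E E E (A τ) with hB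
  obtain ⟨q, hq₀, hq⟩ := exists_linear_solution (A := B) (a := a') (b := b') (K := K)
    (fun τ hτ => (ContinuousLinearMap.compL ℝ E E E).continuous.continuousAt.comp_continuousWithinAt
      ((hAc τ (hsub hτ) (hN hτ).1).mono hsub))
    (fun τ hτ => by
      have h1 : ‖A τ‖ ≤ K := (le_of_lt (hN hτ).2).trans (by rw [hK]; push_cast; rfl)
      refine (ContinuousLinearMap.opNorm_le_bound _ (norm_nonneg _) fun y => ?_).trans h1
      exact ContinuousLinearMap.opNorm_comp_le _ _)
    (by
      calc 2 * (K : ℝ) * (b' - a') ≤ 2 * K * (1 / (2 * K)) := by gcongr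
        _ = 1 := by field_simp) ht' (1 : E →L[ℝ] E)
  have hunit : ∀ᶠ τ in 𝓝[Icc a' b'] t₀, IsUnit (q τ) := by
    have h1 : {g : E →L[ℝ] E | IsUnit g} ∈ 𝓝 (q t₀) :=
      Units.isOpen.mem_nhds (by rw [hq₀]; exact isUnit_one)
    exact (hq t₀ ht').continuousWithinAt h1
  set N : Set ℝ := {τ | τ ∈ Icc a' b' ∧ IsUnit (q τ)} with hNdef
  have hNmem : N ∈ 𝓝[Icc a' b'] t₀ := inter_mem self_mem_nhdsWithin hunit
  have hNmem' : N ∈ 𝓝[Icc a b] t₀ := by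
    -- Since `Icc a' b'` is a neighbourhood of `t₀` within `Icc a b`, the two neighbourhood filters
    -- coincide.
    rw [← nhdsWithin_inter_of_mem hmem, inter_eq_left.2 hsub] at *
    exact hNmem
  have hΦ : ∀ τ ∈ N, ∃ e : E ≃L[ℝ] E, ∀ v, coordL (E := E) (c t₀) (c τ) (e v) = q τ v := by
    intro τ hτ
    obtain ⟨g, hg⟩ := hτ.2
    have hs : c τ ∈ (extChartAt 𝓘(ℝ, E) (c t₀)).source := (hN hτ.1).1
    have hinj : Function.Injective
        ((tangentCoordChange 𝓘(ℝ, E) (c t₀) (c τ) (c τ)).comp (q τ)) := by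
      intro v w hvw
      have := congrArg (coordL (E := E) (c t₀) (c τ)) hvw
      simp only [ContinuousLinearMap.comp_apply, coordL_tangentCoordChange hs] at this
      rw [← hg] at this
      exact (ContinuousLinearEquiv.ofUnit g).injective this
    refine ⟨(LinearEquiv.ofInjectiveEndo _ hinj).toContinuousLinearEquiv, fun v => ?_⟩
    exact coordL_tangentCoordChange hs _
  have : Nonempty (E ≃L[ℝ] E) := ⟨ContinuousLinearEquiv.refl ℝ E⟩
  choose! Φ hΦ using hΦ
  refine ⟨N, hNmem', fun τ hτ => hsub hτ.1, Φ, fun v r hr => ?_⟩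
  have hNs : N ⊆ Icc a b := fun τ hτ => hsub hτ.1
  refine InvariantIn.change_chart hX (hc.mono hNs) (t₁ := t₀) hr (hN hr.1).1
    (mem_extChartAt_source _) ?_
  have h1 : HasDerivWithinAt (fun τ => q τ v) ((A r) (q r v)) N r :=
    ((hq r hr.1).clm_apply (hasDerivWithinAt_const r _ v)).congr_deriv (by simp [hB])
      |>.mono fun τ hτ => hτ.1
  rw [InvariantIn, hΦ r hr]
  exact h1.congr (fun τ hτ => hΦ τ hτ v) (hΦ r hr v)

/-- Invariance is a linear condition with constant coefficients on the right of `Φ`: composing a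
frame with a fixed automorphism of `E` keeps it invariant. Local frames can thus be matched at a
common time and glued. -/
theorem exists_isInvariantFrame {X : ∀ x : M, TangentSpace 𝓘(ℝ, E) x}
    (hX : SmoothOn X univ) {c : ℝ → M} {a b : ℝ} (hab : a < b)
    (hc : IsMIntegralCurveOn c X (Icc a b)) :
    ∃ Φ : ℝ → E ≃L[ℝ] E, IsInvariantFrame X c (Icc a b) Φ := by
  refine rel_of_local_of_trans
    (P := fun s₁ s₂ => ∃ Φ : ℝ → E ≃L[ℝ] E, IsInvariantFrame X c (Icc s₁ s₂) Φ) hab.le ?_ ?_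
  · intro s hs
    obtain ⟨N, hN, hNs, Φ, hΦ⟩ := exists_isInvariantFrame_local hX hab hs hc
    obtain ⟨ε, hε, hεN⟩ := Metric.mem_nhdsWithin_iff.1 hN
    refine ⟨ε, hε, fun s₁ h₁ s₂ h₂ _ hd₁ hd₂ => ⟨Φ, fun v r hr => ?_⟩⟩
    have hsub : Icc s₁ s₂ ⊆ N := fun x hx => hεN ⟨by
      rw [Metric.mem_ball, Real.dist_eq]
      rw [abs_lt] at *
      constructor <;> linarith [hx.1, hx.2], ⟨h₁.1.trans hx.1, hx.2.trans h₂.2⟩⟩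
    exact (hΦ v r (hsub hr)).mono hsub
  · rintro s₁ - s₂ - s₃ - h₁₂ h₂₃ ⟨Φ, hΦ⟩ ⟨Ψ, hΨ⟩
    -- The second frame is precomposed with `(Ψ s₂)⁻¹ ∘ Φ s₂`, so that the two agree at `s₂`.
    refine ⟨fun τ => if τ ≤ s₂ then Φ τ else
      ((Φ s₂).trans (Ψ s₂).symm).trans (Ψ τ), fun v r hr => ?_⟩
    set Θ : ℝ → E := fun τ => (if τ ≤ s₂ then Φ τ else
      ((Φ s₂).trans (Ψ s₂).symm).trans (Ψ τ)) v with hΘ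
    have e1 : ∀ τ ∈ Icc s₁ s₂, Θ τ = Φ τ v := fun τ hτ => by simp [hΘ, hτ.2]
    have e2 : ∀ τ ∈ Icc s₂ s₃, Θ τ = Ψ τ ((Ψ s₂).symm (Φ s₂ v)) := fun τ hτ => by
      rcases hτ.1.eq_or_lt with h | h
      · subst h; simp [hΘ]
      · simp [hΘ, not_le.2 h]
    change InvariantIn X c (c r) (Icc s₁ s₃) Θ r
    refine hasDerivWithinAt_Icc_glue h₁₂ h₂₃ (fun h => ?_) (fun h => ?_)
    · have hr' : r ∈ Icc s₁ s₂ := ⟨hr.1, h⟩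
      have := hΦ v r hr'
      rw [InvariantIn, ← e1 r hr'] at this
      exact this.congr (fun τ hτ => by rw [e1 τ hτ]) (by rw [e1 r hr'])
    · have hr' : r ∈ Icc s₂ s₃ := ⟨h, hr.2⟩
      have := hΨ ((Ψ s₂).symm (Φ s₂ v)) r hr'
      rw [InvariantIn, ← e2 r hr'] at this
      exact this.congr (fun τ hτ => by rw [e2 τ hτ]) (by rw [e2 r hr'])

/-- Near `t₀` the columns of the frame, in the chart at `c t₀`, solve a linear equation whose
coefficients are smooth along `c`. -/
theorem IsInvariantFrame.contDiffWithinAt {X : ∀ x : M, TangentSpace 𝓘(ℝ, E) x}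
    (hX : SmoothOn X univ) {c : ℝ → M} {a b t₀ : ℝ} (hab : a < b) (ht₀ : t₀ ∈ Icc a b)
    (hc : IsMIntegralCurveOn c X (Icc a b)) {Φ : ℝ → E ≃L[ℝ] E}
    (hΦ : IsInvariantFrame X c (Icc a b) Φ) :
    ContDiffWithinAt ℝ ∞ (frameIn c Φ (c t₀)) (Icc a b) t₀ := by
  obtain ⟨a', b', hab', -, hsub, hN, ht', hmem⟩ := exists_Icc_mem_nhdsWithin hab ht₀
    ((hc.continuousWithinAt ht₀) (extChartAt_source_mem_nhds (I := 𝓘(ℝ, E)) (c t₀))) one_pos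
  suffices h : ContDiffOn ℝ ∞ (frameIn c Φ (c t₀)) (Icc a' b') from
    (h t₀ ht').mono_of_mem_nhdsWithin hmem
  rw [contDiffOn_clm_apply]
  intro v
  have : CompleteSpace E := FiniteDimensional.complete ℝ E
  have hu := contDiffOn_chart_integralCurve hX (t₀ := t₀) (hc.mono hsub) hN
  refine ODE.contDiffOn_enat_Icc_of_hasDerivWithinAt (n := ⊤)
    (f := fun τ z => fderiv ℝ (chartVec X (c t₀)) (extChartAt 𝓘(ℝ, E) (c t₀) (c τ)) z)
    (u := univ) ?_ (fun τ hτ => ?_) (mapsTo_univ _ _)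
  · have h1 : ContDiffOn ℝ ∞
        (fun τ => fderiv ℝ (chartVec X (c t₀)) (extChartAt 𝓘(ℝ, E) (c t₀) (c τ))) (Icc a' b') :=
      fun τ hτ => (contDiffAt_fderiv_chartVec hX (hN hτ)).comp_contDiffWithinAt τ (hu τ hτ)
    exact ContDiffOn.clm_apply (h1.comp contDiffOn_fst fun x hx => hx.1) contDiffOn_snd
  · have h := InvariantIn.change_chart hX hc (hsub hτ) (mem_extChartAt_source _) (hN hτ)
      (hΦ v τ (hsub hτ))
    exact HasDerivWithinAt.mono h hsub

/-- Smoothness of a field along `c` can be read off in an invariant frame. -/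
theorem IsInvariantFrame.contMDiffWithinAt_iff {X : ∀ x : M, TangentSpace 𝓘(ℝ, E) x}
    (hX : SmoothOn X univ) {c : ℝ → M} {a b t : ℝ} (hab : a < b) {s : Set ℝ} (hs : s ⊆ Icc a b)
    (ht : t ∈ s) (hc : IsMIntegralCurveOn c X (Icc a b)) {Φ : ℝ → E ≃L[ℝ] E}
    (hΦ : IsInvariantFrame X c (Icc a b) Φ) (W : ∀ t : ℝ, TangentSpace 𝓘(ℝ, E) (c t)) :
    ContMDiffWithinAt 𝓘(ℝ, ℝ) 𝓘(ℝ, E).tangent ∞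
      (fun t => (⟨c t, W t⟩ : TangentBundle 𝓘(ℝ, E) M)) s t ↔
    ContDiffWithinAt ℝ ∞ (fun t => (Φ t).symm (W t)) s t := by
  have : CompleteSpace E := FiniteDimensional.complete ℝ E
  have hq : ContDiffWithinAt ℝ ∞ (frameIn c Φ (c t)) s t :=
    (hΦ.contDiffWithinAt hX hab (hs ht) hc).mono hs
  have hqW : ∀ τ, coordL (E := E) (c t) (c τ) (W τ) = frameIn c Φ (c t) τ ((Φ τ).symm (W τ)) :=
    fun τ => by
      change _ = coordL (E := E) (c t) (c τ) (Φ τ ((Φ τ).symm (W τ)))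
      exact congrArg _ ((Φ τ).apply_symm_apply (W τ)).symm
  rw [contMDiffWithinAt_lift_iff (a := c t) (mem_extChartAt_source _),
    contMDiffWithinAt_iff_contDiffWithinAt]
  simp only [hqW]
  constructor
  · rintro ⟨-, h⟩
    -- Inversion is smooth near the isomorphism `Φ t`, so coordinates in the frame are smooth
    -- functions of coordinates in the chart.
    have hinv : ContDiffWithinAt ℝ ∞ (fun τ => (frameIn c Φ (c t) τ).inverse) s t := by
      refine ContDiffAt.comp_contDiffWithinAt t (g := ContinuousLinearMap.inverse) ?_ hq
      rw [frameIn_self]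
      exact contDiffAt_map_inverse (Φ t)
    refine (hinv.clm_apply h).congr_of_eventuallyEq ?_ ?_
    · have hev : ∀ᶠ τ in 𝓝[s] t, frameIn c Φ (c t) τ ∈
          range ((↑) : (E ≃L[ℝ] E) → E →L[ℝ] E) :=
        hq.continuousWithinAt (by rw [frameIn_self]; exact ContinuousLinearEquiv.nhds (Φ t))
      filter_upwards [hev] with τ ⟨e, he⟩
      simp only [← he]
      simp
    · simp only [frameIn_self]
      simp
  · intro h
    exact ⟨(contMDiffOn_integralCurve hX hab hc t (hs ht)).mono hs, hq.clm_apply h⟩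

/-- In an invariant frame, the bracket with `X` is the derivative. -/
theorem IsInvariantFrame.bracketAlong_eq {X : ∀ x : M, TangentSpace 𝓘(ℝ, E) x}
    (hX : SmoothOn X univ) {c : ℝ → M} {a b t : ℝ} (hab : a < b) {s : Set ℝ} (hs : s ⊆ Icc a b)
    (ht : t ∈ s) (hst : UniqueDiffWithinAt ℝ s t) (hc : IsMIntegralCurveOn c X (Icc a b))
    {Φ : ℝ → E ≃L[ℝ] E} (hΦ : IsInvariantFrame X c (Icc a b) Φ)
    (W : ∀ t : ℝ, TangentSpace 𝓘(ℝ, E) (c t))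
    (hW : DifferentiableWithinAt ℝ (fun t => (Φ t).symm (W t)) s t) :
    bracketAlong X c s W t = Φ t (derivWithin (fun t => (Φ t).symm (W t)) s t) := by
  set w : ℝ → E := fun t => (Φ t).symm (W t) with hw
  have hq : HasDerivWithinAt (frameIn c Φ (c t)) (derivWithin (frameIn c Φ (c t)) s t) s t :=
    (((hΦ.contDiffWithinAt hX hab (hs ht) hc).mono hs).differentiableWithinAt
      (by simp)).hasDerivWithinAt
  -- The derivative of the frame is `dX` applied to it. In the Leibniz rule for `W = Φ w` this term
  -- cancels the term `-(dX) W` of the bracket and leaves `Φ w'`.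
  have hq' : ∀ v, derivWithin (frameIn c Φ (c t)) s t v =
      fderiv ℝ (chartVec X (c t)) (extChartAt 𝓘(ℝ, E) (c t) (c t)) (Φ t v) := fun v => by
    have h1 := hq.clm_apply (hasDerivWithinAt_const t s v)
    have h2 : HasDerivWithinAt (fun τ => frameIn c Φ (c t) τ v) _ s t := (hΦ v t (hs ht)).mono hs
    have h3 := hst.eq_deriv _ h1 h2
    rw [map_zero, add_zero] at h3
    rw [h3, coordL_self]; rfl
  have hqW : ∀ τ, coordL (E := E) (c t) (c τ) (W τ) = frameIn c Φ (c t) τ (w τ) :=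
    fun τ => by
      change _ = coordL (E := E) (c t) (c τ) (Φ τ ((Φ τ).symm (W τ)))
      exact congrArg _ ((Φ τ).apply_symm_apply (W τ)).symm
  have hd := (hq.clm_apply hW.hasDerivWithinAt).derivWithin hst
  have e : (fun τ => coordL (E := E) (c t) (c τ) (W τ)) = fun τ => frameIn c Φ (c t) τ (w τ) :=
    funext hqW
  have hΦw : Φ t (w t) = W t := (Φ t).apply_symm_apply (W t)
  have h := DynPair.bracketAlong_eq X c s W t
  refine h.trans ?_
  have h5 : derivWithin (fun τ => coordL (E := E) (c t) (c τ) (W τ)) s t =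
      fderiv ℝ (chartVec X (c t)) (extChartAt 𝓘(ℝ, E) (c t) (c t)) (Φ t (w t)) +
        Φ t (derivWithin w s t) := by
    rw [e, hd, hq', frameIn_self]; rfl
  rw [hΦw] at h5
  exact sub_eq_iff_eq_add'.2 h5

end DynPair

namespace DynPair

/-! ### The differential of the flow -/

variable {E : Type*} [NormedAddCommGroup E] [NormedSpace ℝ E]
  {M : Type*} [TopologicalSpace M] [ChartedSpace E M]

theorem isMIntegralCurveOn_glue {X : ∀ x : M, TangentSpace 𝓘(ℝ, E) x} {γ δ : ℝ → M}
    {s₁ s₂ s₃ : ℝ} (h₁₂ : s₁ ≤ s₂) (h₂₃ : s₂ ≤ s₃) (hγ : IsMIntegralCurveOn γ X (Icc s₁ s₂))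
    (hδ : IsMIntegralCurveOn δ X (Icc s₂ s₃)) (h : γ s₂ = δ s₂) :
    IsMIntegralCurveOn (fun τ => if τ ≤ s₂ then γ τ else δ τ) X (Icc s₁ s₃) := by
  intro r hr
  set g : ℝ → M := fun τ => if τ ≤ s₂ then γ τ else δ τ with hg
  have e1 : EqOn g γ (Icc s₁ s₂) := fun τ hτ => by simp [hg, hτ.2]
  have e2 : EqOn g δ (Icc s₂ s₃) := fun τ hτ => by
    rcases hτ.1.eq_or_lt with h' | h'
    · subst h'; simp [hg, h]
    · simp [hg, not_le.2 h']
  have A : r ≤ s₂ → HasMFDerivAt[Icc s₁ s₂] g r ((1 : ℝ →L[ℝ] ℝ).smulRight (X (g r))) := by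
    intro h'
    have hr' : r ∈ Icc s₁ s₂ := ⟨hr.1, h'⟩
    have := hγ r hr'
    rw [← e1 hr'] at this
    exact this.congr_of_eventuallyEq (eventually_mem_nhdsWithin.mono fun x hx => e1 hx) (e1 hr')
  have B : s₂ ≤ r → HasMFDerivAt[Icc s₂ s₃] g r ((1 : ℝ →L[ℝ] ℝ).smulRight (X (g r))) := by
    intro h'
    have hr' : r ∈ Icc s₂ s₃ := ⟨h', hr.2⟩
    have := hδ r hr'
    rw [← e2 hr'] at this
    exact this.congr_of_eventuallyEq (eventually_mem_nhdsWithin.mono fun x hx => e2 hx) (e2 hr')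
  rcases lt_trichotomy r s₂ with h' | h' | h'
  · refine (A h'.le).mono_of_mem_nhdsWithin ?_
    filter_upwards [self_mem_nhdsWithin, mem_nhdsWithin_of_mem_nhds (Iio_mem_nhds h')] with x hx hx'
    exact ⟨hx.1, (mem_Iio.1 hx').le⟩
  · rw [← Icc_union_Icc_eq_Icc h₁₂ h₂₃]
    exact (A h'.le).union (B h'.ge)
  · refine (B h'.le).mono_of_mem_nhdsWithin ?_
    filter_upwards [self_mem_nhdsWithin, mem_nhdsWithin_of_mem_nhds (Ioi_mem_nhds h')] with x hx hx'
    exact ⟨(mem_Ioi.1 hx').le, hx.2⟩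

theorem hasMFDerivAt_comp_of_eq {G₁ G₂ : M → M} {x y : M} (hy : G₁ x = y) {A₁ A₂ : E →L[ℝ] E}
    (h₁ : HasMFDerivAt 𝓘(ℝ, E) 𝓘(ℝ, E) G₁ x A₁) (h₂ : HasMFDerivAt 𝓘(ℝ, E) 𝓘(ℝ, E) G₂ y A₂) :
    HasMFDerivAt 𝓘(ℝ, E) 𝓘(ℝ, E) (fun z => G₂ (G₁ z)) x (A₂.comp A₁) := by
  subst hy
  exact HasMFDerivAt.comp x h₂ h₁

/-- The local flow of `X` from time `s₁` to time `s₂` is defined near `c s₁`, and its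
differential there is given by an invariant frame along `c`. -/
def FlowsAlong (X : ∀ x : M, TangentSpace 𝓘(ℝ, E) x) (c : ℝ → M) (Φ : ℝ → E ≃L[ℝ] E)
    (s₁ s₂ : ℝ) : Prop :=
  ∃ G : M → M, G (c s₁) = c s₂ ∧
    HasMFDerivAt 𝓘(ℝ, E) 𝓘(ℝ, E) G (c s₁) ((Φ s₁).symm.trans (Φ s₂) : E →L[ℝ] E) ∧
    ∀ᶠ y in 𝓝 (c s₁), ∃ γ : ℝ → M, γ s₁ = y ∧ γ s₂ = G y ∧ IsMIntegralCurveOn γ X (Icc s₁ s₂)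

/-- The local flows compose, and their differentials telescope: `(Φ s₃ Φ s₂⁻¹)(Φ s₂ Φ s₁⁻¹) = Φ s₃ Φ
s₁⁻¹`. -/
theorem FlowsAlong.trans {X : ∀ x : M, TangentSpace 𝓘(ℝ, E) x} {c : ℝ → M} {Φ : ℝ → E ≃L[ℝ] E}
    {s₁ s₂ s₃ : ℝ} (h₁₂ : s₁ ≤ s₂) (h₂₃ : s₂ ≤ s₃) (h : FlowsAlong X c Φ s₁ s₂)
    (h' : FlowsAlong X c Φ s₂ s₃) : FlowsAlong X c Φ s₁ s₃ := by
  obtain ⟨G₁, hG₁, hd₁, hγ₁⟩ := h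
  obtain ⟨G₂, hG₂, hd₂, hγ₂⟩ := h'
  refine ⟨fun z => G₂ (G₁ z), by simp only [hG₁, hG₂], ?_, ?_⟩
  · have := hasMFDerivAt_comp_of_eq hG₁ hd₁ hd₂
    have e : ((Φ s₂).symm.trans (Φ s₃) : E →L[ℝ] E).comp ((Φ s₁).symm.trans (Φ s₂) : E →L[ℝ] E) =
        ((Φ s₁).symm.trans (Φ s₃) : E →L[ℝ] E) := by ext v; simp
    exact this.congr_mfderiv e
  · have hcont : Tendsto G₁ (𝓝 (c s₁)) (𝓝 (c s₂)) := by
      have := hd₁.continuousAt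
      rwa [ContinuousAt, hG₁] at this
    filter_upwards [hγ₁, hcont.eventually hγ₂] with y ⟨γ, h1, h2, h3⟩ ⟨δ, h4, h5, h6⟩
    refine ⟨fun τ => if τ ≤ s₂ then γ τ else δ τ, by simp [h₁₂, h1], ?_,
      isMIntegralCurveOn_glue h₁₂ h₂₃ h3 h6 (by rw [h2, h4])⟩
    rcases h₂₃.eq_or_lt with h | h
    · subst h; simp only [le_refl, if_true]; rw [h2, ← h5, h4]
    · simp [not_le.2 h, h5]

variable [IsManifold 𝓘(ℝ, E) ∞ M]

theorem tangentCoordChange_coordL {a x : M} (ha : x ∈ (extChartAt 𝓘(ℝ, E) a).source) (v : E) :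
    tangentCoordChange 𝓘(ℝ, E) a x x (coordL (E := E) a x v) = v := by
  rw [coordL, tangentCoordChange_comp ⟨⟨mem_extChartAt_source x, ha⟩, mem_extChartAt_source x⟩,
    tangentCoordChange_self (mem_extChartAt_source x)]

/-- The differential of a map which is given in the chart centred at `a`. -/
theorem hasMFDerivAt_of_chart {a x y : M} (hx : x ∈ (extChartAt 𝓘(ℝ, E) a).source)
    (hy : y ∈ (extChartAt 𝓘(ℝ, E) a).source) {G : E → E} {Q A : E →L[ℝ] E}
    (hG : HasFDerivAt G Q (extChartAt 𝓘(ℝ, E) a x))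
    (hGx : G (extChartAt 𝓘(ℝ, E) a x) = extChartAt 𝓘(ℝ, E) a y)
    (hA : ∀ v, Q (coordL (E := E) a x v) = coordL (E := E) a y (A v)) :
    HasMFDerivAt 𝓘(ℝ, E) 𝓘(ℝ, E)
      (fun z => (extChartAt 𝓘(ℝ, E) a).symm (G (extChartAt 𝓘(ℝ, E) a z))) x A := by
  set F : M → M := fun z => (extChartAt 𝓘(ℝ, E) a).symm (G (extChartAt 𝓘(ℝ, E) a z)) with hF
  have hFx : F x = y := by
    rw [hF]; simp only [hGx]; exact (extChartAt 𝓘(ℝ, E) a).left_inv hy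
  have hxx := mem_extChartAt_source (I := 𝓘(ℝ, E)) x
  have hyy := mem_extChartAt_source (I := 𝓘(ℝ, E)) y
  refine ⟨?_, ?_⟩
  · have h1 : ContinuousAt (extChartAt 𝓘(ℝ, E) a) x := continuousAt_extChartAt' hx
    have h2 : ContinuousAt (extChartAt 𝓘(ℝ, E) a).symm (G (extChartAt 𝓘(ℝ, E) a x)) := by
      rw [hGx]; exact continuousAt_extChartAt_symm' hy
    exact ContinuousAt.comp (g := (extChartAt 𝓘(ℝ, E) a).symm)
      (f := fun z => G (extChartAt 𝓘(ℝ, E) a z)) h2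
      (ContinuousAt.comp (g := G) (f := extChartAt 𝓘(ℝ, E) a) hG.continuousAt h1)
  · have d1 : HasFDerivAt (transition (E := E) x a)
        (fderiv ℝ (transition x a) (extChartAt 𝓘(ℝ, E) x x)) (extChartAt 𝓘(ℝ, E) x x) :=
      ((contDiffAt_transition hxx hx).differentiableAt (by simp)).hasFDerivAt
    have d2 : HasFDerivAt (transition (E := E) a y)
        (fderiv ℝ (transition a y) (extChartAt 𝓘(ℝ, E) a y)) (extChartAt 𝓘(ℝ, E) a y) :=
      ((contDiffAt_transition hy hyy).differentiableAt (by simp)).hasFDerivAt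
    have e0 : transition (E := E) x a (extChartAt 𝓘(ℝ, E) x x) = extChartAt 𝓘(ℝ, E) a x := by
      simp only [transition, Function.comp_apply, (extChartAt 𝓘(ℝ, E) x).left_inv hxx]
    have d3 : HasFDerivAt (fun z => G (transition x a z))
        (Q.comp (fderiv ℝ (transition x a) (extChartAt 𝓘(ℝ, E) x x))) (extChartAt 𝓘(ℝ, E) x x) :=
      HasFDerivAt.comp (g := G) _ (by rw [e0]; exact hG) d1
    have d4 := HasFDerivAt.comp (g := transition a y) (f := fun z => G (transition x a z))
      (extChartAt 𝓘(ℝ, E) x x) (by rw [e0, hGx]; exact d2) d3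
    have e1 : (fderiv ℝ (transition (E := E) a y) (extChartAt 𝓘(ℝ, E) a y)).comp
        (Q.comp (fderiv ℝ (transition x a) (extChartAt 𝓘(ℝ, E) x x))) = A := by
      ext v
      have h1 : fderiv ℝ (transition (E := E) x a) (extChartAt 𝓘(ℝ, E) x x) v =
          coordL (E := E) a x v := by
        rw [coordL_transition hxx hx, coordL_self]; rfl
      rw [ContinuousLinearMap.comp_apply, ContinuousLinearMap.comp_apply, h1, hA,
        ← coordL_transition hy hyy, coordL_self]
      rfl
    rw [e1] at d4
    rw [writtenInExtChartAt, hFx]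
    exact d4.hasFDerivWithinAt

variable [FiniteDimensional ℝ E]

/-- Within one chart the differential of the flow is the solution operator of the linearised
equation, and the frame `Φ` supplies the solutions with arbitrary initial value. -/
theorem flowsAlong_local {X : ∀ x : M, TangentSpace 𝓘(ℝ, E) x}
    (hX : SmoothOn X univ) {c : ℝ → M} {a b s : ℝ} (hs : s ∈ Icc a b)
    (hc : IsMIntegralCurveOn c X (Icc a b)) {Φ : ℝ → E ≃L[ℝ] E}
    (hΦ : IsInvariantFrame X c (Icc a b) Φ) :
    ∃ ε > 0, ∀ s₁ ∈ Icc a b, ∀ s₂ ∈ Icc a b, s₁ ≤ s₂ → |s₁ - s| < ε → |s₂ - s| < ε →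
      FlowsAlong X c Φ s₁ s₂ := by
  have : CompleteSpace E := FiniteDimensional.complete ℝ E
  have hself := mem_extChartAt_source (I := 𝓘(ℝ, E)) (c s)
  obtain ⟨ε, hε, ρ, hρ, H⟩ := exists_local_flow_hasFDerivAt (f := chartVec X (c s))
    ((contDiffAt_chartVec hX isOpen_univ (mem_univ _) hself).of_le ENat.LEInfty.out)
    ((isOpen_extChartAt_target (I := 𝓘(ℝ, E)) (c s)).mem_nhds (mem_extChartAt_target (c s)))
  have h1 := (hc.continuousWithinAt hs) (extChartAt_source_mem_nhds (I := 𝓘(ℝ, E)) (c s))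
  have h2 := (hasDerivWithinAt_chart hc (t₀ := s) hs hself).continuousWithinAt
    (Metric.ball_mem_nhds _ hρ)
  obtain ⟨η, hη, hηN⟩ := Metric.mem_nhdsWithin_iff.1 (inter_mem h1 h2)
  refine ⟨min η (ε / 2), by positivity, fun s₁ h₁ s₂ h₂ h₁₂ hd₁ hd₂ => ?_⟩
  rw [lt_min_iff, abs_lt, abs_lt] at hd₁ hd₂
  have hsub : Icc s₁ s₂ ⊆ Icc a b := Icc_subset_Icc h₁.1 h₂.2
  have hN : ∀ τ ∈ Icc s₁ s₂, c τ ∈ (extChartAt 𝓘(ℝ, E) (c s)).source ∧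
      extChartAt 𝓘(ℝ, E) (c s) (c τ) ∈ Metric.ball (extChartAt 𝓘(ℝ, E) (c s) (c s)) ρ :=
    fun τ hτ => hηN ⟨by
      rw [Metric.mem_ball, Real.dist_eq, abs_lt]
      constructor <;> linarith [hτ.1, hτ.2, hd₁.1.1, hd₂.1.2], hsub hτ⟩
  have hs₁ : s₁ ∈ Icc s₁ s₂ := ⟨le_rfl, h₁₂⟩
  have hs₂ : s₂ ∈ Icc s₁ s₂ := ⟨h₁₂, le_rfl⟩
  -- `P v` is the constant vector whose image under `Φ s₁` has chart coordinates `v`; then `Φ τ (P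
  -- v)` is the linearised solution starting at `v`.
  set P : E →L[ℝ] E := (Φ s₁).symm.toContinuousLinearMap.comp
    (tangentCoordChange 𝓘(ℝ, E) (c s) (c s₁) (c s₁)) with hP
  obtain ⟨G, hG, hGd, hγ⟩ := H s₁ s₂ h₁₂ (by linarith [hd₁.2.1, hd₂.2.2])
    (fun τ => extChartAt 𝓘(ℝ, E) (c s) (c τ))
    (fun τ hτ => (hasDerivWithinAt_chart hc (hsub hτ) (hN τ hτ).1).mono hsub)
    (fun τ hτ => (hN τ hτ).2) ((frameIn c Φ (c s) s₂).comp P) (fun v => by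
      refine ⟨fun τ => frameIn c Φ (c s) τ (P v), ?_, rfl, fun τ hτ => ?_⟩
      · simp only [frameIn, hP, ContinuousLinearMap.comp_apply, ContinuousLinearEquiv.coe_coe,
          ContinuousLinearEquiv.apply_symm_apply]
        exact coordL_tangentCoordChange (hN s₁ hs₁).1 v
      · have h := InvariantIn.change_chart hX hc (hsub hτ) (mem_extChartAt_source _) (hN τ hτ).1
          (hΦ (P v) τ (hsub hτ))
        exact HasDerivWithinAt.mono h hsub)
  refine ⟨fun z => (extChartAt 𝓘(ℝ, E) (c s)).symm (G (extChartAt 𝓘(ℝ, E) (c s) z)), ?_, ?_, ?_⟩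
  · simp only [hG]
    exact (extChartAt 𝓘(ℝ, E) (c s)).left_inv (hN s₂ hs₂).1
  · refine hasMFDerivAt_of_chart (hN s₁ hs₁).1 (hN s₂ hs₂).1 hGd hG fun v => ?_
    simp only [frameIn, hP, ContinuousLinearMap.comp_apply, ContinuousLinearEquiv.coe_coe,
      tangentCoordChange_coordL (hN s₁ hs₁).1]
    rfl
  · have hcont : ContinuousAt (extChartAt 𝓘(ℝ, E) (c s)) (c s₁) :=
      continuousAt_extChartAt' (hN s₁ hs₁).1
    filter_upwards [hcont.eventually hγ,
      (isOpen_extChartAt_source (I := 𝓘(ℝ, E)) (c s)).mem_nhds (hN s₁ hs₁).1] with y hy hys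
    obtain ⟨γ, hγ1, hγ2, hγ3⟩ := hy
    refine ⟨fun τ => (extChartAt 𝓘(ℝ, E) (c s)).symm (γ τ), ?_, ?_,
      isMIntegralCurveOn_of_chart (fun τ hτ => (hγ3 τ hτ).1) (fun τ hτ => (hγ3 τ hτ).2)⟩
    · simp only [hγ1]
      exact (extChartAt 𝓘(ℝ, E) (c s)).left_inv hys
    · simp only [hγ2]

/-- The differential of the flow along the integral curve `c`, in terms of an invariant frame. -/
theorem hasMFDerivAt_flow [T2Space M] {X : ∀ x : M, TangentSpace 𝓘(ℝ, E) x}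
    (hX : SmoothOn X univ) {c : ℝ → M} {t : ℝ} (ht : 0 < t)
    (hc : IsMIntegralCurveOn c X (Icc 0 t)) {Φ : ℝ → E ≃L[ℝ] E}
    (hΦ : IsInvariantFrame X c (Icc 0 t) Φ) :
    HasMFDerivAt 𝓘(ℝ, E) 𝓘(ℝ, E) (flow X t) (c 0)
      ((Φ 0).symm.trans (Φ t) : E →L[ℝ] E) := by
  have : CompleteSpace E := FiniteDimensional.complete ℝ E
  obtain ⟨G, hG, hd, hγ⟩ : FlowsAlong X c Φ 0 t :=
    rel_of_local_of_trans ht.le (fun s hs => flowsAlong_local hX hs hc hΦ)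
      (fun s₁ _ s₂ _ s₃ _ h₁₂ h₂₃ => FlowsAlong.trans h₁₂ h₂₃)
  -- Near `c 0` the integral curves reach time `t`, so by uniqueness `flow` takes no junk value
  -- there and coincides with the composed local flow.
  have hev : flow X t =ᶠ[𝓝 (c 0)] G := by
    filter_upwards [hγ] with y ⟨γ, h1, h2, h3⟩
    rw [← h1, flow_eq hX ht h3, h2, ← h1]
  exact hd.congr_of_eventuallyEq hev

end DynPair

namespace DynPair

/-! ### Structure equations of a frame -/

variable {E : Type*} [NormedAddCommGroup E] [NormedSpace ℝ E]
  {M : Type*} [TopologicalSpace M] [ChartedSpace E M] [IsManifold 𝓘(ℝ, E) ∞ M]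

/-- The fields `e_1, …, e_m, [X, e_1], …, [X, e_m]`. -/
noncomputable def prolong {m : ℕ} (X : ∀ x : M, TangentSpace 𝓘(ℝ, E) x)
    (e : Fin m → ∀ x : M, TangentSpace 𝓘(ℝ, E) x) :
    Fin m ⊕ Fin m → ∀ x : M, TangentSpace 𝓘(ℝ, E) x :=
  Sum.elim e fun i => bracket X (e i)

theorem chartVec_self (Y : ∀ x : M, TangentSpace 𝓘(ℝ, E) x) (x : M) :
    chartVec Y x (extChartAt 𝓘(ℝ, E) x x) = Y x := by
  rw [chartVec_extChartAt Y (mem_extChartAt_source x), coordL_self]; rfl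

theorem IsFrameOn.isSectionOn {m : ℕ} {𝒱 : ∀ x : M, Submodule ℝ (TangentSpace 𝓘(ℝ, E) x)}
    {e : Fin m → ∀ x : M, TangentSpace 𝓘(ℝ, E) x} {U : Set M} (he : IsFrameOn 𝒱 e U) (i : Fin m) :
    IsSectionOn 𝒱 (e i) U :=
  ⟨he.1 i, fun x hx => by rw [← (he.2 x hx).2]; exact Submodule.subset_span ⟨i, rfl⟩⟩

variable [FiniteDimensional ℝ E]

theorem SmoothOn.bracket {X Y : ∀ x : M, TangentSpace 𝓘(ℝ, E) x} {U : Set M}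
    (hX : SmoothOn X univ) (hU : IsOpen U) (hY : SmoothOn Y U) : SmoothOn (bracket X Y) U := by
  intro x hx
  have : CompleteSpace E := FiniteDimensional.complete ℝ E
  have : IsManifold 𝓘(ℝ, E) (((⊤ : ℕ∞) : WithTop ℕ∞) + 1) M := by
    simpa using (inferInstance : IsManifold 𝓘(ℝ, E) ∞ M)
  have : IsManifold 𝓘(ℝ, E) (minSmoothness ℝ 2) M := by
    rw [minSmoothness_of_isRCLikeNormedField]
    exact IsManifold.of_le (n := ∞) ENat.LEInfty.out
  have h1 := (hX x (mem_univ x)).contMDiffAt univ_mem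
  have h2 := (hY x hx).contMDiffAt (hU.mem_nhds hx)
  exact (ContMDiffAt.mlieBracket_vectorField (m := ⊤) (n := ⊤) h1 h2
    (by simp)).contMDiffWithinAt

/-- The bracket of `X` with a section of `𝒱`, in a local frame of `𝒱`. -/
theorem bracket_mem_span {m : ℕ} {X W : ∀ x : M, TangentSpace 𝓘(ℝ, E) x}
    {𝒱 : ∀ x : M, Submodule ℝ (TangentSpace 𝓘(ℝ, E) x)}
    {e : Fin m → ∀ x : M, TangentSpace 𝓘(ℝ, E) x} {U U' : Set M} (hU : IsOpen U)
    (he : IsFrameOn 𝒱 e U) (hU' : IsOpen U') (hW : IsSectionOn 𝒱 W U') {x : M}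
    (hx : x ∈ U) (hx' : x ∈ U') :
    bracket X W x ∈ Submodule.span ℝ (range fun k => prolong X e k x) := by
  have hself := mem_extChartAt_source (I := 𝓘(ℝ, E)) x
  have hf : ∀ y ∈ U ∩ U', ∃ f : Fin m → ℝ, ∑ i, f i • e i y = W y := fun y hy => by
    have h1 := hW.2 y hy.2
    rw [← (he.2 y hy.1).2] at h1
    exact Submodule.mem_span_range_iff_exists_fun ℝ |>.1 h1
  choose! f hf using hf
  set p : E := extChartAt 𝓘(ℝ, E) x x with hp
  set g : Fin m → E → ℝ := fun i y => f ((extChartAt 𝓘(ℝ, E) x).symm y) i with hg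
  have hsymm : (extChartAt 𝓘(ℝ, E) x).symm p = x := (extChartAt 𝓘(ℝ, E) x).left_inv hself
  have heq : ∀ᶠ y in 𝓝 p, chartVec W x y = ∑ i, g i y • chartVec (e i) x y := by
    have hc : ContinuousAt (extChartAt 𝓘(ℝ, E) x).symm p :=
      continuousAt_extChartAt_symm'' (mem_extChartAt_target x)
    have hn : U ∩ U' ∈ 𝓝 ((extChartAt 𝓘(ℝ, E) x).symm p) := by
      rw [hsymm]; exact (hU.inter hU').mem_nhds ⟨hx, hx'⟩
    filter_upwards [hc hn] with y hy
    have h := congrArg (coordL (E := E) x ((extChartAt 𝓘(ℝ, E) x).symm y)) (hf _ hy)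
    refine h.symm.trans ?_
    exact (map_sum (coordL (E := E) x ((extChartAt 𝓘(ℝ, E) x).symm y))
      (fun i => (f ((extChartAt 𝓘(ℝ, E) x).symm y) i • e i ((extChartAt 𝓘(ℝ, E) x).symm y) : E))
      Finset.univ).trans (Finset.sum_congr rfl fun i _ => map_smul _ _ _)
  have hes : ∀ i, ContDiffAt ℝ ∞ (chartVec (e i) x) p := fun i =>
    contDiffAt_chartVec (he.1 i) hU hx hself
  have hWs : ContDiffAt ℝ ∞ (chartVec W x) p := contDiffAt_chartVec hW.1 hU' hx' hself
  have hli : LinearIndependent ℝ fun i => chartVec (e i) x p := by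
    have h1 : (fun i => chartVec (e i) x p) = fun i => (e i x : E) :=
      funext fun i => chartVec_self (e i) x
    rw [h1]
    exact (he.2 x hx).1
  -- The coefficients come from a pointwise choice; they are differentiable because the frame is
  -- independent and `W` is smooth.
  have hgs : ∀ i, DifferentiableAt ℝ (g i) p := fun i => by
    have h1 := contMDiffWithinAt_coeff (I := 𝓘(ℝ, E)) (n := ∞) (mem_univ p)
      (fun i => (hes i).contMDiffAt.contMDiffWithinAt) hli hWs.contMDiffAt.contMDiffWithinAt
      (h := g) (by rwa [nhdsWithin_univ]) i
    exact (h1.contMDiffAt univ_mem).contDiffAt.differentiableAt (by simp)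
  have hD : HasFDerivAt (chartVec W x) (∑ i, (g i p • fderiv ℝ (chartVec (e i) x) p +
      (fderiv ℝ (g i) p).smulRight (chartVec (e i) x p))) p := by
    refine HasFDerivAt.congr_of_eventuallyEq ?_ heq
    exact HasFDerivAt.fun_sum fun i _ => (hgs i).hasFDerivAt.smul
      ((hes i).differentiableAt (by simp)).hasFDerivAt
  have hWx : (W x : E) = ∑ i, g i p • (e i x : E) := by
    rw [← chartVec_self W x, heq.self_of_nhds]
    exact Finset.sum_congr rfl fun i _ => congrArg _ (chartVec_self (e i) x)
  have alg : ∀ (ξ : E) (ε β : Fin m → E), (∀ i, chartVec (e i) x p = ε i) →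
      (∀ i, β i = fderiv ℝ (chartVec (e i) x) p ξ - fderiv ℝ (chartVec X x) p (ε i)) →
      (∑ i, (g i p • fderiv ℝ (chartVec (e i) x) p +
        (fderiv ℝ (g i) p).smulRight (chartVec (e i) x p))) ξ -
        fderiv ℝ (chartVec X x) p (∑ i, g i p • ε i) =
      ∑ i, (g i p • β i + fderiv ℝ (g i) p ξ • ε i) := by
    intro ξ ε β h1 h2
    simp only [h1, h2, sum_apply, map_sum, map_smul, ← Finset.sum_sub_distrib]
    refine Finset.sum_congr rfl fun i _ => ?_
    simp only [add_apply, smul_apply, ContinuousLinearMap.smulRight_apply, smul_sub]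
    abel
  -- The Leibniz rule `[X, ∑ gᵢ eᵢ] = ∑ (gᵢ [X, eᵢ] + X(gᵢ) eᵢ)`.
  have key : (bracket X W x : E) = ∑ i, (g i p • (bracket X (e i) x : E) +
      (fderiv ℝ (g i) p (X x)) • (e i x : E)) := by
    refine (bracket_eq X W x).trans ?_
    rw [hD.fderiv]
    refine (congrArg (fun v : E => (∑ i, (g i p • fderiv ℝ (chartVec (e i) x) p +
      (fderiv ℝ (g i) p).smulRight (chartVec (e i) x p))) (X x : E) -
        fderiv ℝ (chartVec X x) p v) hWx).trans ?_
    have h2 : ∀ i, (bracket X (e i) x : E) = fderiv ℝ (chartVec (e i) x) p (X x) -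
        fderiv ℝ (chartVec X x) p (e i x) := fun i => bracket_eq X (e i) x
    have h3 : ∀ i, chartVec (e i) x p = (e i x : E) := fun i => chartVec_self (e i) x
    exact alg (X x) (fun i => e i x) (fun i => bracket X (e i) x) h3 h2
  have hmem : ∀ k, (prolong X e k x) ∈ Submodule.span ℝ (range fun k => prolong X e k x) :=
    fun k => Submodule.subset_span ⟨k, rfl⟩
  have hfin : (∑ i, (g i p • (bracket X (e i) x) + (fderiv ℝ (g i) p (X x)) • (e i x))) ∈
      Submodule.span ℝ (range fun k => prolong X e k x) :=
    Submodule.sum_mem _ fun i _ => Submodule.add_mem _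
      (Submodule.smul_mem _ _ (hmem (Sum.inr i))) (Submodule.smul_mem _ _ (hmem (Sum.inl i)))
  exact key ▸ hfin

theorem derived_le_span {m : ℕ} {X : ∀ x : M, TangentSpace 𝓘(ℝ, E) x}
    {𝒱 : ∀ x : M, Submodule ℝ (TangentSpace 𝓘(ℝ, E) x)}
    {e : Fin m → ∀ x : M, TangentSpace 𝓘(ℝ, E) x} {U : Set M} (hU : IsOpen U)
    (he : IsFrameOn 𝒱 e U) {x : M} (hx : x ∈ U) :
    derived X 𝒱 x ≤ Submodule.span ℝ (range fun k => prolong X e k x) := by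
  refine sup_le ?_ (Submodule.span_le.2 ?_)
  · rw [← (he.2 x hx).2]
    refine Submodule.span_mono ?_
    rintro _ ⟨i, rfl⟩
    exact ⟨Sum.inl i, rfl⟩
  · rintro v ⟨U', W, hU', hx', hW, rfl⟩
    exact bracket_mem_span hU he hU' hW hx hx'

/-- These `2m` vectors span a space containing `𝒟`, of dimension `2m`, so they must be independent.
-/
theorem linearIndependent_prolong {m : ℕ} {X : ∀ x : M, TangentSpace 𝓘(ℝ, E) x}
    {𝒱 : ∀ x : M, Submodule ℝ (TangentSpace 𝓘(ℝ, E) x)} (hreg : IsRegular X 𝒱 m)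
    {e : Fin m → ∀ x : M, TangentSpace 𝓘(ℝ, E) x} {U : Set M} (hU : IsOpen U)
    (he : IsFrameOn 𝒱 e U) {x : M} (hx : x ∈ U) :
    LinearIndependent ℝ fun k => prolong X e k x := by
  have : FiniteDimensional ℝ (TangentSpace 𝓘(ℝ, E) x) :=
    inferInstanceAs (FiniteDimensional ℝ E)
  rw [linearIndependent_iff_card_le_finrank_span]
  have h := Submodule.finrank_mono (derived_le_span (X := X) hU he hx)
  rw [hreg.finrank_derived] at h
  simpa [Set.finrank, two_mul] using h

/-- The structure equations of a frame, with smooth coefficients. -/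
theorem exists_structure_equations {m : ℕ} {X : ∀ x : M, TangentSpace 𝓘(ℝ, E) x}
    (hX : SmoothOn X univ)
    {𝒱 : ∀ x : M, Submodule ℝ (TangentSpace 𝓘(ℝ, E) x)} (hreg : IsRegular X 𝒱 m)
    {e : Fin m → ∀ x : M, TangentSpace 𝓘(ℝ, E) x} {U : Set M} (hU : IsOpen U)
    (he : IsFrameOn 𝒱 e U) :
    ∃ H₀ H₁ : M → Matrix (Fin m) (Fin m) ℝ,
      (∀ y ∈ U, ∀ j, bracket X (bracket X (e j)) y =
        ∑ i, H₀ y i j • e i y + ∑ i, H₁ y i j • bracket X (e i) y) ∧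
      (∀ i j, ContMDiffOn 𝓘(ℝ, E) 𝓘(ℝ, ℝ) ∞ (fun y => H₀ y i j) U) ∧
      ∀ i j, ContMDiffOn 𝓘(ℝ, E) 𝓘(ℝ, ℝ) ∞ (fun y => H₁ y i j) U := by
  have hbs : ∀ i, SmoothOn (bracket X (e i)) U := fun i => hX.bracket hU (he.1 i)
  have hks : ∀ k, SmoothOn (prolong X e k) U := fun k => by
    rcases k with i | i
    · exact he.1 i
    · exact hbs i
  have hmem : ∀ y ∈ U, ∀ j, ∃ h : Fin m ⊕ Fin m → ℝ,
      ∑ k, h k • prolong X e k y = bracket X (bracket X (e j)) y := fun y hy j => by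
    refine (Submodule.mem_span_range_iff_exists_fun ℝ).1 (derived_le_span hU he hy ?_)
    -- `[X, e_j]` is a smooth section of `𝒟`, hence so is in `𝒟` its bracket with `X`.
    refine hreg.invariant U _ hU ⟨hbs j, fun z hz => ?_⟩ y hy
    exact Submodule.mem_sup_right (Submodule.subset_span ⟨U, e j, hU, hz, he.isSectionOn j, rfl⟩)
  choose! h hh using hmem
  have hsm : ∀ j k, ContMDiffOn 𝓘(ℝ, E) 𝓘(ℝ, ℝ) ∞ (fun y => h y j k) U := fun j k x hx => by
    have hself := mem_extChartAt_source (I := 𝓘(ℝ, E)) x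
    refine contMDiffWithinAt_coeff hx
      (b := fun k y => coordL (E := E) x y (prolong X e k y))
      (y := fun y => coordL (E := E) x y (bracket X (bracket X (e j)) y))
      (h := fun k y => h y j k)
      (fun k => (hks k).contMDiffWithinAt_coord hx hself) ?_
      ((hX.bracket hU (hbs j)).contMDiffWithinAt_coord hx hself) ?_ k
    · rw [coordL_self]
      exact linearIndependent_prolong hreg hU he hx
    · filter_upwards [self_mem_nhdsWithin] with y hy
      refine (congrArg (coordL (E := E) x y) (hh y hy j)).symm.trans ?_
      exact (map_sum (coordL (E := E) x y) (fun k => (h y j k • prolong X e k y : E))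
        Finset.univ).trans (Finset.sum_congr rfl fun i _ => map_smul _ _ _)
  refine ⟨fun y => Matrix.of fun i j => h y j (Sum.inl i),
    fun y => Matrix.of fun i j => h y j (Sum.inr i), fun y hy j => ?_,
    fun i j => hsm j _, fun i j => hsm j _⟩
  rw [← hh y hy j, Fintype.sum_sum_type]
  rfl

end DynPair

namespace DynPair

/-! ### Curves of subspaces of a vector space -/

section MovingFrame

variable {E : Type*} [NormedAddCommGroup E] [NormedSpace ℝ E]
  {F : Type*} [NormedAddCommGroup F] [NormedSpace ℝ F]
  {V : ℝ → Submodule ℝ E} {s J : Set ℝ}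

/-- A smooth frame `P` of the curve of subspaces `V` over `s ∩ J`, given by isomorphisms of a fixed
space with the subspaces, which together with its derivative `P₁` satisfies the structure equation
`P'' = P h₀ + P' h₁`. -/
structure IsMovingFrame (V : ℝ → Submodule ℝ E) (s J : Set ℝ) (P P₁ : ℝ → F →L[ℝ] E)
    (h₀ h₁ : ℝ → F →L[ℝ] F) : Prop where
  isOpen : IsOpen J
  contDiff : ∀ t ∈ s ∩ J, ContDiffWithinAt ℝ ∞ P s t
  contDiff₁ : ∀ t ∈ s ∩ J, ContDiffWithinAt ℝ ∞ P₁ s t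
  contDiff_h₀ : ∀ t ∈ s ∩ J, ContDiffWithinAt ℝ ∞ h₀ s t
  contDiff_h₁ : ∀ t ∈ s ∩ J, ContDiffWithinAt ℝ ∞ h₁ s t
  deriv : ∀ t ∈ s ∩ J, HasDerivWithinAt P (P₁ t) s t
  deriv₁ : ∀ t ∈ s ∩ J, HasDerivWithinAt P₁ ((P t).comp (h₀ t) + (P₁ t).comp (h₁ t)) s t
  inj : ∀ t ∈ s ∩ J, ∀ a b, P t a + P₁ t b = 0 → a = 0 ∧ b = 0
  mem_iff : ∀ t ∈ s ∩ J, ∀ x, x ∈ V t ↔ ∃ a, P t a = x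

/-- The curvature operator in a moving frame. -/
noncomputable def frameCurvature (s : Set ℝ) (h₀ h₁ : ℝ → F →L[ℝ] F) (t : ℝ) : F →L[ℝ] F :=
  -h₀ t + (1 / 2 : ℝ) • derivWithin h₁ s t - (1 / 4 : ℝ) • (h₁ t).comp (h₁ t)

/-- A smooth section of `V` over `s ∩ J`. -/
def IsCurveSection (V : ℝ → Submodule ℝ E) (s J : Set ℝ) (w : ℝ → E) : Prop :=
  ∀ t ∈ s ∩ J, ContDiffWithinAt ℝ ∞ w s t ∧ w t ∈ V t

/-- The horizontal space at `t`, spanned by the derivatives of the normal sections of `V`. -/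
def curveHorizontal (V : ℝ → Submodule ℝ E) (s : Set ℝ) (t : ℝ) : Submodule ℝ E :=
  Submodule.span ℝ {v | ∃ (J : Set ℝ) (w : ℝ → E), IsOpen J ∧ t ∈ J ∧ IsCurveSection V s J w ∧
    (∀ r ∈ s ∩ J, derivWithin (derivWithin w s) s r ∈ V r) ∧ v = derivWithin w s t}

/-- There is a local section of `V` with value `x` at `t` and with derivative `z` modulo `V`. -/
def SymbolRel (V : ℝ → Submodule ℝ E) (s : Set ℝ) (t : ℝ) (z x : E) : Prop :=
  ∃ (J : Set ℝ) (w : ℝ → E), IsOpen J ∧ t ∈ J ∧ IsCurveSection V s J w ∧ w t = x ∧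
    derivWithin w s t - z ∈ V t

theorem contDiffWithinAt_derivWithin {w : ℝ → E} {t : ℝ} (hs : UniqueDiffOn ℝ s) (ht : t ∈ s)
    (hw : ContDiffWithinAt ℝ ∞ w s t) : ContDiffWithinAt ℝ ∞ (derivWithin w s) s t := by
  have h := hw.fderivWithin_right hs (m := ∞) (by simp) ht
  have h2 := h.clm_apply (contDiffWithinAt_const (c := (1 : ℝ)))
  exact h2

theorem contDiffWithinAt_hasDerivWithinAt {w : ℝ → E} {t : ℝ}
    (hw : ContDiffWithinAt ℝ ∞ w s t) : HasDerivWithinAt w (derivWithin w s t) s t :=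
  (hw.differentiableWithinAt (by simp)).hasDerivWithinAt

theorem inter_mem_nhdsWithin_of_isOpen {t : ℝ} (hJ : IsOpen J) (ht : t ∈ J) : s ∩ J ∈ 𝓝[s] t :=
  inter_mem_nhdsWithin _ (hJ.mem_nhds ht)

theorem IsCurveSection.mono {J' : Set ℝ} {w : ℝ → E} (h : IsCurveSection V s J w) (hJ : J' ⊆ J) :
    IsCurveSection V s J' w :=
  fun t ht => h t ⟨ht.1, hJ ht.2⟩

namespace IsMovingFrame

variable {P P₁ : ℝ → F →L[ℝ] E} {h₀ h₁ : ℝ → F →L[ℝ] F}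

theorem mono {J' : Set ℝ} (hf : IsMovingFrame V s J P P₁ h₀ h₁) (hJ' : IsOpen J') (h : J' ⊆ J) :
    IsMovingFrame V s J' P P₁ h₀ h₁ := by
  have hsub : s ∩ J' ⊆ s ∩ J := inter_subset_inter_right s h
  exact ⟨hJ', fun t ht => hf.contDiff t (hsub ht), fun t ht => hf.contDiff₁ t (hsub ht),
    fun t ht => hf.contDiff_h₀ t (hsub ht), fun t ht => hf.contDiff_h₁ t (hsub ht),
    fun t ht => hf.deriv t (hsub ht), fun t ht => hf.deriv₁ t (hsub ht),
    fun t ht => hf.inj t (hsub ht), fun t ht => hf.mem_iff t (hsub ht)⟩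

variable (hf : IsMovingFrame V s J P P₁ h₀ h₁)

include hf

theorem eq_of_eq {t : ℝ} (ht : t ∈ s ∩ J) {a b a' b' : F}
    (h : P t a + P₁ t b = P t a' + P₁ t b') : a = a' ∧ b = b' := by
  have := hf.inj t ht (a - a') (b - b') (by
    rw [map_sub, map_sub, ← sub_eq_zero.2 h]; abel)
  exact ⟨sub_eq_zero.1 this.1, sub_eq_zero.1 this.2⟩

theorem apply_mem {t : ℝ} (ht : t ∈ s ∩ J) (a : F) : P t a ∈ V t :=
  (hf.mem_iff t ht _).2 ⟨a, rfl⟩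

/-- An element of the sum of `V` and `V'` lies in `V` iff its component along `P₁` vanishes. -/
theorem apply_add_mem_iff {t : ℝ} (ht : t ∈ s ∩ J) (a b : F) :
    P t a + P₁ t b ∈ V t ↔ b = 0 := by
  constructor
  · intro h
    obtain ⟨a', ha'⟩ := (hf.mem_iff t ht _).1 h
    exact (hf.eq_of_eq ht (a := a) (b := b) (a' := a') (b' := 0) (by rw [← ha']; simp)).2
  · rintro rfl
    simpa using hf.apply_mem ht a

theorem hasDerivWithinAt_apply {t : ℝ} (ht : t ∈ s ∩ J) {a : ℝ → F} {a' : F}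
    (ha : HasDerivWithinAt a a' s t) :
    HasDerivWithinAt (fun τ => P τ (a τ)) (P t a' + P₁ t (a t)) s t := by
  rw [add_comm]; exact (hf.deriv t ht).clm_apply ha

theorem hasDerivWithinAt_apply₁ {t : ℝ} (ht : t ∈ s ∩ J) {b : ℝ → F} {b' : F}
    (hb : HasDerivWithinAt b b' s t) :
    HasDerivWithinAt (fun τ => P₁ τ (b τ)) (P t (h₀ t (b t)) + P₁ t (h₁ t (b t) + b')) s t := by
  refine ((hf.deriv₁ t ht).clm_apply hb).congr_deriv ?_
  simp only [add_apply, ContinuousLinearMap.comp_apply, map_add]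
  abel

theorem hasDerivWithinAt_pair {t : ℝ} (ht : t ∈ s ∩ J) {a b : ℝ → F} {a' b' : F}
    (ha : HasDerivWithinAt a a' s t) (hb : HasDerivWithinAt b b' s t) :
    HasDerivWithinAt (fun τ => P τ (a τ) + P₁ τ (b τ))
      (P t (a' + h₀ t (b t)) + P₁ t (a t + h₁ t (b t) + b')) s t := by
  refine ((hf.hasDerivWithinAt_apply ht ha).add (hf.hasDerivWithinAt_apply₁ ht hb)).congr_deriv ?_
  simp only [map_add]
  abel

theorem isCurveSection_apply {a : ℝ → F} (ha : ∀ t ∈ s ∩ J, ContDiffWithinAt ℝ ∞ a s t) :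
    IsCurveSection V s J fun t => P t (a t) :=
  fun t ht => ⟨(hf.contDiff t ht).clm_apply (ha t ht), hf.apply_mem ht _⟩

theorem hasDerivWithinAt_of_eq {t : ℝ} (ht : t ∈ s ∩ J) {y : ℝ → E} {a : ℝ → F}
    (h : ∀ τ ∈ s ∩ J, y τ = P τ (a τ)) (ha : ContDiffWithinAt ℝ ∞ a s t) :
    HasDerivWithinAt y (P t (derivWithin a s t) + P₁ t (a t)) s t := by
  refine (hf.hasDerivWithinAt_apply ht (contDiffWithinAt_hasDerivWithinAt ha)).congr_of_eventuallyEq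
    ?_ (h t ht)
  filter_upwards [inter_mem_nhdsWithin_of_isOpen hf.isOpen ht.2] with τ hτ using h τ hτ

variable [FiniteDimensional ℝ E] [FiniteDimensional ℝ F]

theorem contDiffWithinAt_coeff_pair {t : ℝ} (ht : t ∈ s ∩ J) {y : ℝ → E} {a b : ℝ → F}
    (hy : ContDiffWithinAt ℝ ∞ y s t) (h : ∀ τ ∈ s ∩ J, y τ = P τ (a τ) + P₁ τ (b τ)) :
    ContDiffWithinAt ℝ ∞ a s t ∧ ContDiffWithinAt ℝ ∞ b s t := by
  have hB : ContDiffWithinAt ℝ ∞ (fun τ => (P τ).coprod (P₁ τ)) s t := by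
    have e : (fun τ => (P τ).coprod (P₁ τ)) = fun τ =>
        (P τ).comp (ContinuousLinearMap.fst ℝ F F) + (P₁ τ).comp (ContinuousLinearMap.snd ℝ F F) := by
      ext τ x <;> simp
    rw [e]
    exact ((hf.contDiff t ht).clm_comp contDiffWithinAt_const).add
      ((hf.contDiff₁ t ht).clm_comp contDiffWithinAt_const)
  have h1 := contMDiffWithinAt_of_clm_apply (I := 𝓘(ℝ, ℝ)) (a := fun τ => (a τ, b τ)) ht.1
    hB.contMDiffWithinAt (fun x x' hxx' => by
      have := hf.eq_of_eq ht (a := x.1) (b := x.2) (a' := x'.1) (b' := x'.2) (by simpa using hxx')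
      exact Prod.ext this.1 this.2) hy.contMDiffWithinAt
    (by
      filter_upwards [inter_mem_nhdsWithin_of_isOpen hf.isOpen ht.2] with τ hτ
      simpa using h τ hτ)
  have h2 := h1.contDiffWithinAt
  exact ⟨contDiff_fst.contDiffAt.comp_contDiffWithinAt t h2,
    contDiff_snd.contDiffAt.comp_contDiffWithinAt t h2⟩

/-- The coefficients of a section in a moving frame. -/
theorem exists_coeff {y : ℝ → E} (hy : IsCurveSection V s J y) :
    ∃ a : ℝ → F, ∀ t ∈ s ∩ J, y t = P t (a t) ∧ ContDiffWithinAt ℝ ∞ a s t := by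
  have h := fun t (ht : t ∈ s ∩ J) => (hf.mem_iff t ht _).1 (hy t ht).2
  choose! a ha using h
  refine ⟨a, fun t ht => ⟨(ha t ht).symm, ?_⟩⟩
  exact (hf.contDiffWithinAt_coeff_pair ht (hy t ht).1 (b := 0)
    (fun τ hτ => by simp [ha τ hτ])).1

/-- The derivative of a section at `t` is tangent to `V` iff the section vanishes at `t`. -/
theorem derivWithin_mem_iff (hs : UniqueDiffOn ℝ s) {t : ℝ} (ht : t ∈ s ∩ J) {y : ℝ → E}
    (hy : IsCurveSection V s J y) : derivWithin y s t ∈ V t ↔ y t = 0 := by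
  obtain ⟨a, ha⟩ := hf.exists_coeff hy
  rw [(hf.hasDerivWithinAt_of_eq ht (fun τ hτ => (ha τ hτ).1) (ha t ht).2).derivWithin
    (hs t ht.1), hf.apply_add_mem_iff ht, (ha t ht).1]
  constructor
  · intro h; simp [h]
  · intro h; exact (hf.inj t ht (a t) 0 (by simpa using h)).1

/-- The difference of two such sections has derivative in `V t`, so it vanishes at `t`:
differentiation modulo `V` is an injective tensorial map. -/
theorem symbolRel_unique (hs : UniqueDiffOn ℝ s) {t : ℝ} (ht : t ∈ s ∩ J) {z x x' : E}
    (h : SymbolRel V s t z x) (h' : SymbolRel V s t z x') : x = x' := by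
  obtain ⟨J₁, w, hJ₁, ht₁, hw, rfl, hz⟩ := h
  obtain ⟨J₂, w', hJ₂, ht₂, hw', rfl, hz'⟩ := h'
  set J' := J ∩ (J₁ ∩ J₂) with hJ'
  have hf' := hf.mono (hf.isOpen.inter (hJ₁.inter hJ₂)) (inter_subset_left : J' ⊆ J)
  have ht' : t ∈ s ∩ J' := ⟨ht.1, ht.2, ht₁, ht₂⟩
  have hsec : IsCurveSection V s J' fun τ => w τ - w' τ := fun τ hτ =>
    ⟨(hw τ ⟨hτ.1, hτ.2.2.1⟩).1.sub (hw' τ ⟨hτ.1, hτ.2.2.2⟩).1,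
      Submodule.sub_mem _ (hw τ ⟨hτ.1, hτ.2.2.1⟩).2 (hw' τ ⟨hτ.1, hτ.2.2.2⟩).2⟩
  refine sub_eq_zero.1 ((hf'.derivWithin_mem_iff hs ht' hsec).1 ?_)
  have hd := (contDiffWithinAt_hasDerivWithinAt (hw t ⟨ht.1, ht₁⟩).1).sub
    (contDiffWithinAt_hasDerivWithinAt (hw' t ⟨ht.1, ht₂⟩).1)
  have hd' := hd.derivWithin (hs t ht.1)
  have e : derivWithin (fun τ => w τ - w' τ) s t = derivWithin w s t - derivWithin w' s t := hd'
  rw [e]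
  have := Submodule.sub_mem _ hz hz'
  rwa [sub_sub_sub_cancel_right] at this

/-- For a section `P a` the derivative is `P a' + P₁ a`: modulo `V` only the value `a t` matters,
and it is the `P₁`-coefficient of `z`. This makes the frame-free relation computable in any moving
frame; in particular `z` has a symbol only if it lies in `V + V'`. -/
theorem symbolRel_iff (hs : UniqueDiffOn ℝ s) {t : ℝ} (ht : t ∈ s ∩ J) {z x : E} :
    SymbolRel V s t z x ↔ ∃ a b, z = P t a + P₁ t b ∧ x = P t b := by
  -- The section with constant coefficient `b` realises the symbol.
  have hmk : ∀ a b, SymbolRel V s t (P t a + P₁ t b) (P t b) := fun a b => by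
    have hc : ContDiffWithinAt ℝ ∞ (fun _ : ℝ => b) s t := contDiffWithinAt_const
    refine ⟨J, fun τ => P τ b, hf.isOpen, ht.2,
      hf.isCurveSection_apply fun _ _ => contDiffWithinAt_const, rfl, ?_⟩
    rw [(hf.hasDerivWithinAt_of_eq ht (fun τ _ => rfl) hc).derivWithin (hs t ht.1)]
    have : P t (derivWithin (fun _ : ℝ => b) s t) + P₁ t b - (P t a + P₁ t b) =
        P t (derivWithin (fun _ : ℝ => b) s t - a) := by rw [map_sub]; abel
    rw [this]
    exact hf.apply_mem ht _
  constructor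
  · intro h
    obtain ⟨J₁, w, hJ₁, ht₁, hw, hx, hz⟩ := id h
    have hf' := hf.mono (hf.isOpen.inter hJ₁) (inter_subset_left : J ∩ J₁ ⊆ J)
    have ht' : t ∈ s ∩ (J ∩ J₁) := ⟨ht.1, ht.2, ht₁⟩
    obtain ⟨a, ha⟩ := hf'.exists_coeff (hw.mono inter_subset_right)
    rw [(hf'.hasDerivWithinAt_of_eq ht' (fun τ hτ => (ha τ hτ).1) (ha t ht').2).derivWithin
      (hs t ht.1)] at hz
    obtain ⟨c, hc⟩ := (hf.mem_iff t ht _).1 hz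
    have hz' : z = P t (derivWithin a s t - c) + P₁ t (a t) := by
      rw [map_sub, hc]; abel
    refine ⟨_, _, hz', ?_⟩
    rw [← hx, (ha t ht').1]
  · rintro ⟨a, b, rfl, rfl⟩
    exact hmk a b

end IsMovingFrame

end MovingFrame

end DynPair

namespace DynPair

/-! ### Horizontal spaces and Jacobi fields of a curve of subspaces -/

section CurveJacobi

/-- The same short interval serves all initial times in it, on both sides; this allows linear
equations to be solved from any nearby starting point. -/
theorem exists_local_linear_solution {F : Type*} [NormedAddCommGroup F] [NormedSpace ℝ F]
    [CompleteSpace F] {A : ℝ → F →L[ℝ] F} {α β t : ℝ} (hαβ : α < β) (ht : t ∈ Icc α β)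
    {N : Set ℝ} (hN : N ∈ 𝓝[Icc α β] t) (hA : ∀ τ ∈ N, ContDiffWithinAt ℝ ∞ A (Icc α β) τ) :
    ∃ a b, Icc a b ⊆ Icc α β ∧ Icc a b ⊆ N ∧ t ∈ Icc a b ∧ Icc a b ∈ 𝓝[Icc α β] t ∧
      ∀ t₁ ∈ Icc a b, ∀ x₀ : F, ∃ x : ℝ → F, x t₁ = x₀ ∧ ContDiffOn ℝ ∞ x (Icc a b) ∧
        ∀ τ ∈ Icc a b, HasDerivWithinAt x (A τ (x τ)) (Icc a b) τ := by
  have htN : t ∈ N := mem_of_mem_nhdsWithin ht hN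
  have hbd : ∀ᶠ τ in 𝓝[Icc α β] t, ‖A τ‖ < ‖A t‖ + 1 :=
    (hA t htN).continuousWithinAt.norm.eventually_lt_const (by linarith)
  set K : NNReal := ‖A t‖₊ + 1 with hK
  have hKpos : (0 : ℝ) < K := by rw [hK]; push_cast; positivity
  obtain ⟨a, b, hab, hlen, hsub, hsubN, ht', hmem⟩ := exists_Icc_mem_nhdsWithin hαβ ht
    (inter_mem hN hbd) (δ := 1 / (2 * K)) (by positivity)
  have hAs : ContDiffOn ℝ ∞ A (Icc a b) := fun τ hτ => (hA τ (hsubN hτ).1).mono hsub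
  refine ⟨a, b, hsub, fun τ hτ => (hsubN hτ).1, ht', hmem, fun t₁ ht₁ x₀ => ?_⟩
  obtain ⟨x, hx₀, hx⟩ := exists_linear_solution (K := K) hAs.continuousOn
    (fun τ hτ => (le_of_lt (hsubN hτ).2).trans (by rw [hK]; push_cast; rfl))
    (by
      calc 2 * (K : ℝ) * (b - a) ≤ 2 * K * (1 / (2 * K)) := by gcongr
        _ = 1 := by field_simp) ht₁ x₀
  refine ⟨x, hx₀, ?_, hx⟩
  refine ODE.contDiffOn_enat_Icc_of_hasDerivWithinAt (n := ⊤) (f := fun τ z => A τ z)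
    (u := univ) ?_ hx (mapsTo_univ _ _)
  exact ContDiffOn.clm_apply (hAs.comp contDiffOn_fst fun x hx => hx.1) contDiffOn_snd

variable {E : Type*} [NormedAddCommGroup E] [NormedSpace ℝ E] [FiniteDimensional ℝ E]
  {F : Type*} [NormedAddCommGroup F] [NormedSpace ℝ F] [FiniteDimensional ℝ F]
  {V : ℝ → Submodule ℝ E} {α β : ℝ} {J : Set ℝ}
  {P P₁ : ℝ → F →L[ℝ] E} {h₀ h₁ : ℝ → F →L[ℝ] F}

/-- The horizontal space in a moving frame. -/
theorem IsMovingFrame.mem_curveHorizontal_iff (hαβ : α < β)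
    (hf : IsMovingFrame V (Icc α β) J P P₁ h₀ h₁) {t : ℝ} (ht : t ∈ Icc α β ∩ J) (v : E) :
    v ∈ curveHorizontal V (Icc α β) t ↔ ∃ b, v = P₁ t b - (1 / 2 : ℝ) • P t (h₁ t b) := by
  have : CompleteSpace F := FiniteDimensional.complete ℝ F
  have hs : UniqueDiffOn ℝ (Icc α β) := uniqueDiffOn_Icc hαβ
  set L : F →L[ℝ] E := P₁ t - (1 / 2 : ℝ) • (P t).comp (h₁ t) with hL
  have hLa : ∀ b, L b = P₁ t b - (1 / 2 : ℝ) • P t (h₁ t b) := fun b => rfl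
  -- the second derivative of a section
  have hsnd : ∀ {J' : Set ℝ}, IsOpen J' → J' ⊆ J → ∀ {w : ℝ → E} {a : ℝ → F},
      (∀ τ ∈ Icc α β ∩ J', w τ = P τ (a τ) ∧ ContDiffWithinAt ℝ ∞ a (Icc α β) τ) →
      ∀ τ ∈ Icc α β ∩ J', derivWithin (derivWithin w (Icc α β)) (Icc α β) τ =
        P τ (derivWithin (derivWithin a (Icc α β)) (Icc α β) τ + h₀ τ (a τ)) +
        P₁ τ (derivWithin a (Icc α β) τ + h₁ τ (a τ) + derivWithin a (Icc α β) τ) := by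
    intro J' hJ' hJJ w a ha τ hτ
    have hf' := hf.mono hJ' hJJ
    have hw : ∀ σ ∈ Icc α β ∩ J', derivWithin w (Icc α β) σ =
        P σ (derivWithin a (Icc α β) σ) + P₁ σ (a σ) := fun σ hσ =>
      (hf'.hasDerivWithinAt_of_eq hσ (fun ρ hρ => (ha ρ hρ).1) (ha σ hσ).2).derivWithin (hs σ hσ.1)
    have h := hf'.hasDerivWithinAt_pair hτ (contDiffWithinAt_hasDerivWithinAt
      (contDiffWithinAt_derivWithin hs hτ.1 (ha τ hτ).2))
      (contDiffWithinAt_hasDerivWithinAt (ha τ hτ).2)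
    refine (h.congr_of_eventuallyEq ?_ (hw τ hτ)).derivWithin (hs τ hτ.1)
    filter_upwards [inter_mem_nhdsWithin_of_isOpen hJ' hτ.2] with σ hσ using hw σ hσ
  constructor
  · intro hv
    suffices h : curveHorizontal V (Icc α β) t ≤ LinearMap.range (L : F →ₗ[ℝ] E) by
      obtain ⟨b, hb⟩ := h hv
      exact ⟨b, by rw [← hLa, ← hb]; rfl⟩
    refine Submodule.span_le.2 ?_
    rintro _ ⟨J₁, w, hJ₁, ht₁, hw, hnorm, rfl⟩
    have hJ' := hf.isOpen.inter hJ₁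
    have hf' := hf.mono hJ' (inter_subset_left : J ∩ J₁ ⊆ J)
    have ht' : t ∈ Icc α β ∩ (J ∩ J₁) := ⟨ht.1, ht.2, ht₁⟩
    obtain ⟨a, ha⟩ := hf'.exists_coeff (hw.mono inter_subset_right)
    have h1 := hnorm t ⟨ht.1, ht₁⟩
    rw [hsnd hJ' inter_subset_left ha t ht', hf.apply_add_mem_iff ht] at h1
    refine ⟨a t, ?_⟩
    rw [(hf'.hasDerivWithinAt_of_eq ht' (fun τ hτ => (ha τ hτ).1) (ha t ht').2).derivWithin
      (hs t ht.1)]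
    -- Normality kills the `P₁`-component `2a' + h₁ a` of the second derivative, so a normal section
    -- has `a' = -½ h₁ a`.
    have h2 : derivWithin a (Icc α β) t = -((1 / 2 : ℝ) • h₁ t (a t)) := by
      have h3 : (2 : ℝ) • derivWithin a (Icc α β) t = -h₁ t (a t) := by
        rw [two_smul, eq_neg_iff_add_eq_zero, ← h1]; abel
      have h4 := congrArg (fun x => (1 / 2 : ℝ) • x) h3
      simpa [smul_smul] using h4
    rw [h2]
    change L (a t) = _
    rw [hLa, map_neg, map_smul]; abel
  · rintro ⟨b, rfl⟩
    -- Conversely every `b` is the value at `t` of a solution of `a' = -½ h₁ a`, which defines a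
    -- normal section near `t`.
    obtain ⟨a', b', hsub, hsubN, ht', hmem, hsol⟩ := exists_local_linear_solution
      (A := fun τ => -((1 / 2 : ℝ) • h₁ τ)) hαβ ht.1 (inter_mem_nhdsWithin_of_isOpen hf.isOpen ht.2)
      (fun τ hτ => ((hf.contDiff_h₁ τ hτ).const_smul _).neg)
    obtain ⟨x, hx₀, hxs, hx⟩ := hsol t ht' b
    obtain ⟨O, hO, htO, hOsub⟩ := mem_nhdsWithin.1 hmem
    have hJ' := hf.isOpen.inter hO
    have hmem' : ∀ τ ∈ Icc α β ∩ (J ∩ O), τ ∈ Icc a' b' ∧ Icc a' b' ∈ 𝓝[Icc α β] τ := fun τ hτ =>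
      ⟨hOsub ⟨hτ.2.2, hτ.1⟩, mem_nhdsWithin.2 ⟨O, hO, hτ.2.2, hOsub⟩⟩
    have hxs' : ∀ τ ∈ Icc α β ∩ (J ∩ O), ContDiffWithinAt ℝ ∞ x (Icc α β) τ := fun τ hτ =>
      (hxs τ (hmem' τ hτ).1).mono_of_mem_nhdsWithin (hmem' τ hτ).2
    have hxd : ∀ τ ∈ Icc α β ∩ (J ∩ O),
        derivWithin x (Icc α β) τ = -((1 / 2 : ℝ) • h₁ τ (x τ)) := fun τ hτ =>
      ((hx τ (hmem' τ hτ).1).mono_of_mem_nhdsWithin (hmem' τ hτ).2).derivWithin (hs τ hτ.1)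
    have hf' := hf.mono hJ' (inter_subset_left : J ∩ O ⊆ J)
    have htJ : t ∈ Icc α β ∩ (J ∩ O) := ⟨ht.1, ht.2, htO⟩
    refine Submodule.subset_span ⟨J ∩ O, fun τ => P τ (x τ), hJ', htJ.2,
      hf'.isCurveSection_apply hxs', fun τ hτ => ?_, ?_⟩
    · rw [hsnd hJ' inter_subset_left (fun σ hσ => ⟨rfl, hxs' σ hσ⟩) τ hτ,
        hf'.apply_add_mem_iff hτ, hxd τ hτ]
      module
    · rw [(hf'.hasDerivWithinAt_of_eq htJ (fun τ _ => rfl) (hxs' t htJ)).derivWithin (hs t ht.1),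
        hxd t htJ, hx₀, map_neg, map_smul]
      abel

/-- The vertical part of the derivative of a section, in a moving frame. -/
theorem IsMovingFrame.sub_mem_curveHorizontal_iff (hαβ : α < β)
    (hf : IsMovingFrame V (Icc α β) J P P₁ h₀ h₁) {t : ℝ} (ht : t ∈ Icc α β ∩ J) {y : ℝ → E}
    {a : ℝ → F} (ha : ∀ τ ∈ Icc α β ∩ J, y τ = P τ (a τ) ∧ ContDiffWithinAt ℝ ∞ a (Icc α β) τ)
    {d : E} (hd : d ∈ V t) :
    derivWithin y (Icc α β) t - d ∈ curveHorizontal V (Icc α β) t ↔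
      d = P t (derivWithin a (Icc α β) t + (1 / 2 : ℝ) • h₁ t (a t)) := by
  obtain ⟨c, rfl⟩ := (hf.mem_iff t ht _).1 hd
  rw [hf.mem_curveHorizontal_iff hαβ ht, (hf.hasDerivWithinAt_of_eq ht (fun τ hτ => (ha τ hτ).1)
    (ha t ht).2).derivWithin (uniqueDiffOn_Icc hαβ t ht.1)]
  constructor
  · rintro ⟨b, hb⟩
    have h := hf.eq_of_eq ht (a := derivWithin a (Icc α β) t - c) (b := a t)
      (a' := -((1 / 2 : ℝ) • h₁ t b)) (b' := b) (by
        rw [map_sub, map_neg, map_smul, neg_add_eq_sub, ← hb]; abel)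
    obtain ⟨h1, rfl⟩ := h
    congr 1
    rw [sub_eq_iff_eq_add] at h1
    rw [h1]; abel
  · intro h
    rw [h]
    refine ⟨a t, ?_⟩
    rw [map_add, map_smul]; abel

/-- Jacobi fields of a curve of subspaces with a curvature relation `K`. -/
def IsCurveJacobi (V : ℝ → Submodule ℝ E) (s : Set ℝ) (K : ℝ → E → E → Prop) (v : ℝ → E) : Prop :=
  IsCurveSection V s univ v ∧ ∃ d dd k : ℝ → E,
    (IsCurveSection V s univ d ∧ ∀ t ∈ s, derivWithin v s t - d t ∈ curveHorizontal V s t) ∧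
    (IsCurveSection V s univ dd ∧ ∀ t ∈ s, derivWithin d s t - dd t ∈ curveHorizontal V s t) ∧
    (∀ t ∈ s, K t (v t) (k t)) ∧ ∀ t ∈ s, dd t + k t = 0

/-- A vector lies in `V t` exactly if its class modulo `V t` is zero. This turns the vanishing of a
Jacobi field into membership in `V t`. -/
theorem IsMovingFrame.mem_iff_of_symbolRel (hαβ : α < β)
    (hf : IsMovingFrame V (Icc α β) J P P₁ h₀ h₁) {t : ℝ} (ht : t ∈ Icc α β ∩ J) {z x : E}
    (h : SymbolRel V (Icc α β) t z x) : z ∈ V t ↔ x = 0 := by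
  obtain ⟨a, b, rfl, rfl⟩ := (hf.symbolRel_iff (uniqueDiffOn_Icc hαβ) ht).1 h
  rw [hf.apply_add_mem_iff ht]
  constructor
  · rintro rfl; simp
  · intro h; exact (hf.inj t ht b 0 (by simpa using h)).1

/-- A Jacobi field determines an element `z` whose symbol it is. -/
theorem IsCurveJacobi.exists_symbolRel (hαβ : α < β) {K : ℝ → E → E → Prop}
    (hK : ∀ t ∈ Icc α β, ∀ v k, K t v k → ∃ (J : Set ℝ) (P P₁ : ℝ → F →L[ℝ] E)
      (h₀ h₁ : ℝ → F →L[ℝ] F), t ∈ J ∧ IsMovingFrame V (Icc α β) J P P₁ h₀ h₁ ∧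
      ∃ a, v = P t a ∧ k = P t (frameCurvature (Icc α β) h₀ h₁ t a))
    {v : ℝ → E} (hv : IsCurveJacobi V (Icc α β) K v) :
    ∃ z, ∀ t ∈ Icc α β, SymbolRel V (Icc α β) t z (v t) := by
  obtain ⟨hvs, d, dd, k, ⟨hds, hvd⟩, ⟨hdds, hddd⟩, hk, hsum⟩ := hv
  set s := Icc α β with hs_def
  have hs : UniqueDiffOn ℝ s := uniqueDiffOn_Icc hαβ
  -- If `v = P q` is the symbol of `P p + P₁ q`, then `D_X v = P (-p - ½ h₁ q)` and `v' = P (-p - h₁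
  -- q) + P₁ q`; so the vector is recovered as `v' - 2 D_X v`.
  set Z : ℝ → E := fun t => derivWithin v s t - (2 : ℝ) • d t with hZ
  have hZd : ∀ t ∈ s, HasDerivWithinAt Z 0 s t := by
    intro t ht
    obtain ⟨J, P, P₁, h₀, h₁, htJ, hf, a₀, hva, hka⟩ := hK t ht _ _ (hk t ht)
    have htJ' : t ∈ s ∩ J := ⟨ht, htJ⟩
    obtain ⟨a, ha⟩ := hf.exists_coeff (hvs.mono (subset_univ J))
    obtain ⟨b, hb⟩ := hf.exists_coeff (hds.mono (subset_univ J))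
    have haa : a t = a₀ := by
      refine (hf.eq_of_eq htJ' (b := 0) (b' := 0) ?_).1
      simp only [map_zero, add_zero]
      rw [← (ha t htJ').1, hva]
    set a' := derivWithin a s with ha'
    have had : ∀ τ ∈ s ∩ J, HasDerivWithinAt a (a' τ) s τ := fun τ hτ =>
      contDiffWithinAt_hasDerivWithinAt (ha τ hτ).2
    have ha'd : HasDerivWithinAt a' (derivWithin a' s t) s t :=
      contDiffWithinAt_hasDerivWithinAt (contDiffWithinAt_derivWithin hs ht (ha t htJ').2)
    have hbd : HasDerivWithinAt b (derivWithin b s t) s t :=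
      contDiffWithinAt_hasDerivWithinAt (hb t htJ').2
    have hh₁ : HasDerivWithinAt h₁ (derivWithin h₁ s t) s t :=
      contDiffWithinAt_hasDerivWithinAt (hf.contDiff_h₁ t htJ')
    have hba : ∀ τ ∈ s ∩ J, b τ = a' τ + (1 / 2 : ℝ) • h₁ τ (a τ) := fun τ hτ => by
      have h1 := (hf.sub_mem_curveHorizontal_iff hαβ hτ ha (hds τ ⟨hτ.1, trivial⟩).2).1 (hvd τ hτ.1)
      rw [(hb τ hτ).1] at h1
      exact (hf.eq_of_eq hτ (b := 0) (b' := 0) (by simpa using h1)).1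
    have hb' : derivWithin b s t = derivWithin a' s t +
        (1 / 2 : ℝ) • (derivWithin h₁ s t (a t) + h₁ t (a' t)) := by
      have h1 := ha'd.add ((hh₁.clm_apply (had t htJ')).const_smul (1 / 2 : ℝ))
      refine (h1.congr_of_eventuallyEq ?_ (hba t htJ')).derivWithin (hs t ht)
      filter_upwards [inter_mem_nhdsWithin_of_isOpen hf.isOpen htJ] with τ hτ using hba τ hτ
    have hjac : derivWithin b s t + (1 / 2 : ℝ) • h₁ t (b t) + frameCurvature s h₀ h₁ t (a t) = 0 := by
      have h1 := (hf.sub_mem_curveHorizontal_iff hαβ htJ' hb (hdds t ⟨ht, trivial⟩).2).1 (hddd t ht)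
      have h2 := hsum t ht
      rw [h1, hka, ← map_add, haa.symm] at h2
      exact (hf.inj t htJ' _ 0 (by simpa using h2)).1
    have hZeq : ∀ τ ∈ s ∩ J, Z τ = P τ (a' τ - (2 : ℝ) • b τ) + P₁ τ (a τ) := fun τ hτ => by
      rw [hZ]
      simp only
      rw [(hf.hasDerivWithinAt_of_eq hτ (fun σ hσ => (ha σ hσ).1) (ha τ hτ).2).derivWithin
        (hs τ hτ.1), (hb τ hτ).1, map_sub, map_smul]
      abel
    have hder := hf.hasDerivWithinAt_pair htJ' (ha'd.sub (hbd.const_smul (2 : ℝ))) (had t htJ')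
    have hder' := hder.congr_of_eventuallyEq (f₁ := Z) (by
      filter_upwards [inter_mem_nhdsWithin_of_isOpen hf.isOpen htJ] with τ hτ using hZeq τ hτ)
      (hZeq t htJ')
    refine hder'.congr_deriv ?_
    -- The `P₁`-component of `Z'` vanishes by the formula for `D_X v`, and the `P`-component below
    -- by the Jacobi equation.
    have e1 : a' t - (2 : ℝ) • b t + h₁ t (a t) + a' t = 0 := by
      rw [hba t htJ']; module
    have e2 : derivWithin a' s t - (2 : ℝ) • derivWithin b s t + h₀ t (a t) = 0 := by
      have h3 := hjac
      simp only [frameCurvature, add_apply, sub_apply, neg_apply, smul_apply,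
        ContinuousLinearMap.comp_apply] at h3
      rw [hba t htJ', map_add, map_smul] at h3
      have h4 : derivWithin a' s t = derivWithin b s t -
          (1 / 2 : ℝ) • (derivWithin h₁ s t (a t) + h₁ t (a' t)) := by rw [hb']; abel
      rw [h4]
      have h5 : derivWithin b s t = -((1 / 2 : ℝ) • (h₁ t (a' t) + (1 / 2 : ℝ) • h₁ t (h₁ t (a t))) +
          (-h₀ t (a t) + (1 / 2 : ℝ) • derivWithin h₁ s t (a t) -
            (1 / 4 : ℝ) • h₁ t (h₁ t (a t)))) := by
        rw [eq_neg_iff_add_eq_zero, ← h3]; abel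
      rw [h5]
      module
    change P t (derivWithin a' s t - (2 : ℝ) • derivWithin b s t + h₀ t (a t)) +
      P₁ t (a' t - (2 : ℝ) • b t + h₁ t (a t) + a' t) = 0
    rw [e1, e2, map_zero, map_zero, add_zero]
  have hconst : ∀ t ∈ s, Z t = Z α := fun t ht =>
    constant_of_has_deriv_right_zero (fun τ hτ => (hZd τ hτ).continuousWithinAt)
      (fun τ hτ => hasDerivWithinAt_Ici_of_Icc hτ (hZd τ (Ico_subset_Icc_self hτ))) t ht
  refine ⟨Z α, fun t ht => ⟨univ, v, isOpen_univ, trivial, hvs, rfl, ?_⟩⟩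
  rw [← hconst t ht, hZ]
  simp only [sub_sub_cancel]
  exact Submodule.smul_mem _ _ (hds t ⟨ht, trivial⟩).2

/-- The sum of `V` and its derivative is constant. -/
theorem exists_symbolRel_of_left (hαβ : α < β)
    (hfr : ∀ t ∈ Icc α β, ∃ (J : Set ℝ) (P P₁ : ℝ → F →L[ℝ] E) (h₀ h₁ : ℝ → F →L[ℝ] F),
      t ∈ J ∧ IsMovingFrame V (Icc α β) J P P₁ h₀ h₁) {z : E}
    (hz : ∃ x, SymbolRel V (Icc α β) α z x) {t : ℝ} (ht : t ∈ Icc α β) :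
    ∃ x, SymbolRel V (Icc α β) t z x := by
  have : CompleteSpace F := FiniteDimensional.complete ℝ F
  have hs : UniqueDiffOn ℝ (Icc α β) := uniqueDiffOn_Icc hαβ
  refine rel_of_local_of_trans (P := fun s₁ s₂ => (∃ x, SymbolRel V (Icc α β) s₁ z x) →
    ∃ x, SymbolRel V (Icc α β) s₂ z x) ht.1 ?_ (fun _ _ _ _ _ _ _ _ h h' hx => h' (h hx)) hz
  intro σ hσ
  replace hσ : σ ∈ Icc α β := ⟨hσ.1, hσ.2.trans ht.2⟩
  obtain ⟨J, P, P₁, h₀, h₁, hσJ, hf⟩ := hfr σ hσ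
  -- The system `p' = -h₀ q`, `q' = -p - h₁ q`, which expresses that `P p + P₁ q` is constant.
  -- Solving it from the coefficients of `z` at `s₁` shows that `z` remains in the span of `P` and
  -- `P₁`.
  set A : ℝ → (F × F) →L[ℝ] (F × F) := fun τ =>
    (ContinuousLinearMap.inl ℝ F F).comp ((-h₀ τ).comp (ContinuousLinearMap.snd ℝ F F)) +
    (ContinuousLinearMap.inr ℝ F F).comp (-ContinuousLinearMap.fst ℝ F F -
      (h₁ τ).comp (ContinuousLinearMap.snd ℝ F F)) with hA
  have hAa : ∀ τ x, A τ x = (-h₀ τ x.2, -x.1 - h₁ τ x.2) := fun τ x => by simp [hA]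
  obtain ⟨a, b, hsub, hsubN, -, hmem, hsol⟩ := exists_local_linear_solution (A := A) hαβ hσ
    (inter_mem_nhdsWithin_of_isOpen hf.isOpen hσJ) (fun τ hτ => by
      have c0 := hf.contDiff_h₀ τ hτ
      have c1 := hf.contDiff_h₁ τ hτ
      exact (contDiffWithinAt_const.clm_comp (c0.neg.clm_comp contDiffWithinAt_const)).add
        (contDiffWithinAt_const.clm_comp
          (contDiffWithinAt_const.sub (c1.clm_comp contDiffWithinAt_const))))
  obtain ⟨ε, hε, hεN⟩ := Metric.mem_nhdsWithin_iff.1 hmem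
  refine ⟨ε, hε, fun s₁ hs₁ s₂ hs₂ _ hd₁ hd₂ ⟨x, hx⟩ => ?_⟩
  have m₁ : s₁ ∈ Icc a b := hεN ⟨by rwa [Metric.mem_ball, Real.dist_eq], hs₁.1, hs₁.2.trans ht.2⟩
  have m₂ : s₂ ∈ Icc a b := hεN ⟨by rwa [Metric.mem_ball, Real.dist_eq], hs₂.1, hs₂.2.trans ht.2⟩
  obtain ⟨p₀, q₀, hz₀, -⟩ := (hf.symbolRel_iff hs (hsubN m₁)).1 hx
  obtain ⟨y, hy₀, -, hy⟩ := hsol s₁ m₁ (p₀, q₀)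
  have hZd : ∀ τ ∈ Icc a b, HasDerivWithinAt (fun τ => P τ (y τ).1 + P₁ τ (y τ).2) 0 (Icc a b) τ := by
    intro τ hτ
    have hfst := (ContinuousLinearMap.fst ℝ F F).hasFDerivAt.comp_hasDerivWithinAt τ (hy τ hτ)
    have hsnd := (ContinuousLinearMap.snd ℝ F F).hasFDerivAt.comp_hasDerivWithinAt τ (hy τ hτ)
    simp only [hAa, Function.comp_def, ContinuousLinearMap.coe_fst', ContinuousLinearMap.coe_snd']
      at hfst hsnd
    have d1 := (((hf.deriv τ (hsubN hτ)).mono hsub).clm_apply hfst)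
    have d2 := (((hf.deriv₁ τ (hsubN hτ)).mono hsub).clm_apply hsnd)
    refine (d1.add d2).congr_deriv ?_
    simp only [add_apply, ContinuousLinearMap.comp_apply, map_sub, map_neg]
    abel
  have hconst : (fun τ => P τ (y τ).1 + P₁ τ (y τ).2) s₂ =
      (fun τ => P τ (y τ).1 + P₁ τ (y τ).2) s₁ := by
    have key : ∀ r ∈ Icc a b, (fun τ => P τ (y τ).1 + P₁ τ (y τ).2) r =
        (fun τ => P τ (y τ).1 + P₁ τ (y τ).2) a :=
      constant_of_has_deriv_right_zero (fun τ hτ => (hZd τ hτ).continuousWithinAt)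
        (fun τ hτ => hasDerivWithinAt_Ici_of_Icc hτ (hZd τ (Ico_subset_Icc_self hτ)))
    rw [key s₂ m₂, key s₁ m₁]
  refine ⟨P s₂ (y s₂).2, (hf.symbolRel_iff hs (hsubN m₂)).2 ⟨(y s₂).1, (y s₂).2, ?_, rfl⟩⟩
  simp only [hy₀] at hconst
  rw [hz₀, hconst]

/-- Every element of the sum of `V` and its derivative is the symbol of a Jacobi field. -/
theorem exists_isCurveJacobi (hαβ : α < β) {K : ℝ → E → E → Prop}
    (hK : ∀ t ∈ Icc α β, ∃ (J : Set ℝ) (P P₁ : ℝ → F →L[ℝ] E) (h₀ h₁ : ℝ → F →L[ℝ] F),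
      t ∈ J ∧ IsMovingFrame V (Icc α β) J P P₁ h₀ h₁ ∧
      ∀ a, K t (P t a) (P t (frameCurvature (Icc α β) h₀ h₁ t a)))
    {z : E} {v : ℝ → E} (hv : ∀ t ∈ Icc α β, SymbolRel V (Icc α β) t z (v t)) :
    IsCurveJacobi V (Icc α β) K v := by
  set s := Icc α β with hs_def
  have hs : UniqueDiffOn ℝ s := uniqueDiffOn_Icc hαβ
  -- The covariant derivative, found by solving `z = v' - 2 D_X v`.
  set d : ℝ → E := fun t => (1 / 2 : ℝ) • (derivWithin v s t - z) with hd
  -- the local form of `v` and `d`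
  have hloc : ∀ {J : Set ℝ} {P P₁ : ℝ → F →L[ℝ] E} {h₀ h₁ : ℝ → F →L[ℝ] F},
      IsMovingFrame V s J P P₁ h₀ h₁ → ∃ p q : ℝ → F, ∀ t ∈ s ∩ J,
      (v t = P t (q t) ∧ ContDiffWithinAt ℝ ∞ q s t) ∧ ContDiffWithinAt ℝ ∞ p s t ∧
      z = P t (p t) + P₁ t (q t) ∧
      HasDerivWithinAt p (-h₀ t (q t)) s t ∧ HasDerivWithinAt q (-p t - h₁ t (q t)) s t := by
    intro J P P₁ h₀ h₁ hf
    have h1 := fun t (ht : t ∈ s ∩ J) => (hf.symbolRel_iff hs ht).1 (hv t ht.1)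
    choose! p q hzpq hvq using h1
    have hsm := fun t (ht : t ∈ s ∩ J) => hf.contDiffWithinAt_coeff_pair ht
      (contDiffWithinAt_const (c := z)) hzpq
    refine ⟨p, q, fun t ht => ⟨⟨hvq t ht, (hsm t ht).2⟩, (hsm t ht).1, hzpq t ht, ?_⟩⟩
    have hp := contDiffWithinAt_hasDerivWithinAt (hsm t ht).1
    have hq := contDiffWithinAt_hasDerivWithinAt (hsm t ht).2
    have hz' := (hf.hasDerivWithinAt_pair ht hp hq).congr_of_eventuallyEq (f₁ := fun _ => z) (by
      filter_upwards [inter_mem_nhdsWithin_of_isOpen hf.isOpen ht.2] with τ hτ using hzpq τ hτ)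
      (hzpq t ht)
    -- Differentiating the constant `z = P p + P₁ q` and comparing components gives the system for
    -- `p` and `q`.
    have h0 := (hs t ht.1).eq_deriv _ hz' (hasDerivWithinAt_const t s z)
    obtain ⟨e1, e2⟩ := hf.inj t ht _ _ h0
    refine ⟨hp.congr_deriv (eq_neg_of_add_eq_zero_left e1), hq.congr_deriv ?_⟩
    rw [add_comm] at e2
    rw [eq_neg_of_add_eq_zero_left e2]; abel
  have hdloc : ∀ {J : Set ℝ} {P P₁ : ℝ → F →L[ℝ] E} {h₀ h₁ : ℝ → F →L[ℝ] F},
      IsMovingFrame V s J P P₁ h₀ h₁ → ∃ p q : ℝ → F, (∀ t ∈ s ∩ J,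
      (v t = P t (q t) ∧ ContDiffWithinAt ℝ ∞ q s t) ∧
      HasDerivWithinAt p (-h₀ t (q t)) s t ∧ HasDerivWithinAt q (-p t - h₁ t (q t)) s t) ∧
      ∀ t ∈ s ∩ J, d t = P t (-p t - (1 / 2 : ℝ) • h₁ t (q t)) ∧
        ContDiffWithinAt ℝ ∞ (fun τ => -p τ - (1 / 2 : ℝ) • h₁ τ (q τ)) s t := by
    intro J P P₁ h₀ h₁ hf
    obtain ⟨p, q, hpq⟩ := hloc hf
    refine ⟨p, q, fun t ht => ⟨(hpq t ht).1, (hpq t ht).2.2.2⟩, fun t ht => ⟨?_, ?_⟩⟩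
    · obtain ⟨⟨-, hq⟩, -, hz, -, hq'⟩ := hpq t ht
      rw [hd]
      simp only
      rw [(hf.hasDerivWithinAt_of_eq ht (fun τ hτ => (hpq τ hτ).1.1) hq).derivWithin (hs t ht.1),
        hq'.derivWithin (hs t ht.1), hz]
      simp only [map_sub, map_neg, map_smul]
      module
    · exact (hpq t ht).2.1.neg.sub
        (((hf.contDiff_h₁ t ht).clm_apply (hpq t ht).1.2).const_smul (1 / 2 : ℝ))
  have hvs : IsCurveSection V s univ v := fun t ht => by
    obtain ⟨J, P, P₁, h₀, h₁, htJ, hf, -⟩ := hK t ht.1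
    obtain ⟨p, q, hpq⟩ := hloc hf
    have := hf.isCurveSection_apply (a := q) (fun τ hτ => (hpq τ hτ).1.2) t ⟨ht.1, htJ⟩
    refine ⟨this.1.congr_of_eventuallyEq ?_ (hpq t ⟨ht.1, htJ⟩).1.1, ?_⟩
    · filter_upwards [inter_mem_nhdsWithin_of_isOpen hf.isOpen htJ] with τ hτ using (hpq τ hτ).1.1
    · rw [(hpq t ⟨ht.1, htJ⟩).1.1]; exact this.2
  have hds : IsCurveSection V s univ d := fun t ht => by
    obtain ⟨J, P, P₁, h₀, h₁, htJ, hf, -⟩ := hK t ht.1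
    obtain ⟨p, q, -, hb⟩ := hdloc hf
    have := hf.isCurveSection_apply (fun τ hτ => (hb τ hτ).2) t ⟨ht.1, htJ⟩
    refine ⟨this.1.congr_of_eventuallyEq ?_ (hb t ⟨ht.1, htJ⟩).1, ?_⟩
    · filter_upwards [inter_mem_nhdsWithin_of_isOpen hf.isOpen htJ] with τ hτ using (hb τ hτ).1
    · rw [(hb t ⟨ht.1, htJ⟩).1]; exact this.2
  have hdd : ∀ t ∈ s, ∃ x, x ∈ V t ∧ derivWithin d s t - x ∈ curveHorizontal V s t ∧
      K t (v t) (-x) := by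
    intro t ht
    obtain ⟨J, P, P₁, h₀, h₁, htJ, hf, hKa⟩ := hK t ht
    have htJ' : t ∈ s ∩ J := ⟨ht, htJ⟩
    obtain ⟨p, q, hpq, hb⟩ := hdloc hf
    set b : ℝ → F := fun τ => -p τ - (1 / 2 : ℝ) • h₁ τ (q τ) with hb_def
    -- `x` is `D_X d` at `t`; the computation below identifies `-x` with the curvature applied to `v
    -- t`, so the Jacobi equation holds.
    set x : E := P t (derivWithin b s t + (1 / 2 : ℝ) • h₁ t (b t)) with hx
    have hxV : x ∈ V t := hf.apply_mem htJ' _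
    refine ⟨x, hxV, (hf.sub_mem_curveHorizontal_iff hαβ htJ' hb hxV).2 rfl, ?_⟩
    obtain ⟨⟨hvq, -⟩, hp', hq'⟩ := hpq t htJ'
    have hh₁ : HasDerivWithinAt h₁ (derivWithin h₁ s t) s t :=
      contDiffWithinAt_hasDerivWithinAt (hf.contDiff_h₁ t htJ')
    have hb' : derivWithin b s t = h₀ t (q t) - (1 / 2 : ℝ) •
        (derivWithin h₁ s t (q t) + h₁ t (-p t - h₁ t (q t))) := by
      have h1 := hp'.neg.sub ((hh₁.clm_apply hq').const_smul (1 / 2 : ℝ))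
      rw [neg_neg] at h1
      exact h1.derivWithin (hs t ht)
    have hkey : -x = P t (frameCurvature s h₀ h₁ t (q t)) := by
      rw [hx, ← map_neg]
      congr 1
      rw [hb', hb_def]
      simp only [frameCurvature, add_apply, sub_apply, neg_apply, smul_apply,
        ContinuousLinearMap.comp_apply, map_sub, map_neg, map_smul]
      module
    rw [hkey, hvq]
    exact hKa (q t)
  choose! dd hddV hddH hddK using hdd
  refine ⟨hvs, d, dd, fun t => -dd t, ⟨hds, fun t ht => ?_⟩, ⟨fun t ht => ⟨?_, hddV t ht.1⟩, hddH⟩,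
    hddK, fun t _ => add_neg_cancel _⟩
  · obtain ⟨J, P, P₁, h₀, h₁, htJ, hf, -⟩ := hK t ht
    have htJ' : t ∈ s ∩ J := ⟨ht, htJ⟩
    obtain ⟨p, q, hpq, hb⟩ := hdloc hf
    refine (hf.sub_mem_curveHorizontal_iff hαβ htJ' (fun τ hτ => (hpq τ hτ).1)
      (hds t ⟨ht, trivial⟩).2).2 ?_
    rw [(hb t htJ').1, (hpq t htJ').2.2.derivWithin (hs t ht)]
    congr 1
    module
  · obtain ⟨J, P, P₁, h₀, h₁, htJ, hf, -⟩ := hK t ht.1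
    have htJ' : t ∈ s ∩ J := ⟨ht.1, htJ⟩
    obtain ⟨p, q, hpq, hb⟩ := hdloc hf
    set b : ℝ → F := fun τ => -p τ - (1 / 2 : ℝ) • h₁ τ (q τ) with hb_def
    -- The pointwise choice of `dd` is forced by the splitting into vertical and horizontal parts,
    -- hence smooth.
    have hloc' : ∀ τ ∈ s ∩ J, dd τ = P τ (derivWithin b s τ + (1 / 2 : ℝ) • h₁ τ (b τ)) :=
      fun τ hτ => (hf.sub_mem_curveHorizontal_iff hαβ hτ hb (hddV τ hτ.1)).1 (hddH τ hτ.1)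
    have hsm : ContDiffWithinAt ℝ ∞
        (fun τ => P τ (derivWithin b s τ + (1 / 2 : ℝ) • h₁ τ (b τ))) s t :=
      (hf.contDiff t htJ').clm_apply ((contDiffWithinAt_derivWithin hs ht.1 (hb t htJ').2).add
        (((hf.contDiff_h₁ t htJ').clm_apply (hb t htJ').2).const_smul (1 / 2 : ℝ)))
    refine hsm.congr_of_eventuallyEq ?_ (hloc' t htJ')
    filter_upwards [inter_mem_nhdsWithin_of_isOpen hf.isOpen htJ] with τ hτ using hloc' τ hτ

/-- An element is determined by its symbol along the curve. -/
theorem eq_zero_of_symbolRel_zero (hαβ : α < β)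
    (hfr : ∀ t ∈ Icc α β, ∃ (J : Set ℝ) (P P₁ : ℝ → F →L[ℝ] E) (h₀ h₁ : ℝ → F →L[ℝ] F),
      t ∈ J ∧ IsMovingFrame V (Icc α β) J P P₁ h₀ h₁) {z : E}
    (h : ∀ t ∈ Icc α β, SymbolRel V (Icc α β) t z 0) : z = 0 := by
  have hα : α ∈ Icc α β := ⟨le_rfl, hαβ.le⟩
  -- So the constant function `z` is a section of `V`, with derivative zero; a section whose
  -- derivative lies in `V` vanishes.
  have hzV : ∀ t ∈ Icc α β, z ∈ V t := fun t ht => by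
    obtain ⟨J, P, P₁, h₀, h₁, htJ, hf⟩ := hfr t ht
    exact (hf.mem_iff_of_symbolRel hαβ ⟨ht, htJ⟩ (h t ht)).2 rfl
  obtain ⟨J, P, P₁, h₀, h₁, htJ, hf⟩ := hfr α hα
  refine (hf.derivWithin_mem_iff (uniqueDiffOn_Icc hαβ) ⟨hα, htJ⟩ (y := fun _ => z)
    fun t ht => ⟨contDiffWithinAt_const, hzV t ht.1⟩).1 ?_
  simp

end CurveJacobi

end DynPair

namespace DynPair

/-! ### Moving frames given by vectors -/

section Vectors

variable {E : Type*} [NormedAddCommGroup E] [NormedSpace ℝ E] {m : ℕ} {s : Set ℝ} {t : ℝ}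

theorem contDiffWithinAt_combination {ι : Type*} [Fintype ι] {b : ι → ℝ → E}
    (hb : ∀ i, ContDiffWithinAt ℝ ∞ (b i) s t) :
    ContDiffWithinAt ℝ ∞ (fun τ => combination fun i => b i τ) s t :=
  (contMDiffWithinAt_combination fun i => (hb i).contMDiffWithinAt).contDiffWithinAt

theorem hasDerivWithinAt_combination {ι : Type*} [Fintype ι] {b : ι → ℝ → E} {b' : ι → E}
    (hb : ∀ i, HasDerivWithinAt (b i) (b' i) s t) :
    HasDerivWithinAt (fun τ => combination fun i => b i τ) (combination b') s t := by
  unfold combination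
  refine HasDerivWithinAt.fun_sum fun i _ => ?_
  exact (((ContinuousLinearMap.smulRightL ℝ (ι → ℝ) E)
    (ContinuousLinearMap.proj i)).hasFDerivAt.comp_hasDerivWithinAt t (hb i))

theorem combination_matrix_apply (A : Matrix (Fin m) (Fin m) ℝ) (a : Fin m → ℝ) :
    combination (fun j i => A i j) a = A.mulVec a := by
  rw [combination_apply]
  ext i
  simp [Matrix.mulVec, dotProduct, mul_comm]

/-- Structure equations written for the vectors of a frame become operator equations. The matrices
act on coefficient vectors by `mulVec`, so the `j`-th column of `H₀` and `H₁` is the image of the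
`j`-th basis vector. -/
theorem isMovingFrame_of_vectors {V : ℝ → Submodule ℝ E} {J : Set ℝ} (hJ : IsOpen J)
    {e f : Fin m → ℝ → E} {H₀ H₁ : ℝ → Matrix (Fin m) (Fin m) ℝ}
    (he : ∀ t ∈ s ∩ J, ∀ i, ContDiffWithinAt ℝ ∞ (e i) s t)
    (hf : ∀ t ∈ s ∩ J, ∀ i, ContDiffWithinAt ℝ ∞ (f i) s t)
    (hH₀ : ∀ t ∈ s ∩ J, ∀ i j, ContDiffWithinAt ℝ ∞ (fun τ => H₀ τ i j) s t)
    (hH₁ : ∀ t ∈ s ∩ J, ∀ i j, ContDiffWithinAt ℝ ∞ (fun τ => H₁ τ i j) s t)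
    (hde : ∀ t ∈ s ∩ J, ∀ i, HasDerivWithinAt (e i) (f i t) s t)
    (hdf : ∀ t ∈ s ∩ J, ∀ j, HasDerivWithinAt (f j)
      (∑ i, H₀ t i j • e i t + ∑ i, H₁ t i j • f i t) s t)
    (hli : ∀ t ∈ s ∩ J, LinearIndependent ℝ (Sum.elim (fun i => e i t) fun i => f i t))
    (hV : ∀ t ∈ s ∩ J, V t = Submodule.span ℝ (range fun i => e i t)) :
    IsMovingFrame V s J (fun τ => combination fun i => e i τ) (fun τ => combination fun i => f i τ)
      (fun τ => combination fun j i => H₀ τ i j) (fun τ => combination fun j i => H₁ τ i j) where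
  isOpen := hJ
  contDiff t ht := contDiffWithinAt_combination (he t ht)
  contDiff₁ t ht := contDiffWithinAt_combination (hf t ht)
  contDiff_h₀ t ht := contDiffWithinAt_combination fun j => contDiffWithinAt_pi.2 fun i =>
    hH₀ t ht i j
  contDiff_h₁ t ht := contDiffWithinAt_combination fun j => contDiffWithinAt_pi.2 fun i =>
    hH₁ t ht i j
  deriv t ht := hasDerivWithinAt_combination (hde t ht)
  deriv₁ t ht := by
    convert hasDerivWithinAt_combination (hdf t ht) using 1
    refine ContinuousLinearMap.ext fun a => ?_
    simp only [add_apply, ContinuousLinearMap.comp_apply]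
    simp only [combination_apply, Finset.sum_apply, Pi.smul_apply, smul_eq_mul, Finset.sum_smul,
      smul_add, Finset.smul_sum, Finset.sum_add_distrib, mul_smul]
    rw [Finset.sum_comm]
    congr 1
    rw [Finset.sum_comm]
  inj t ht a b hab := by
    rw [combination_apply, combination_apply] at hab
    have := Fintype.linearIndependent_iff.1 (hli t ht) (Sum.elim a b) (by
      rw [Fintype.sum_sum_type]; simpa using hab)
    exact ⟨funext fun i => this (Sum.inl i), funext fun i => this (Sum.inr i)⟩
  mem_iff t ht x := by
    rw [hV t ht, Submodule.mem_span_range_iff_exists_fun]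
    simp only [combination_apply]

theorem frameCurvature_combination {H₀ H₁ : ℝ → Matrix (Fin m) (Fin m) ℝ}
    {H₁' : Matrix (Fin m) (Fin m) ℝ} (hs : UniqueDiffWithinAt ℝ s t)
    (hH₁ : ∀ i j, HasDerivWithinAt (fun τ => H₁ τ i j) (H₁' i j) s t) (a : Fin m → ℝ) :
    frameCurvature s (fun τ => combination fun j i => H₀ τ i j)
      (fun τ => combination fun j i => H₁ τ i j) t a =
    (-H₀ t + (1 / 2 : ℝ) • H₁' - (1 / 4 : ℝ) • (H₁ t * H₁ t)).mulVec a := by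
  have hd : HasDerivWithinAt (fun τ => combination fun j i => H₁ τ i j)
      (combination fun j i => H₁' i j) s t :=
    hasDerivWithinAt_combination fun j => hasDerivWithinAt_pi.2 fun i => hH₁ i j
  rw [frameCurvature, hd.derivWithin hs]
  simp only [sub_apply, add_apply, neg_apply, smul_apply, ContinuousLinearMap.comp_apply,
    combination_matrix_apply, Matrix.sub_mulVec, Matrix.add_mulVec, Matrix.neg_mulVec,
    Matrix.smul_mulVec, Matrix.mulVec_mulVec]

end Vectors

/-! ### Linearity of the symbol -/

section SymbolRel

variable {E : Type*} [NormedAddCommGroup E] [NormedSpace ℝ E] {V : ℝ → Submodule ℝ E} {s : Set ℝ}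
  {t : ℝ}

theorem SymbolRel.add (hs : UniqueDiffOn ℝ s) (ht : t ∈ s) {z x z' x' : E}
    (h : SymbolRel V s t z x) (h' : SymbolRel V s t z' x') :
    SymbolRel V s t (z + z') (x + x') := by
  obtain ⟨J, w, hJ, htJ, hw, rfl, hwz⟩ := h
  obtain ⟨J', w', hJ', htJ', hw', rfl, hwz'⟩ := h'
  refine ⟨J ∩ J', fun τ => w τ + w' τ, hJ.inter hJ', ⟨htJ, htJ'⟩, fun τ hτ =>
    ⟨(hw τ ⟨hτ.1, hτ.2.1⟩).1.add (hw' τ ⟨hτ.1, hτ.2.2⟩).1,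
      add_mem (hw τ ⟨hτ.1, hτ.2.1⟩).2 (hw' τ ⟨hτ.1, hτ.2.2⟩).2⟩, rfl, ?_⟩
  rw [((contDiffWithinAt_hasDerivWithinAt (hw t ⟨ht, htJ⟩).1).fun_add
    (contDiffWithinAt_hasDerivWithinAt (hw' t ⟨ht, htJ'⟩).1)).derivWithin (hs t ht),
    add_sub_add_comm]
  exact add_mem hwz hwz'

theorem SymbolRel.smul (hs : UniqueDiffOn ℝ s) (ht : t ∈ s) {z x : E} (k : ℝ)
    (h : SymbolRel V s t z x) : SymbolRel V s t (k • z) (k • x) := by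
  obtain ⟨J, w, hJ, htJ, hw, rfl, hwz⟩ := h
  refine ⟨J, fun τ => k • w τ, hJ, htJ, fun τ hτ => ⟨(hw τ hτ).1.const_smul k,
    Submodule.smul_mem _ k (hw τ hτ).2⟩, rfl, ?_⟩
  rw [((contDiffWithinAt_hasDerivWithinAt (hw t ⟨ht, htJ⟩).1).fun_const_smul k).derivWithin
    (hs t ht), ← smul_sub]
  exact Submodule.smul_mem _ k hwz

theorem symbolRel_zero_right {z : E} (hz : z ∈ V t) : SymbolRel V s t z 0 := by
  refine ⟨univ, fun _ => 0, isOpen_univ, trivial, fun τ _ => ⟨contDiffWithinAt_const,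
    zero_mem _⟩, rfl, ?_⟩
  simpa using hz

end SymbolRel

/-! ### The Jacobi fields of a curve of subspaces that vanish at two times -/

section JacobiSpace

variable {E : Type*} [NormedAddCommGroup E] [NormedSpace ℝ E] [FiniteDimensional ℝ E]
  {F : Type*} [NormedAddCommGroup F] [NormedSpace ℝ F] [FiniteDimensional ℝ F]
  {V : ℝ → Submodule ℝ E} {α β : ℝ}

/-- The Jacobi fields vanishing at `α` and `t` correspond linearly to `V α ⊓ V t`. -/
theorem exists_jacobi_linearMap (hαβ : α < β) {K : ℝ → E → E → Prop}
    (hK : ∀ t ∈ Icc α β, ∀ v k, K t v k → ∃ (J : Set ℝ) (P P₁ : ℝ → F →L[ℝ] E)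
      (h₀ h₁ : ℝ → F →L[ℝ] F), t ∈ J ∧ IsMovingFrame V (Icc α β) J P P₁ h₀ h₁ ∧
      ∃ a, v = P t a ∧ k = P t (frameCurvature (Icc α β) h₀ h₁ t a))
    (hK' : ∀ t ∈ Icc α β, ∃ (J : Set ℝ) (P P₁ : ℝ → F →L[ℝ] E) (h₀ h₁ : ℝ → F →L[ℝ] F),
      t ∈ J ∧ IsMovingFrame V (Icc α β) J P P₁ h₀ h₁ ∧
      ∀ a, K t (P t a) (P t (frameCurvature (Icc α β) h₀ h₁ t a)))
    {t : ℝ} (ht : t ∈ Icc α β) :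
    ∃ L : ↥(V α ⊓ V t) →ₗ[ℝ] ℝ → E, Function.Injective L ∧
      ∀ v, v ∈ LinearMap.range L ↔ IsCurveJacobi V (Icc α β) K v ∧ (∀ r ∉ Icc α β, v r = 0) ∧
        v α = 0 ∧ v t = 0 := by
  classical
  have hs : UniqueDiffOn ℝ (Icc α β) := uniqueDiffOn_Icc hαβ
  have hα : α ∈ Icc α β := ⟨le_rfl, hαβ.le⟩
  have hfr : ∀ t ∈ Icc α β, ∃ (J : Set ℝ) (P P₁ : ℝ → F →L[ℝ] E) (h₀ h₁ : ℝ → F →L[ℝ] F),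
      t ∈ J ∧ IsMovingFrame V (Icc α β) J P P₁ h₀ h₁ := fun r hr => by
    obtain ⟨J, P, P₁, h₀, h₁, hrJ, hf, -⟩ := hK' r hr
    exact ⟨J, P, P₁, h₀, h₁, hrJ, hf⟩
  have huniq : ∀ r ∈ Icc α β, ∀ z x x', SymbolRel V (Icc α β) r z x →
      SymbolRel V (Icc α β) r z x' → x = x' := fun r hr z x x' h h' => by
    obtain ⟨J, P, P₁, h₀, h₁, hrJ, hf⟩ := hfr r hr
    exact hf.symbolRel_unique hs ⟨hr, hrJ⟩ h h'
  have hmem : ∀ r ∈ Icc α β, ∀ z x, SymbolRel V (Icc α β) r z x → (z ∈ V r ↔ x = 0) :=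
    fun r hr z x h => by
      obtain ⟨J, P, P₁, h₀, h₁, hrJ, hf⟩ := hfr r hr
      exact hf.mem_iff_of_symbolRel hαβ ⟨hr, hrJ⟩ h
  have hex : ∀ z : ↥(V α ⊓ V t), ∃ v : ℝ → E, (∀ r ∉ Icc α β, v r = 0) ∧
      ∀ r ∈ Icc α β, SymbolRel V (Icc α β) r z (v r) := fun z => by
    have h : ∀ r, ∃ x, (r ∉ Icc α β → x = 0) ∧
        (r ∈ Icc α β → SymbolRel V (Icc α β) r z x) := fun r => by
      by_cases hr : r ∈ Icc α β
      -- At `α` the vector `z ∈ V α` has symbol zero, so it has a symbol at every time.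
      · obtain ⟨x, hx⟩ := exists_symbolRel_of_left hαβ hfr ⟨0, symbolRel_zero_right z.2.1⟩ hr
        exact ⟨x, fun h => absurd hr h, fun _ => hx⟩
      · exact ⟨0, fun _ => rfl, fun h => absurd h hr⟩
    choose v hv using h
    exact ⟨v, fun r => (hv r).1, fun r => (hv r).2⟩
  choose L hL0 hL using hex
  refine ⟨⟨⟨L, fun z z' => funext fun r => ?_⟩, fun k z => funext fun r => ?_⟩, ?_, fun v => ?_⟩
  · by_cases hr : r ∈ Icc α β
    -- The symbols were chosen time by time; linearity follows from their uniqueness.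
    · exact huniq r hr _ _ _ (hL (z + z') r hr) ((hL z r hr).add hs hr (hL z' r hr))
    · simp [hL0 _ r hr]
  · by_cases hr : r ∈ Icc α β
    · exact huniq r hr _ _ _ (hL (k • z) r hr) ((hL z r hr).smul hs hr k)
    · simp [hL0 _ r hr]
  · refine (injective_iff_map_eq_zero _).2 fun z hz => ?_
    have hz' : ∀ r, L z r = 0 := fun r => congrFun hz r
    refine Subtype.ext (eq_zero_of_symbolRel_zero hαβ hfr fun r hr => ?_)
    have := hL z r hr
    rwa [hz'] at this
  · constructor
    · rintro ⟨z, rfl⟩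
      exact ⟨exists_isCurveJacobi hαβ hK' (hL z), hL0 z,
        (hmem α hα _ _ (hL z α hα)).1 z.2.1, (hmem t ht _ _ (hL z t ht)).1 z.2.2⟩
    · rintro ⟨hv, hv0, hvα, hvt⟩
      -- Every Jacobi field is the symbol of some `z`, and its two zeros say that `z` lies in `V α`
      -- and in `V t`.
      obtain ⟨z, hz⟩ := hv.exists_symbolRel hαβ hK
      refine ⟨⟨z, (hmem α hα _ _ (hz α hα)).2 hvα, (hmem t ht _ _ (hz t ht)).2 hvt⟩,
        funext fun r => ?_⟩
      by_cases hr : r ∈ Icc α β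
      · exact huniq r hr _ _ _ (hL _ r hr) (hz r hr)
      · exact (hL0 _ r hr).trans (hv0 r hr).symm

end JacobiSpace

end DynPair

namespace DynPair

/-! ### Fields along an integral curve in an invariant frame -/

section Along

variable {E : Type*} [NormedAddCommGroup E] [NormedSpace ℝ E]
  {M : Type*} [TopologicalSpace M] [ChartedSpace E M] [IsManifold 𝓘(ℝ, E) ∞ M]
  {X : ∀ x : M, TangentSpace 𝓘(ℝ, E) x} {c : ℝ → M} {a b t : ℝ} {Φ : ℝ → E ≃L[ℝ] E}
  {𝒱 : ∀ x : M, Submodule ℝ (TangentSpace 𝓘(ℝ, E) x)}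

/-- Along an integral curve the chain rule turns `(dY) X` into the derivative of `Y ∘ c`, so the two
brackets agree. -/
theorem bracketAlong_field (hab : a < b)
    (hc : IsMIntegralCurveOn c X (Icc a b))
    {Y : ∀ x : M, TangentSpace 𝓘(ℝ, E) x} {U : Set M} (hU : IsOpen U) (hY : SmoothOn Y U)
    (ht : t ∈ Icc a b) (htU : c t ∈ U) :
    bracketAlong X c (Icc a b) (fun τ => Y (c τ)) t = bracket X Y (c t) := by
  have hself := mem_extChartAt_source (I := 𝓘(ℝ, E)) (c t)
  have hd := ((contDiffAt_chartVec hY hU htU hself).differentiableAt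
    (by simp)).hasFDerivAt.comp_hasDerivWithinAt t (hasDerivWithinAt_chart hc ht hself)
  have hev : (fun τ => coordL (E := E) (c t) (c τ) (Y (c τ))) =ᶠ[𝓝[Icc a b] t]
      fun τ => chartVec Y (c t) (extChartAt 𝓘(ℝ, E) (c t) (c τ)) := by
    filter_upwards [hc.continuousWithinAt ht (extChartAt_source_mem_nhds (I := 𝓘(ℝ, E)) (c t))]
      with τ hτ
    exact (chartVec_extChartAt Y hτ).symm
  have h1 := (hd.congr_of_eventuallyEq_of_mem hev ht).derivWithin (uniqueDiffOn_Icc hab t ht)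
  refine (bracketAlong_eq X c (Icc a b) (fun τ => Y (c τ)) t).trans
    (Eq.trans ?_ (bracket_eq X Y (c t)).symm)
  refine congrArg (fun v : E => v - fderiv ℝ (chartVec X (c t))
    (extChartAt 𝓘(ℝ, E) (c t) (c t)) (Y (c t) : E)) (h1.trans ?_)
  exact congrArg (fderiv ℝ (chartVec Y (c t)) (extChartAt 𝓘(ℝ, E) (c t) (c t)))
    (chartVec_self X (c t))

/-- The distribution `𝒱` along `c`, in the frame `Φ`. -/
def alongFrame (𝒱 : ∀ x : M, Submodule ℝ (TangentSpace 𝓘(ℝ, E) x)) (c : ℝ → M)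
    (Φ : ℝ → E ≃L[ℝ] E) (τ : ℝ) : Submodule ℝ E where
  carrier := {v | (Φ τ v : TangentSpace 𝓘(ℝ, E) (c τ)) ∈ 𝒱 (c τ)}
  add_mem' {v w} hv hw := by
    have h := add_mem (S := Submodule ℝ (TangentSpace 𝓘(ℝ, E) (c τ))) hv hw
    have e : Φ τ (v + w) = Φ τ v + Φ τ w := map_add _ _ _
    exact (congrArg (fun u : TangentSpace 𝓘(ℝ, E) (c τ) => u ∈ 𝒱 (c τ)) e).mpr h
  zero_mem' := by
    have e : Φ τ 0 = 0 := map_zero _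
    exact (congrArg (fun u : TangentSpace 𝓘(ℝ, E) (c τ) => u ∈ 𝒱 (c τ)) e).mpr (zero_mem _)
  smul_mem' k v hv := by
    have h := Submodule.smul_mem (𝒱 (c τ)) k hv
    have e : Φ τ (k • v) = k • Φ τ v := map_smul _ _ _
    exact (congrArg (fun u : TangentSpace 𝓘(ℝ, E) (c τ) => u ∈ 𝒱 (c τ)) e).mpr h

theorem symm_mem_alongFrame {τ : ℝ} {w : TangentSpace 𝓘(ℝ, E) (c τ)} :
    (Φ τ).symm w ∈ alongFrame 𝒱 c Φ τ ↔ w ∈ 𝒱 (c τ) := by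
  have e : Φ τ ((Φ τ).symm w) = w := (Φ τ).apply_symm_apply w
  exact iff_of_eq (congrArg (fun u : TangentSpace 𝓘(ℝ, E) (c τ) => u ∈ 𝒱 (c τ)) e)

/-- The curvature operator along `c`, in the frame `Φ`. -/
def alongCurvature (m : ℕ) (X : ∀ x : M, TangentSpace 𝓘(ℝ, E) x)
    (𝒱 : ∀ x : M, Submodule ℝ (TangentSpace 𝓘(ℝ, E) x)) (c : ℝ → M) (Φ : ℝ → E ≃L[ℝ] E)
    (τ : ℝ) (v k : E) : Prop :=
  HasCurvature m X 𝒱 (c τ) (Φ τ v) (Φ τ k)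

theorem alongCurvature_symm {m : ℕ} {τ : ℝ} {v k : TangentSpace 𝓘(ℝ, E) (c τ)} :
    alongCurvature m X 𝒱 c Φ τ ((Φ τ).symm v) ((Φ τ).symm k) ↔
      HasCurvature m X 𝒱 (c τ) v k := by
  have e : ∀ w : E, Φ τ ((Φ τ).symm w) = w := (Φ τ).apply_symm_apply
  exact iff_of_eq (congrArg₂ (fun v k : TangentSpace 𝓘(ℝ, E) (c τ) =>
    HasCurvature m X 𝒱 (c τ) v k) (e v) (e k))

variable [FiniteDimensional ℝ E]

theorem contDiffWithinAt_field (hX : SmoothOn X univ) (hab : a < b)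
    (hc : IsMIntegralCurveOn c X (Icc a b)) (hΦ : IsInvariantFrame X c (Icc a b) Φ)
    {Y : ∀ x : M, TangentSpace 𝓘(ℝ, E) x} {U : Set M} (hU : IsOpen U) (hY : SmoothOn Y U)
    (ht : t ∈ Icc a b) (htU : c t ∈ U) :
    ContDiffWithinAt ℝ ∞ (fun τ => (Φ τ).symm (Y (c τ))) (Icc a b) t :=
  (hΦ.contMDiffWithinAt_iff hX hab Subset.rfl ht hc fun τ => Y (c τ)).1
    (((hY _ htU).contMDiffAt (hU.mem_nhds htU)).comp_contMDiffWithinAt t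
      (contMDiffOn_integralCurve hX hab hc t ht))

theorem hasDerivWithinAt_field (hX : SmoothOn X univ) (hab : a < b)
    (hc : IsMIntegralCurveOn c X (Icc a b)) (hΦ : IsInvariantFrame X c (Icc a b) Φ)
    {Y : ∀ x : M, TangentSpace 𝓘(ℝ, E) x} {U : Set M} (hU : IsOpen U) (hY : SmoothOn Y U)
    (ht : t ∈ Icc a b) (htU : c t ∈ U) :
    HasDerivWithinAt (fun τ => (Φ τ).symm (Y (c τ))) ((Φ t).symm (bracket X Y (c t)))
      (Icc a b) t := by
  have hd := contDiffWithinAt_hasDerivWithinAt (contDiffWithinAt_field hX hab hc hΦ hU hY ht htU)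
  have h1 := hΦ.bracketAlong_eq hX hab Subset.rfl ht (uniqueDiffOn_Icc hab t ht) hc
    (fun τ => Y (c τ)) hd.differentiableWithinAt
  have h2 := (bracketAlong_field hab hc hU hY ht htU).symm.trans h1
  have h3 : (Φ t).symm (bracket X Y (c t)) = derivWithin (fun τ => (Φ τ).symm (Y (c τ)))
      (Icc a b) t :=
    (congrArg (Φ t).symm h2).trans ((Φ t).symm_apply_apply _)
  exact hd.congr_deriv h3.symm

theorem isSectionAlong_iff (hX : SmoothOn X univ) (hab : a < b)
    (hc : IsMIntegralCurveOn c X (Icc a b)) (hΦ : IsInvariantFrame X c (Icc a b) Φ)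
    {J : Set ℝ} (hJ : IsOpen J) (W : ∀ t : ℝ, TangentSpace 𝓘(ℝ, E) (c t)) :
    IsSectionAlong 𝒱 c (Icc a b ∩ J) W ↔
      IsCurveSection (alongFrame 𝒱 c Φ) (Icc a b) J fun τ => (Φ τ).symm (W τ) := by
  have h : ∀ r ∈ Icc a b ∩ J, ContMDiffWithinAt 𝓘(ℝ, ℝ) 𝓘(ℝ, E).tangent ∞
      (fun t => (⟨c t, W t⟩ : TangentBundle 𝓘(ℝ, E) M)) (Icc a b ∩ J) r ↔
      ContDiffWithinAt ℝ ∞ (fun t => (Φ t).symm (W t)) (Icc a b) r := fun r hr =>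
    (hΦ.contMDiffWithinAt_iff hX hab inter_subset_left hr hc W).trans
      (contDiffWithinAt_inter (hJ.mem_nhds hr.2))
  constructor
  · exact fun hW r hr => ⟨(h r hr).1 (hW.1 r hr), symm_mem_alongFrame.2 (hW.2 r hr)⟩
  · exact fun hW => ⟨fun r hr => (h r hr).2 (hW r hr).1,
      fun r hr => symm_mem_alongFrame.1 (hW r hr).2⟩

theorem isSectionAlong_Icc_iff (hX : SmoothOn X univ) (hab : a < b)
    (hc : IsMIntegralCurveOn c X (Icc a b)) (hΦ : IsInvariantFrame X c (Icc a b) Φ)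
    (W : ∀ t : ℝ, TangentSpace 𝓘(ℝ, E) (c t)) :
    IsSectionAlong 𝒱 c (Icc a b) W ↔
      IsCurveSection (alongFrame 𝒱 c Φ) (Icc a b) univ fun τ => (Φ τ).symm (W τ) := by
  have h := isSectionAlong_iff (𝒱 := 𝒱) hX hab hc hΦ isOpen_univ W
  rwa [inter_univ] at h

/-- The bracket is taken over the window `[a, b] ∩ J`, the derivative over the whole interval; they
match because `J` is open. Agreement of the fields is required only on the window, so the statement
can be applied twice to obtain `[X, [X, W]]`. -/
theorem bracketAlong_of_eq (hX : SmoothOn X univ) (hab : a < b)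
    (hc : IsMIntegralCurveOn c X (Icc a b)) (hΦ : IsInvariantFrame X c (Icc a b) Φ)
    {J : Set ℝ} (hJ : IsOpen J) (ht : t ∈ Icc a b ∩ J)
    {W : ∀ t : ℝ, TangentSpace 𝓘(ℝ, E) (c t)} {w : ℝ → E}
    (hw : ContDiffWithinAt ℝ ∞ w (Icc a b) t)
    (heq : ∀ τ ∈ Icc a b ∩ J, (Φ τ).symm (W τ) = w τ) :
    (Φ t).symm (bracketAlong X c (Icc a b ∩ J) W t) = derivWithin w (Icc a b) t := by
  have hd : HasDerivWithinAt (fun τ => (Φ τ).symm (W τ)) (derivWithin w (Icc a b) t)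
      (Icc a b ∩ J) t :=
    ((contDiffWithinAt_hasDerivWithinAt hw).mono inter_subset_left).congr heq (heq t ht)
  have hu : UniqueDiffWithinAt ℝ (Icc a b ∩ J) t :=
    (uniqueDiffOn_Icc hab t ht.1).inter (hJ.mem_nhds ht.2)
  have h := hΦ.bracketAlong_eq hX hab inter_subset_left ht hu hc W hd.differentiableWithinAt
  refine (congrArg (Φ t).symm h).trans (((Φ t).symm_apply_apply _).trans (hd.derivWithin hu))

theorem isNormalAlong_iff (hX : SmoothOn X univ) (hab : a < b)
    (hc : IsMIntegralCurveOn c X (Icc a b)) (hΦ : IsInvariantFrame X c (Icc a b) Φ)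
    {J : Set ℝ} (hJ : IsOpen J) (W : ∀ t : ℝ, TangentSpace 𝓘(ℝ, E) (c t)) :
    IsNormalAlong X 𝒱 c (Icc a b ∩ J) W ↔
      IsCurveSection (alongFrame 𝒱 c Φ) (Icc a b) J (fun τ => (Φ τ).symm (W τ)) ∧
      ∀ r ∈ Icc a b ∩ J, derivWithin (derivWithin (fun τ => (Φ τ).symm (W τ)) (Icc a b))
        (Icc a b) r ∈ alongFrame 𝒱 c Φ r := by
  have hs := uniqueDiffOn_Icc hab
  rw [IsNormalAlong, isSectionAlong_iff hX hab hc hΦ hJ W]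
  refine and_congr_right fun hW => forall₂_congr fun r hr => ?_
  have h1 := bracketAlong_of_eq hX hab hc hΦ hJ hr
    (contDiffWithinAt_derivWithin hs hr.1 (hW r hr).1) fun τ hτ =>
    bracketAlong_of_eq hX hab hc hΦ hJ hτ (hW τ hτ).1 fun _ _ => rfl
  rw [← h1]
  exact symm_mem_alongFrame.symm

theorem mem_span_iff_of_equiv {A B : Type*} [AddCommGroup A] [Module ℝ A] [AddCommGroup B]
    [Module ℝ B] (e : A ≃ₗ[ℝ] B) {S : Set A} {S' : Set B} (h : ∀ x, e x ∈ S' ↔ x ∈ S) (x : A) :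
    e x ∈ Submodule.span ℝ S' ↔ x ∈ Submodule.span ℝ S := by
  have hS : S' = e '' S := by
    ext y
    constructor
    · exact fun hy => ⟨e.symm y, (h _).1 (by simpa using hy), by simp⟩
    · rintro ⟨x, hx, rfl⟩
      exact (h x).2 hx
  rw [hS, ← LinearEquiv.coe_coe, Submodule.span_image]
  simp

/-- The frame identifies local normal sections with local normal sections, hence the spanning sets
of the two horizontal spaces. -/
theorem mem_horizontal_iff (hX : SmoothOn X univ) (hab : a < b)
    (hc : IsMIntegralCurveOn c X (Icc a b)) (hΦ : IsInvariantFrame X c (Icc a b) Φ)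
    (ht : t ∈ Icc a b) (v : TangentSpace 𝓘(ℝ, E) (c t)) :
    v ∈ horizontal X 𝒱 c (Icc a b) t ↔
      (Φ t).symm v ∈ curveHorizontal (alongFrame 𝒱 c Φ) (Icc a b) t := by
  refine mem_span_iff_of_equiv (A := E) (Φ t).symm.toLinearEquiv ?_ v |>.symm
  intro x
  constructor
  · rintro ⟨J, w, hJ, htJ, hw, hn, hv⟩
    have hwΦ : (fun τ => (Φ τ).symm (Φ τ (w τ))) = w :=
      funext fun τ => (Φ τ).symm_apply_apply (w τ)
    have h1 := bracketAlong_of_eq hX hab hc hΦ hJ ⟨ht, htJ⟩ (W := fun τ => Φ τ (w τ))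
      (hw t ⟨ht, htJ⟩).1 fun τ _ => (Φ τ).symm_apply_apply (w τ)
    refine ⟨J, fun τ => Φ τ (w τ), hJ, htJ, (isNormalAlong_iff hX hab hc hΦ hJ _).2 ?_,
      (Φ t).symm.injective (hv.trans h1.symm)⟩
    rw [hwΦ]
    exact ⟨hw, hn⟩
  · rintro ⟨J, W, hJ, htJ, hW, rfl⟩
    have h := (isNormalAlong_iff hX hab hc hΦ hJ W).1 hW
    exact ⟨J, fun τ => (Φ τ).symm (W τ), hJ, htJ, h.1, h.2,
      bracketAlong_of_eq hX hab hc hΦ hJ ⟨ht, htJ⟩ (h.1 t ⟨ht, htJ⟩).1 fun _ _ => rfl⟩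

theorem hasCovDerivAlong_iff (hX : SmoothOn X univ) (hab : a < b)
    (hc : IsMIntegralCurveOn c X (Icc a b)) (hΦ : IsInvariantFrame X c (Icc a b) Φ)
    {V Z : ∀ t : ℝ, TangentSpace 𝓘(ℝ, E) (c t)} (hV : IsCurveSection (alongFrame 𝒱 c Φ)
      (Icc a b) univ fun τ => (Φ τ).symm (V τ)) :
    HasCovDerivAlong X 𝒱 c (Icc a b) V Z ↔
      IsCurveSection (alongFrame 𝒱 c Φ) (Icc a b) univ (fun τ => (Φ τ).symm (Z τ)) ∧
      ∀ r ∈ Icc a b, derivWithin (fun τ => (Φ τ).symm (V τ)) (Icc a b) r - (Φ r).symm (Z r) ∈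
        curveHorizontal (alongFrame 𝒱 c Φ) (Icc a b) r := by
  rw [HasCovDerivAlong, isSectionAlong_Icc_iff hX hab hc hΦ]
  refine and_congr_right fun _ => forall₂_congr fun r hr => ?_
  have h1 := bracketAlong_of_eq hX hab hc hΦ isOpen_univ (W := V) ⟨hr, trivial⟩
    (hV r ⟨hr, trivial⟩).1 fun _ _ => rfl
  rw [inter_univ] at h1
  rw [mem_horizontal_iff hX hab hc hΦ hr, ← h1]
  have e : ∀ x y : E, (Φ r).symm (x - y) = (Φ r).symm x - (Φ r).symm y := map_sub _
  exact iff_of_eq (congrArg (· ∈ curveHorizontal (alongFrame 𝒱 c Φ) (Icc a b) r) (e _ _))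

theorem isVerticalJacobi_iff (hX : SmoothOn X univ) (hab : a < b)
    (hc : IsMIntegralCurveOn c X (Icc a b)) (hΦ : IsInvariantFrame X c (Icc a b) Φ) {m : ℕ}
    (V : ∀ t : ℝ, TangentSpace 𝓘(ℝ, E) (c t)) :
    IsVerticalJacobi m X 𝒱 c (Icc a b) V ↔ IsCurveJacobi (alongFrame 𝒱 c Φ) (Icc a b)
      (alongCurvature m X 𝒱 c Φ) fun τ => (Φ τ).symm (V τ) := by
  have hsurj : ∀ d : ℝ → E, ∃ D : ∀ t : ℝ, TangentSpace 𝓘(ℝ, E) (c t),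
      (fun τ => (Φ τ).symm (D τ)) = d := fun d =>
    ⟨fun τ => Φ τ (d τ), funext fun τ => (Φ τ).symm_apply_apply (d τ)⟩
  have hsum : ∀ r, ∀ x y : E, x + y = 0 ↔ (Φ r).symm x + (Φ r).symm y = 0 := fun r x y => by
    rw [← map_add, EmbeddingLike.map_eq_zero_iff]
  constructor
  · rintro ⟨hV, D, DD, KV, hD, hDD, hK, h0⟩
    have hV' := (isSectionAlong_Icc_iff hX hab hc hΦ V).1 hV
    have hD' := (hasCovDerivAlong_iff hX hab hc hΦ hV').1 hD
    have hDD' := (hasCovDerivAlong_iff hX hab hc hΦ hD'.1).1 hDD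
    exact ⟨hV', fun τ => (Φ τ).symm (D τ), fun τ => (Φ τ).symm (DD τ),
      fun τ => (Φ τ).symm (KV τ), hD', hDD', fun r hr => alongCurvature_symm.2 (hK r hr),
      fun r hr => (hsum r _ _).1 (h0 r hr)⟩
  · rintro ⟨hV, d, dd, k, hd, hdd, hK, h0⟩
    obtain ⟨D, rfl⟩ := hsurj d
    obtain ⟨DD, rfl⟩ := hsurj dd
    obtain ⟨KV, rfl⟩ := hsurj k
    exact ⟨(isSectionAlong_Icc_iff hX hab hc hΦ V).2 hV, D, DD, KV,
      (hasCovDerivAlong_iff hX hab hc hΦ hV).2 hd, (hasCovDerivAlong_iff hX hab hc hΦ hd.1).2 hdd,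
      fun r hr => alongCurvature_symm.1 (hK r hr), fun r hr => (hsum r _ _).2 (h0 r hr)⟩

end Along

end DynPair

namespace DynPair

/-! ### Frames of the distribution along an integral curve -/

section FrameAlong

variable {E : Type*} [NormedAddCommGroup E] [NormedSpace ℝ E]
  {M : Type*} [TopologicalSpace M] [ChartedSpace E M] [IsManifold 𝓘(ℝ, E) ∞ M]
  {X : ∀ x : M, TangentSpace 𝓘(ℝ, E) x} {c : ℝ → M} {a b t : ℝ} {Φ : ℝ → E ≃L[ℝ] E}
  {𝒱 : ∀ x : M, Submodule ℝ (TangentSpace 𝓘(ℝ, E) x)} {m : ℕ}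
  {e : Fin m → ∀ x : M, TangentSpace 𝓘(ℝ, E) x} {U : Set M}

theorem hasDerivWithinAt_comp_integralCurve {s : Set ℝ} (hc : IsMIntegralCurveOn c X s)
    (ht : t ∈ s) {g : M → ℝ} (hg : MDifferentiableAt 𝓘(ℝ, E) 𝓘(ℝ, ℝ) g (c t)) :
    HasDerivWithinAt (fun τ => g (c τ))
      (NormedSpace.fromTangentSpace _ (mfderiv 𝓘(ℝ, E) 𝓘(ℝ, ℝ) g (c t) (X (c t)))) s t := by
  let L : E →L[ℝ] ℝ := mfderiv 𝓘(ℝ, E) 𝓘(ℝ, ℝ) g (c t)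
  let x : E := X (c t)
  have h : HasFDerivWithinAt (fun τ => g (c τ)) (L.comp ((1 : ℝ →L[ℝ] ℝ).smulRight x)) s t :=
    (hg.hasMFDerivAt.comp_hasMFDerivWithinAt t (hc t ht)).hasFDerivWithinAt
  exact h.hasDerivWithinAt.congr_deriv (congrArg L (one_smul ℝ x))

theorem span_symm_eq_alongFrame (he : IsFrameOn 𝒱 e U) {τ : ℝ} (hτ : c τ ∈ U) :
    alongFrame 𝒱 c Φ τ = Submodule.span ℝ (range fun i => (Φ τ).symm (e i (c τ))) := by
  ext v
  have h := mem_span_iff_of_equiv (Φ τ).toLinearEquiv (S' := range fun i => (e i (c τ) : E))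
    (S := range fun i => (Φ τ).symm (e i (c τ) : E)) (fun x => by
      constructor
      · rintro ⟨i, hi⟩
        exact ⟨i, (Φ τ).symm_apply_eq.2 hi⟩
      · rintro ⟨i, rfl⟩
        exact ⟨i, ((Φ τ).apply_symm_apply _).symm⟩) v
  refine Iff.trans ?_ h
  change Φ τ v ∈ 𝒱 (c τ) ↔ _
  rw [← (he.2 _ hτ).2]
  rfl

variable [FiniteDimensional ℝ E]

/-- Ensures that any matrices `H₀`, `H₁` occurring in the definition of a curvature matrix agree on
`U` with the smooth ones, and so give the same curvature. -/
theorem structure_coeff_unique (hreg : IsRegular X 𝒱 m) (hU : IsOpen U) (he : IsFrameOn 𝒱 e U)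
    {x : M} (hx : x ∈ U) {A₀ A₁ B₀ B₁ : Fin m → ℝ}
    (h : ∑ i, A₀ i • e i x + ∑ i, A₁ i • bracket X (e i) x =
      ∑ i, B₀ i • e i x + ∑ i, B₁ i • bracket X (e i) x) : A₀ = B₀ ∧ A₁ = B₁ := by
  have hli := linearIndependent_iff_injective_fintypeLinearCombination.1
    (linearIndependent_prolong hreg hU he hx)
  have h2 := @hli (Sum.elim A₀ A₁) (Sum.elim B₀ B₁) (by
    simp only [Fintype.linearCombination_apply, Fintype.sum_sum_type]
    exact h)
  exact ⟨funext fun i => congrFun h2 (Sum.inl i), funext fun i => congrFun h2 (Sum.inr i)⟩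

/-- A frame of `𝒱` defines a moving frame along `c`, with the same curvature matrix. -/
theorem exists_isMovingFrame (hX : SmoothOn X univ) (hab : a < b)
    (hc : IsMIntegralCurveOn c X (Icc a b)) (hΦ : IsInvariantFrame X c (Icc a b) Φ)
    (hreg : IsRegular X 𝒱 m) (hU : IsOpen U) (he : IsFrameOn 𝒱 e U) (ht : t ∈ Icc a b)
    (htU : c t ∈ U) :
    ∃ (J : Set ℝ) (P₁ : ℝ → (Fin m → ℝ) →L[ℝ] E) (h₀ h₁ : ℝ → (Fin m → ℝ) →L[ℝ] (Fin m → ℝ)),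
      t ∈ J ∧ IsMovingFrame (alongFrame 𝒱 c Φ) (Icc a b) J
        (fun τ => combination fun i => (Φ τ).symm (e i (c τ))) P₁ h₀ h₁ ∧
      (∃ A, HasCurvatureMatrix X e U (c t) A) ∧
      ∀ A, HasCurvatureMatrix X e U (c t) A → ∀ v, frameCurvature (Icc a b) h₀ h₁ t v =
        A.mulVec v := by
  obtain ⟨H₀, H₁, hstr, hH₀, hH₁⟩ := exists_structure_equations hX hreg hU he
  have hcs := contMDiffOn_integralCurve hX hab hc
  obtain ⟨J, hJ, hJU⟩ := continuousOn_iff'.1 hcs.continuousOn U hU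
  have htJ : t ∈ J := by
    have : t ∈ J ∩ Icc a b := hJU ▸ ⟨htU, ht⟩
    exact this.1
  have hcU : ∀ τ ∈ Icc a b ∩ J, c τ ∈ U := fun τ hτ => by
    have : τ ∈ c ⁻¹' U ∩ Icc a b := hJU ▸ ⟨hτ.2, hτ.1⟩
    exact this.1
  have hsmooth : ∀ g : M → ℝ, ContMDiffOn 𝓘(ℝ, E) 𝓘(ℝ, ℝ) ∞ g U → ∀ τ ∈ Icc a b ∩ J,
      ContDiffWithinAt ℝ ∞ (fun τ => g (c τ)) (Icc a b) τ := fun g hg τ hτ =>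
    (((hg _ (hcU τ hτ)).contMDiffAt (hU.mem_nhds (hcU τ hτ))).comp_contMDiffWithinAt τ
      (hcs τ hτ.1)).contDiffWithinAt
  have hbs : ∀ i, SmoothOn (bracket X (e i)) U := fun i => hX.bracket hU (he.1 i)
  have hlin : ∀ τ, ∀ (x y : Fin m → E) (A B : Fin m → ℝ) (z : E),
      z = ∑ i, A i • x i + ∑ i, B i • y i → (Φ τ).symm z =
        ∑ i, A i • (Φ τ).symm (x i) + ∑ i, B i • (Φ τ).symm (y i) := by
    rintro τ x y A B z rfl
    simp
  refine ⟨J, _, _, _, htJ, isMovingFrame_of_vectors hJ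
    (e := fun i τ => (Φ τ).symm (e i (c τ))) (f := fun i τ => (Φ τ).symm (bracket X (e i) (c τ)))
    (H₀ := fun τ => H₀ (c τ)) (H₁ := fun τ => H₁ (c τ))
    (fun τ hτ i => contDiffWithinAt_field hX hab hc hΦ hU (he.1 i) hτ.1 (hcU τ hτ))
    (fun τ hτ i => contDiffWithinAt_field hX hab hc hΦ hU (hbs i) hτ.1 (hcU τ hτ))
    (fun τ hτ i j => hsmooth _ (hH₀ i j) τ hτ) (fun τ hτ i j => hsmooth _ (hH₁ i j) τ hτ)
    (fun τ hτ i => hasDerivWithinAt_field hX hab hc hΦ hU (he.1 i) hτ.1 (hcU τ hτ))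
    (fun τ hτ j => ?_) (fun τ hτ => ?_)
    (fun τ hτ => span_symm_eq_alongFrame he (hcU τ hτ)), ⟨_, H₀, H₁, hstr, rfl⟩, ?_⟩
  · refine (hasDerivWithinAt_field hX hab hc hΦ hU (hbs j) hτ.1 (hcU τ hτ)).congr_deriv ?_
    exact hlin τ (fun i => e i (c τ)) (fun i => bracket X (e i) (c τ)) (fun i => H₀ (c τ) i j)
      (fun i => H₁ (c τ) i j) _ (hstr _ (hcU τ hτ) j)
  · have h1 : LinearIndependent ℝ fun k => (prolong X e k (c τ) : E) :=
      linearIndependent_prolong hreg hU he (hcU τ hτ)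
    have h2 := h1.map' (Φ τ).symm.toLinearEquiv.toLinearMap (LinearEquiv.ker _)
    have h3 : (Sum.elim (fun i => (Φ τ).symm (e i (c τ)))
        fun i => (Φ τ).symm (bracket X (e i) (c τ))) =
        fun k => (Φ τ).symm (prolong X e k (c τ) : E) := by
      funext k
      rcases k with i | i <;> rfl
    rw [h3]
    exact h2
  · rintro A ⟨G₀, G₁, hG, rfl⟩ v
    have heq : ∀ y ∈ U, G₀ y = H₀ y ∧ G₁ y = H₁ y := fun y hy => by
      have := fun j => structure_coeff_unique hreg hU he hy ((hG y hy j).symm.trans (hstr y hy j))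
      exact ⟨Matrix.ext fun i j => congrFun (this j).1 i, Matrix.ext fun i j =>
        congrFun (this j).2 i⟩
    -- The coefficients agree on the open set `U`, hence have the same derivative at `c t`.
    have hd : derivMatrix X G₁ (c t) = derivMatrix X H₁ (c t) := by
      ext i j
      have hev : (fun y => G₁ y i j) =ᶠ[𝓝 (c t)] fun y => H₁ y i j := by
        filter_upwards [hU.mem_nhds htU] with y hy
        rw [(heq y hy).2]
      simp only [derivMatrix, Matrix.of_apply]
      rw [hev.mfderiv_eq]
      rfl
    rw [(heq _ htU).1, (heq _ htU).2, hd]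
    refine frameCurvature_combination (H₀ := fun τ => H₀ (c τ)) (H₁ := fun τ => H₁ (c τ))
      (uniqueDiffOn_Icc hab t ht) (fun i j => ?_) v
    exact hasDerivWithinAt_comp_integralCurve hc ht
      (((hH₁ i j _ htU).contMDiffAt (hU.mem_nhds htU)).mdifferentiableAt (by simp))

/-- The frame of `𝒱` that witnesses the curvature relation may vary with `t`; it is used as the
moving frame near `t`, so no comparison of frames is needed. -/
theorem exists_of_alongCurvature (hX : SmoothOn X univ) (hab : a < b)
    (hc : IsMIntegralCurveOn c X (Icc a b)) (hΦ : IsInvariantFrame X c (Icc a b) Φ)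
    (hreg : IsRegular X 𝒱 m) (ht : t ∈ Icc a b) {v k : E}
    (hvk : alongCurvature m X 𝒱 c Φ t v k) :
    ∃ (J : Set ℝ) (P P₁ : ℝ → (Fin m → ℝ) →L[ℝ] E) (h₀ h₁ : ℝ → (Fin m → ℝ) →L[ℝ] (Fin m → ℝ)),
      t ∈ J ∧ IsMovingFrame (alongFrame 𝒱 c Φ) (Icc a b) J P P₁ h₀ h₁ ∧
      ∃ x, v = P t x ∧ k = P t (frameCurvature (Icc a b) h₀ h₁ t x) := by
  obtain ⟨U, e, A, x, hU, htU, he, hA, hv, hk⟩ := hvk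
  obtain ⟨J, P₁, h₀, h₁, htJ, hf, -, hcurv⟩ := exists_isMovingFrame hX hab hc hΦ hreg hU he ht htU
  have hlin : ∀ (z : E) (y : Fin m → E) (x : Fin m → ℝ), Φ t z = ∑ i, x i • y i →
      z = combination (fun i => (Φ t).symm (y i)) x := fun z y x h => by
    rw [combination_apply, ← (Φ t).symm_apply_apply z, h]
    simp
  refine ⟨J, _, P₁, h₀, h₁, htJ, hf, x, hlin v (fun i => e i (c t)) x hv, ?_⟩
  rw [hcurv A hA]
  exact hlin k (fun i => e i (c t)) _ hk

theorem exists_alongCurvature (hX : SmoothOn X univ) (hab : a < b)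
    (hc : IsMIntegralCurveOn c X (Icc a b)) (hΦ : IsInvariantFrame X c (Icc a b) Φ)
    (h𝒱 : IsDistribution 𝒱 m) (hreg : IsRegular X 𝒱 m) (ht : t ∈ Icc a b) :
    ∃ (J : Set ℝ) (P P₁ : ℝ → (Fin m → ℝ) →L[ℝ] E) (h₀ h₁ : ℝ → (Fin m → ℝ) →L[ℝ] (Fin m → ℝ)),
      t ∈ J ∧ IsMovingFrame (alongFrame 𝒱 c Φ) (Icc a b) J P P₁ h₀ h₁ ∧
      ∀ x, alongCurvature m X 𝒱 c Φ t (P t x) (P t (frameCurvature (Icc a b) h₀ h₁ t x)) := by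
  obtain ⟨U, hU, htU, e, he⟩ := h𝒱 (c t)
  obtain ⟨J, P₁, h₀, h₁, htJ, hf, ⟨A, hA⟩, hcurv⟩ :=
    exists_isMovingFrame hX hab hc hΦ hreg hU he ht htU
  have hlin : ∀ (y : Fin m → E) (x : Fin m → ℝ),
      Φ t (combination (fun i => (Φ t).symm (y i)) x) = ∑ i, x i • y i := fun y x => by
    rw [combination_apply]
    simp
  refine ⟨J, _, P₁, h₀, h₁, htJ, hf, fun x => ⟨U, e, A, x, hU, htU, he, hA,
    hlin (fun i => e i (c t)) x, ?_⟩⟩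
  rw [hcurv A hA]
  exact hlin (fun i => e i (c t)) _

end FrameAlong

/-! ### Conjugate times -/

section Conjugate

variable {E : Type*} [NormedAddCommGroup E] [NormedSpace ℝ E] [FiniteDimensional ℝ E]
  {M : Type*} [TopologicalSpace M] [T2Space M] [ChartedSpace E M] [IsManifold 𝓘(ℝ, E) ∞ M]
  {X : ∀ x : M, TangentSpace 𝓘(ℝ, E) x} {c : ℝ → M} {t : ℝ} {Φ : ℝ → E ≃L[ℝ] E}
  {𝒱 : ∀ x : M, Submodule ℝ (TangentSpace 𝓘(ℝ, E) x)}

/-- The differential of the flow is `Φ t ∘ (Φ 0)⁻¹`, so `Φ t z` is the image of a vector of `𝒱(c 0)`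
exactly if `Φ 0 z ∈ 𝒱(c 0)`. -/
theorem mem_conjugateSpace_iff (hX : SmoothOn X univ) (ht : 0 < t)
    (hc : IsMIntegralCurveOn c X (Icc 0 t)) (hΦ : IsInvariantFrame X c (Icc 0 t) Φ) (z : E) :
    (Φ t z : TangentSpace 𝓘(ℝ, E) (flow X t (c 0))) ∈ conjugateSpace X 𝒱 (c 0) t ↔
      z ∈ alongFrame 𝒱 c Φ 0 ⊓ alongFrame 𝒱 c Φ t := by
  have : CompleteSpace E := FiniteDimensional.complete ℝ E
  have hd := (hasMFDerivAt_flow hX ht hc hΦ).mfderiv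
  have hmem : ∀ {x y : M} (_ : x = y) (v : E),
      ((v : TangentSpace 𝓘(ℝ, E) x) ∈ 𝒱 x ↔ (v : TangentSpace 𝓘(ℝ, E) y) ∈ 𝒱 y) := by
    rintro x _ rfl v; rfl
  refine and_congr ?_ (hmem (flow_eq hX ht hc) (Φ t z))
  have happ : ∀ v : E, (mfderiv 𝓘(ℝ, E) 𝓘(ℝ, E) (flow X t) (c 0) v : E) = Φ t ((Φ 0).symm v) :=
    fun v => congrArg (fun L : E →L[ℝ] E => L v) hd
  constructor
  · rintro ⟨v, hv, hvz⟩
    have h1 : Φ t ((Φ 0).symm v) = Φ t z := (happ v).symm.trans hvz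
    have h2 : (Φ 0).symm v = z := (Φ t).injective h1
    rw [← h2]
    exact symm_mem_alongFrame.2 hv
  · intro hz
    refine ⟨Φ 0 z, hz, (happ (Φ 0 z)).trans ?_⟩
    exact congrArg (Φ t) ((Φ 0).symm_apply_apply z)

/-- The conjugate space, in an invariant frame. -/
theorem exists_equiv_conjugateSpace (hX : SmoothOn X univ) (ht : 0 < t)
    (hc : IsMIntegralCurveOn c X (Icc 0 t)) (hΦ : IsInvariantFrame X c (Icc 0 t) Φ) :
    Nonempty (↥(alongFrame 𝒱 c Φ 0 ⊓ alongFrame 𝒱 c Φ t) ≃ₗ[ℝ] conjugateSpace X 𝒱 (c 0) t) := by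
  refine ⟨LinearEquiv.ofSubmodules (M := E) (M₂ := E) (Φ t).toLinearEquiv _
    (conjugateSpace X 𝒱 (c 0) t) ?_⟩
  refine Submodule.ext fun v => ?_
  constructor
  · rintro ⟨z, hz, rfl⟩
    exact (mem_conjugateSpace_iff hX ht hc hΦ z).2 hz
  · intro hv
    have e : Φ t ((Φ t).symm v) = v := (Φ t).apply_symm_apply v
    exact ⟨(Φ t).symm v, (mem_conjugateSpace_iff hX ht hc hΦ _).1
      ((congrArg (fun u : TangentSpace 𝓘(ℝ, E) (flow X t (c 0)) =>
        u ∈ conjugateSpace X 𝒱 (c 0) t) e).mpr hv), e⟩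

end Conjugate

end DynPair

/-! ### Jacobi fields and conjugate times: the main theorem -/

theorem mainTheorem7
    {E : Type*} [NormedAddCommGroup E] [NormedSpace ℝ E] [FiniteDimensional ℝ E]
    {M : Type*} [TopologicalSpace M] [T2Space M] [ChartedSpace E M] [IsManifold 𝓘(ℝ, E) ∞ M]
    (X : ∀ x : M, TangentSpace 𝓘(ℝ, E) x) (hX : DynPair.SmoothOn X univ)
    (𝒱 : ∀ x : M, Submodule ℝ (TangentSpace 𝓘(ℝ, E) x)) (m : ℕ)
    (h𝒱 : DynPair.IsDistribution 𝒱 m) (hreg : DynPair.IsRegular X 𝒱 m)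
    (c : ℝ → M) (T : ℝ) (hc : IsMIntegralCurveOn c X (Icc 0 T))
    (t : ℝ) (ht : t ∈ Ioc 0 T) :
    (DynPair.IsConjugateTime X 𝒱 (c 0) t ↔
      ∃ V : ∀ r : ℝ, TangentSpace 𝓘(ℝ, E) (c r),
        DynPair.IsVerticalJacobi m X 𝒱 c (Icc 0 T) V ∧ (∃ r ∈ Icc 0 T, V r ≠ 0) ∧
          V 0 = 0 ∧ V t = 0) ∧
    -- fields along `c : [0, T] → M` are represented by their extension by zero to `ℝ`
    ∃ J : Submodule ℝ (∀ r : ℝ, TangentSpace 𝓘(ℝ, E) (c r)),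
      (∀ V, V ∈ J ↔ DynPair.IsVerticalJacobi m X 𝒱 c (Icc 0 T) V ∧ (∀ r ∉ Icc 0 T, V r = 0) ∧
        V 0 = 0 ∧ V t = 0) ∧
      Module.Finite ℝ J ∧ DynPair.multiplicity X 𝒱 (c 0) t = Module.finrank ℝ J := by
  have hT : 0 < T := ht.1.trans_le ht.2
  have ht' : t ∈ Icc 0 T := ⟨ht.1.le, ht.2⟩
  obtain ⟨Φ, hΦ⟩ := DynPair.exists_isInvariantFrame hX hT hc
  have hK := fun (r : ℝ) (hr : r ∈ Icc 0 T) (v k : E) hvk =>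
    DynPair.exists_of_alongCurvature (v := v) (k := k) hX hT hc hΦ hreg hr hvk
  have hK' := fun (r : ℝ) (hr : r ∈ Icc 0 T) =>
    DynPair.exists_alongCurvature hX hT hc hΦ h𝒱 hreg hr
  obtain ⟨L, hLinj, hL⟩ := DynPair.exists_jacobi_linearMap hT hK hK' ht'
  have hsub : Icc 0 t ⊆ Icc 0 T := Icc_subset_Icc le_rfl ht.2
  -- The flow only concerns `[0, t]`, the Jacobi fields live on `[0, T]`; one frame over `[0, T]`
  -- serves both.
  obtain ⟨ψ⟩ := DynPair.exists_equiv_conjugateSpace (𝒱 := 𝒱) hX ht.1 (hc.mono hsub)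
    fun v r hr => (hΦ v r (hsub hr)).mono hsub
  have hJac := DynPair.isVerticalJacobi_iff (𝒱 := 𝒱) (m := m) hX hT hc hΦ
  have hzero : ∀ r, ∀ x : E, (Φ r).symm x = 0 ↔ x = 0 := fun r x =>
    EmbeddingLike.map_eq_zero_iff
  let Ψ : (ℝ → E) ≃ₗ[ℝ] (∀ r : ℝ, TangentSpace 𝓘(ℝ, E) (c r)) :=
    LinearEquiv.piCongrRight fun r => (Φ r).toLinearEquiv
  have hmem : ∀ V, V ∈ (LinearMap.range L).map Ψ.toLinearMap ↔
      DynPair.IsVerticalJacobi m X 𝒱 c (Icc 0 T) V ∧ (∀ r ∉ Icc 0 T, V r = 0) ∧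
        V 0 = 0 ∧ V t = 0 := fun V => by
    refine (Submodule.mem_map_equiv (LinearMap.range L) (e := Ψ)).trans ((hL (Ψ.symm V)).trans ?_)
    exact and_congr (hJac V).symm (and_congr (forall₂_congr fun r _ => hzero r (V r))
      (and_congr (hzero 0 (V 0)) (hzero t (V t))))
  have hfin : Module.Finite ℝ ↥((LinearMap.range L).map Ψ.toLinearMap) := inferInstance
  have hrank : DynPair.multiplicity X 𝒱 (c 0) t =
      Module.finrank ℝ ↥((LinearMap.range L).map Ψ.toLinearMap) :=
    ψ.finrank_eq.symm.trans ((LinearMap.finrank_range_of_inj hLinj).symm.trans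
      (Ψ.finrank_map_eq (LinearMap.range L)).symm)
  refine ⟨?_, _, hmem, hfin, hrank⟩
  have hconj : DynPair.IsConjugateTime X 𝒱 (c 0) t ↔
      (LinearMap.range L).map Ψ.toLinearMap ≠ ⊥ := by
    have : FiniteDimensional ℝ (TangentSpace 𝓘(ℝ, E) (DynPair.flow X t (c 0))) :=
      inferInstanceAs (FiniteDimensional ℝ E)
    rw [DynPair.IsConjugateTime, ne_eq, ne_eq, ← Submodule.finrank_eq_zero (R := ℝ),
      ← Submodule.finrank_eq_zero (R := ℝ), ← hrank]
    rfl
  rw [hconj, Submodule.ne_bot_iff]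
  constructor
  · rintro ⟨V, hV, hne⟩
    obtain ⟨hVJ, hV0, hV1, hV2⟩ := (hmem V).1 hV
    obtain ⟨r, hr⟩ := Function.ne_iff.1 hne
    exact ⟨V, hVJ, ⟨r, by_contra fun h => hr (hV0 r h), hr⟩, hV1, hV2⟩
  · rintro ⟨V, hVJ, ⟨r, hr, hVr⟩, hV1, hV2⟩
    classical
    -- The given field may be arbitrary outside `[0, T]`; truncation brings it into the normal form
    -- of extension by zero. The truncated field is still Jacobi because it has the same symbol
    -- relation on `[0, T]`.
    let V' : ∀ r : ℝ, TangentSpace 𝓘(ℝ, E) (c r) := fun r => if r ∈ Icc 0 T then V r else 0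
    have hV' : ∀ r ∈ Icc 0 T, V' r = V r := fun r hr => if_pos hr
    have hV'J : DynPair.IsVerticalJacobi m X 𝒱 c (Icc 0 T) V' := by
      obtain ⟨z, hz⟩ := ((hJac V).1 hVJ).exists_symbolRel hT hK
      refine (hJac V').2 (DynPair.exists_isCurveJacobi hT hK' (z := z) fun r hr => ?_)
      have e : (Φ r).symm (V' r) = (Φ r).symm (V r) := congrArg (Φ r).symm (hV' r hr)
      rw [e]
      exact hz r hr
    refine ⟨V', (hmem V').2 ⟨hV'J, fun r hr => if_neg hr, ?_, ?_⟩, fun h => hVr ?_⟩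
    · exact (hV' 0 ⟨le_rfl, hT.le⟩).trans hV1
    · exact (hV' t ht').trans hV2
    · exact (hV' r hr).symm.trans (congrFun h r)
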